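/- Let $[n]=\{1,\dots,n\}$ and let $d_{\mathrm{TV}}(P,Q)=\frac12\sum_{x\in[n]}|P(x)-Q(x)|$ for distributions $P,Q$ on $[n]$. For every $\varepsilon_0<1$ there is a constant $c>0$, depending only on $\varepsilon_0$, such that the following holds for all integers $n\ge 2$, $k\ge 100$, $1\le r\le k-1$ and all $\varepsilon\in(0,\varepsilon_0]$. An algorithm has sample access to $k$ distributions $D_1,\dots,D_k$ on $[n]$, where for an unknown subset $\mathcal I\subseteq[k]$ of size $r$ one has $D_i=P$ for $i\in\mathcal I$ and $D_i=Q$ for $i\in[k]\setminus\mathcal I$, with $d_{\mathrm{TV}}(P,Q)\ge\varepsilon$. The algorithm may be randomized and fully adaptive (at each step it chooses, depending on everything seen so far, which $D_i$ to sample next or to stop), and it may know $n,k,r,\varepsilon$. Let $T$ be the maximal total number of samples that it draws. (a) Suppose $\varepsilon\le 1-\frac1n$. If, for every $P$ with $d_{\mathrm{TV}}(P,U)\ge\varepsilon$ and every $\mathcal I$ of size $r$, the algorithm returns the partition $\{\mathcal I,[k]\setminus\mathcal I\}$ with probability at least $0.9$ when $Q=U$ is the uniform distribution on $[n]$, then $$T\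 \ge\ c\,\frac{k+\sqrt{nk}}{\varepsilon^2}.$$ (The case in which $P$ is the uniform distribution is the same with $r$ replaced by $k-r$.) (b) If, for every pair $P,Q$ with $d_{\mathrm{TV}}(P,Q)\ge\varepsilon$ and every $\mathcal I$ of size $r$, the algorithm returns $\{\mathcal I,[k]\setminus\mathcal I\}$ with probability at least $0.9$, then $$T\ \ge\ c\left(\Big(\frac{kn^2}{\varepsilon^4}\Big)^{1/3}+\frac{k+\sqrt{nk}}{\varepsilon^2}\right).$$ -/

import Mathlib

open scoped ENNReal

namespace DistClustering

/-- Total variation distance between two distributions on `[n]`. -/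
noncomputable def tvDist {n : ℕ} (P Q : PMF (Fin n)) : ℝ :=
  (1 / 2) * ∑ x, |(P x).toReal - (Q x).toReal|

/-- `Q` is the uniform distribution on `[n]`. -/
def IsUniform {n : ℕ} (Q : PMF (Fin n)) : Prop :=
  ∀ x, Q x = (n : ℝ≥0∞)⁻¹

/-- The `k` distributions determined by `I`, `P`, `Q`: `D i = P` for `i ∈ I`, `D i = Q` otherwise. -/
def clustered {n k : ℕ} (I : Finset (Fin k)) (P Q : PMF (Fin n)) (i : Fin k) : PMF (Fin n) :=
  if i ∈ I then P else Q

/-- What an algorithm may do next: draw a fresh sample from one of the `k` distributions, or stop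
and return a family of subsets of `[k]` (its guess for the partition). -/
inductive Action (k : ℕ) : Type where
  | draw (i : Fin k) : Action k
  | answer (guess : Finset (Finset (Fin k))) : Action k

/-- A randomized, fully adaptive algorithm. The next action is random, with a law that may depend
arbitrarily on everything seen so far: the list, latest first, of all pairs (index of the
distribution sampled, outcome observed). There are finitely many actions and the history records
all earlier ones, so internal coins, shared or remembered across rounds, give nothing beyond
this. -/
def Algorithm (n k : ℕ) : Type :=
  List (Fin k × Fin n) → PMF (Action k)

/-- Law of the outcome when `A`, having seen the history, continues on the distributions `D` with
at most `T` further samples. The value is `some guess` if `A` stops within this budget and returns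
`guess`, and `none` if `A` asks for a sample after the budget is used up. -/
noncomputable def Algorithm.run {n k : ℕ} (A : Algorithm n k) (D : Fin k → PMF (Fin n)) :
    ℕ → List (Fin k × Fin n) → PMF (Option (Finset (Finset (Fin k))))
  | 0, h => (A h).bind fun a =>
      match a with
      | .draw _ => PMF.pure none
      | .answer g => PMF.pure (some g)
  | T + 1, h => (A h).bind fun a =>
      match a with
      | .draw i => (D i).bind fun x => Algorithm.run A D T ((i, x) :: h)
      | .answer g => PMF.pure (some g)

/-- For all pairs `(P, Q)` in the class `C` and all sets `I` of exactly `r` indices, `A` uses at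
most `T` samples and returns the partition `{I, [k] \ I}`, with probability at least `0.9`. -/
def Algorithm.Recovers {n k : ℕ} (A : Algorithm n k) (T r : ℕ)
    (C : Set (PMF (Fin n) × PMF (Fin n))) : Prop :=
  ∀ P Q : PMF (Fin n), (P, Q) ∈ C → ∀ I : Finset (Fin k), I.card = r →
    (9 / 10 : ℝ≥0∞) ≤ A.run (clustered I P Q) T [] (some {I, Iᶜ})

/-- Both distributions unknown: all pairs at total variation distance at least `ε`. -/
def bothUnknown (n : ℕ) (ε : ℝ) : Set (PMF (Fin n) × PMF (Fin n)) :=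
  {p | ε ≤ tvDist p.1 p.2}

/-- One distribution uniform: all such pairs whose second member is the uniform distribution. -/
def oneUniform (n : ℕ) (ε : ℝ) : Set (PMF (Fin n) × PMF (Fin n)) :=
  {p | ε ≤ tvDist p.1 p.2 ∧ IsUniform p.2}

end DistClustering

/-! The proof is a two-point argument at a single index. Take a set `J` of size `r - 1` or `r + 1`
such that for at least half of the indices `j`, flipping the membership of `j` gives a set of size
`r`. The algorithm is run on `J`, which is not a legal input. Its at most `T` draws are shared among
`k` distributions, so for most of these `j` the distribution `D j` is drawn only O(T/k) times in
expectation. Suppose that O(T/k) samples from `D j` do not reveal whether `D j` is `P` or `Q`, even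
next to O(T) samples from each of `P` and `Q`. Then the run on `J` looks like the run on the legal
input `J ∆ {j}`, and the answer must be the partition of `J ∆ {j}` with probability above 1/2. Two
such indices demand two different partitions, a contradiction. This is `HardFamily.not_close`, built
on `HardFamily.priorSum_val_le`.

To make the indistinguishability computable, samples are read from three tapes (one for `P`, one for
`Q`, one for `D j`), the tape lengths are Poisson, and the pair `(P, Q)` is random with independent
masses in the bins. The joint law of the counts is then a product over bins, so the Bhattacharyya
coefficient of the two hypotheses is a product too (`tsum_sqrt_mixWeight`), and all that remains is
a Hellinger estimate in one bin. Independent masses sum to 1 only approximately; normalization and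
the distance condition hold on a good event controlled by Chebyshev.

Three families give the three terms. A fixed pair at squared Hellinger distance O(ε²) gives k/ε²
(`le_of_pair`). For √(nk)/ε², `Q` is uniform and each bin of `P` is lowered by the factor 1 - δ,
except for a random fraction `p` of bins that compensate (`affinity_perturbed`). For the cube root,
`P` and `Q` carry opposite random signs on light bins, hidden among a fraction `p` of heavy bins on
which they agree; the heavy bins account for most repeated samples, so correlating the tapes is
expensive (`affinity_heavy`). The parameter `p` of the last family is tuned to the bound sought
(`cbrt_le`). -/

open scoped ENNReal

namespace DistClustering

variable {n k : ℕ}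

/-! ### Values of a run; reading the samples from tapes and bounding them by quotas. -/

/-- Expected score of the outcome of a run, for the score function `F`. -/
noncomputable def Algorithm.val (A : Algorithm n k) (D : Fin k → PMF (Fin n))
    (F : Option (Finset (Finset (Fin k))) → ℝ≥0∞) (T : ℕ) (h : List (Fin k × Fin n)) : ℝ≥0∞ :=
  ∑' o, A.run D T h o * F o

theorem tsum_bind_mul {α β : Type*} (p : PMF α) (f : α → PMF β) (F : β → ℝ≥0∞) :
    ∑' b, (p.bind f) b * F b = ∑' a, p a * ∑' b, f a b * F b := by
  simp only [PMF.bind_apply, ← ENNReal.tsum_mul_right, ← ENNReal.tsum_mul_left]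
  rw [ENNReal.tsum_comm]
  simp only [mul_assoc]

theorem tsum_pure_mul {β : Type*} (b : β) (F : β → ℝ≥0∞) :
    ∑' c, (PMF.pure b) c * F c = F b := by
  rw [tsum_eq_single b]
  · simp
  · intro c hc
    simp [PMF.pure_apply, hc]

theorem Algorithm.val_zero (A : Algorithm n k) (D : Fin k → PMF (Fin n))
    (F : Option (Finset (Finset (Fin k))) → ℝ≥0∞) (h : List (Fin k × Fin n)) :
    A.val D F 0 h = ∑' a, A h a * (match a with
      | .draw _ => F none
      | .answer g => F (some g)) := by
  unfold Algorithm.val Algorithm.run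
  rw [tsum_bind_mul]
  congr 1; ext a; congr 1
  cases a <;> exact tsum_pure_mul _ _

theorem Algorithm.val_succ (A : Algorithm n k) (D : Fin k → PMF (Fin n))
    (F : Option (Finset (Finset (Fin k))) → ℝ≥0∞) (T : ℕ) (h : List (Fin k × Fin n)) :
    A.val D F (T + 1) h = ∑' a, A h a * (match a with
      | .draw i => ∑' x, D i x * A.val D F T ((i, x) :: h)
      | .answer g => F (some g)) := by
  unfold Algorithm.val
  rw [Algorithm.run, tsum_bind_mul]
  congr 1; ext a; congr 1
  cases a with
  | draw i => exact tsum_bind_mul _ _ _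
  | answer g => exact tsum_pure_mul _ _

theorem Algorithm.val_le_one (A : Algorithm n k) (D : Fin k → PMF (Fin n))
    (F : Option (Finset (Finset (Fin k))) → ℝ≥0∞) (hF : ∀ o, F o ≤ 1) (T : ℕ)
    (h : List (Fin k × Fin n)) : A.val D F T h ≤ 1 := by
  calc A.val D F T h ≤ ∑' o, A.run D T h o * 1 :=
        ENNReal.tsum_le_tsum fun o => mul_le_mul_right (hF o) _
    _ = 1 := by simp only [mul_one, PMF.tsum_coe]

/-- The tape from which a sample is read. -/
inductive Tape where
  | fst | snd | own

/-- Reading one symbol from a tape; an exhausted tape scores `0`. -/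
def pop {α : Type*} (l : List α) (f : α → List α → ℝ≥0∞) : ℝ≥0∞ :=
  match l with
  | [] => 0
  | x :: l => f x l

/-- Expected score of a run which reads its samples from three given tapes. -/
noncomputable def Algorithm.tapeVal (A : Algorithm n k) (src : Fin k → Tape)
    (F : Option (Finset (Finset (Fin k))) → ℝ≥0∞) :
    ℕ → List (Fin k × Fin n) → List (Fin n) → List (Fin n) → List (Fin n) → ℝ≥0∞
  | 0, h, _, _, _ => ∑' a, A h a * (match a with
      | .draw _ => F none
      | .answer g => F (some g))
  | T + 1, h, l₁, l₂, l₃ => ∑' a, A h a * (match a with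
      | .draw i => match src i with
        | .fst => pop l₁ fun x l => Algorithm.tapeVal A src F T ((i, x) :: h) l l₂ l₃
        | .snd => pop l₂ fun x l => Algorithm.tapeVal A src F T ((i, x) :: h) l₁ l l₃
        | .own => pop l₃ fun x l => Algorithm.tapeVal A src F T ((i, x) :: h) l₁ l₂ l
      | .answer g => F (some g))

/-- Using one unit of a quota; an exhausted quota scores `0`. -/
def spend (L : ℕ) (f : ℕ → ℝ≥0∞) : ℝ≥0∞ :=
  match L with
  | 0 => 0
  | L + 1 => f L

/-- Expected score of a run in which the number of samples from each source is bounded. -/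
noncomputable def Algorithm.quotaVal (A : Algorithm n k) (D : Fin k → PMF (Fin n))
    (src : Fin k → Tape) (F : Option (Finset (Finset (Fin k))) → ℝ≥0∞) :
    ℕ → List (Fin k × Fin n) → ℕ → ℕ → ℕ → ℝ≥0∞
  | 0, h, _, _, _ => ∑' a, A h a * (match a with
      | .draw _ => F none
      | .answer g => F (some g))
  | T + 1, h, a, b, c => ∑' e, A h e * (match e with
      | .draw i => match src i with
        | .fst => spend a fun a' => ∑' x, D i x * Algorithm.quotaVal A D src F T ((i, x) :: h) a' b c
        | .snd => spend b fun b' => ∑' x, D i x * Algorithm.quotaVal A D src F T ((i, x) :: h) a b' c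
        | .own => spend c fun c' => ∑' x, D i x * Algorithm.quotaVal A D src F T ((i, x) :: h) a b c'
      | .answer g => F (some g))

/-- Expectation of a function of `L` independent samples. -/
noncomputable def iidSum {α : Type*} (D : PMF α) : ℕ → (List α → ℝ≥0∞) → ℝ≥0∞
  | 0, f => f []
  | L + 1, f => ∑' x, D x * iidSum D L fun l => f (x :: l)

theorem iidSum_tsum {α β : Type*} (D : PMF α) (L : ℕ) (c : β → ℝ≥0∞) (f : β → List α → ℝ≥0∞) :
    iidSum D L (fun l => ∑' b, c b * f b l) = ∑' b, c b * iidSum D L (f b) := by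
  induction L generalizing f with
  | zero => rfl
  | succ L ih =>
    simp only [iidSum, ih, ← ENNReal.tsum_mul_left]
    rw [ENNReal.tsum_comm]
    simp only [mul_left_comm]

theorem iidSum_const {α : Type*} (D : PMF α) (L : ℕ) (c : ℝ≥0∞) :
    iidSum D L (fun _ => c) = c := by
  induction L with
  | zero => rfl
  | succ L ih => simp [iidSum, ih, ENNReal.tsum_mul_right, PMF.tsum_coe]

theorem iidSum_pop {α : Type*} (D : PMF α) (L : ℕ) (f : α → List α → ℝ≥0∞) :
    iidSum D L (fun l => pop l f) = spend L fun L' => ∑' x, D x * iidSum D L' (f x) := by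
  cases L <;> rfl

theorem iidSum_spend {α : Type*} (D : PMF α) (L M : ℕ) (f : ℕ → List α → ℝ≥0∞) :
    iidSum D L (fun l => spend M fun M' => f M' l) = spend M fun M' => iidSum D L (f M') := by
  cases M
  · exact iidSum_const _ _ _
  · rfl

theorem pop_iidSum {α β : Type*} (D : PMF β) (L : ℕ) (l : List α)
    (f : α → List α → List β → ℝ≥0∞) :
    iidSum D L (fun l' => pop l fun x m => f x m l') = pop l fun x m => iidSum D L (f x m) := by
  cases l
  · exact iidSum_const _ _ _
  · rfl

/-- The distributions feeding the three tapes. -/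
def tapeLaw (P Q S : PMF (Fin n)) : Tape → PMF (Fin n)
  | .fst => P
  | .snd => Q
  | .own => S

theorem tapeLaw_fst (P Q S : PMF (Fin n)) : tapeLaw P Q S .fst = P := rfl
theorem tapeLaw_snd (P Q S : PMF (Fin n)) : tapeLaw P Q S .snd = Q := rfl
theorem tapeLaw_own (P Q S : PMF (Fin n)) : tapeLaw P Q S .own = S := rfl

/-- Fresh samples have the same law as successive symbols of tapes written in advance, and an
exhausted tape is an exhausted quota. For fixed tapes the run no longer depends on `P`, `Q`, `S`, so
two hypotheses can be compared through the laws of the tapes alone, whatever the adaptive strategy.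
-/
theorem Algorithm.iidSum_tapeVal (A : Algorithm n k) (P Q S : PMF (Fin n)) (src : Fin k → Tape)
    (F : Option (Finset (Finset (Fin k))) → ℝ≥0∞) (T : ℕ) (h : List (Fin k × Fin n))
    (a b c : ℕ) :
    iidSum P a (fun l₁ => iidSum Q b fun l₂ => iidSum S c fun l₃ =>
      A.tapeVal src F T h l₁ l₂ l₃) =
    A.quotaVal (fun i => tapeLaw P Q S (src i)) src F T h a b c := by
  induction T generalizing h a b c with
  | zero => simp only [Algorithm.tapeVal, iidSum_const, Algorithm.quotaVal]
  | succ T ih =>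
    simp only [Algorithm.tapeVal, Algorithm.quotaVal, iidSum_tsum]
    congr 1; ext e; congr 1
    cases e with
    | answer g => simp only [iidSum_const]
    | draw i =>
      cases hs : src i
      · simp only [hs, pop_iidSum, iidSum_pop, ih, tapeLaw_fst]
      · simp only [hs, pop_iidSum, iidSum_pop, iidSum_spend, iidSum_tsum, ih, tapeLaw_snd]
      · simp only [hs, iidSum_pop, iidSum_spend, iidSum_tsum, ih, tapeLaw_own]

/-- Scores are nonnegative and exhaustion scores 0, so quotas can only lose value. -/
theorem Algorithm.quotaVal_le_val (A : Algorithm n k) (D : Fin k → PMF (Fin n))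
    (src : Fin k → Tape) (F : Option (Finset (Finset (Fin k))) → ℝ≥0∞)
    (T : ℕ) (h : List (Fin k × Fin n)) (a b c : ℕ) :
    A.quotaVal D src F T h a b c ≤ A.val D F T h := by
  induction T generalizing h a b c with
  | zero => rw [Algorithm.val_zero, Algorithm.quotaVal]
  | succ T ih =>
    rw [Algorithm.val_succ, Algorithm.quotaVal]
    refine ENNReal.tsum_le_tsum fun e => mul_le_mul_right ?_ _
    cases e with
    | answer g => exact le_rfl
    | draw i =>
      have key : ∀ (L : ℕ) (f : Fin n → ℕ → ℝ≥0∞),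
          (∀ x M, f x M ≤ A.val D F T ((i, x) :: h)) →
          spend L (fun M => ∑' x, D i x * f x M) ≤ ∑' x, D i x * A.val D F T ((i, x) :: h) := by
        intro L f hf
        cases L
        · exact zero_le
        · exact ENNReal.tsum_le_tsum fun x => mul_le_mul_right (hf _ _) _
      cases hs : src i <;> simp only [hs]
      · exact key a (fun x M => A.quotaVal D src F T ((i, x) :: h) M b c) fun _ _ => ih _ _ _ _
      · exact key b (fun x M => A.quotaVal D src F T ((i, x) :: h) a M c) fun _ _ => ih _ _ _ _
      · exact key c (fun x M => A.quotaVal D src F T ((i, x) :: h) a b M) fun _ _ => ih _ _ _ _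

/-! ### Expected draw counts and the cost of a quota. -/

/-- Expected number of samples drawn from `D j`. -/
noncomputable def Algorithm.drawCount (A : Algorithm n k) (D : Fin k → PMF (Fin n)) (j : Fin k) :
    ℕ → List (Fin k × Fin n) → ℝ≥0∞
  | 0, _ => 0
  | T + 1, h => ∑' e, A h e * (match e with
      | .draw i => (if i = j then 1 else 0) +
          ∑' x, D i x * Algorithm.drawCount A D j T ((i, x) :: h)
      | .answer _ => 0)

theorem Algorithm.sum_drawCount_le (A : Algorithm n k) (D : Fin k → PMF (Fin n)) (T : ℕ)
    (h : List (Fin k × Fin n)) : ∑ j, A.drawCount D j T h ≤ T := by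
  induction T generalizing h with
  | zero => simp [Algorithm.drawCount]
  | succ T ih =>
    simp only [Algorithm.drawCount]
    rw [← tsum_fintype (L := SummationFilter.unconditional _), ENNReal.tsum_comm]
    calc _ ≤ ∑' e, A h e * ((T + 1 : ℕ) : ℝ≥0∞) := by
          refine ENNReal.tsum_le_tsum fun e => ?_
          rw [ENNReal.tsum_mul_left]
          refine mul_le_mul_right ?_ _
          cases e with
          | answer g => simp
          | draw i =>
            simp only
            rw [ENNReal.tsum_add, ENNReal.tsum_comm]
            simp only [ENNReal.tsum_mul_left]
            have h1 : ∑' b, D i b * ∑' j, A.drawCount D j T ((i, b) :: h) ≤ T := by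
              calc _ ≤ ∑' b, D i b * (T : ℝ≥0∞) := by
                    refine ENNReal.tsum_le_tsum fun b => mul_le_mul_right ?_ _
                    rw [tsum_fintype]; exact ih _
                _ = T := by rw [ENNReal.tsum_mul_right, PMF.tsum_coe, one_mul]
            have h2 : ∑' j : Fin k, (if i = j then (1 : ℝ≥0∞) else 0) = 1 := by
              rw [tsum_fintype]; simp
            rw [h2]; push_cast; rw [add_comm]; gcongr
      _ = _ := by rw [ENNReal.tsum_mul_right, PMF.tsum_coe, one_mul]

/-- Markov's inequality, multiplied out by `c + 1`: the first two quotas cannot run out within `T`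
draws, and the third runs out only if `D j` is drawn at least `c + 1` times. -/
theorem Algorithm.val_le_quotaVal_add (A : Algorithm n k) (D : Fin k → PMF (Fin n))
    (src : Fin k → Tape) (F : Option (Finset (Finset (Fin k))) → ℝ≥0∞) (hF : ∀ o, F o ≤ 1)
    (j : Fin k) (hj : ∀ i, src i = .own ↔ i = j)
    (T : ℕ) (h : List (Fin k × Fin n)) (a b c : ℕ) (ha : T ≤ a) (hb : T ≤ b) :
    ((c : ℝ≥0∞) + 1) * A.val D F T h ≤
      ((c : ℝ≥0∞) + 1) * A.quotaVal D src F T h a b c + A.drawCount D j T h := by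
  induction T generalizing h a b c with
  | zero => rw [Algorithm.val_zero, Algorithm.quotaVal]; exact le_self_add
  | succ T ih =>
    rw [Algorithm.val_succ, Algorithm.quotaVal, Algorithm.drawCount, ← ENNReal.tsum_mul_left,
      ← ENNReal.tsum_mul_left, ← ENNReal.tsum_add]
    refine ENNReal.tsum_le_tsum fun e => ?_
    rw [mul_left_comm, mul_left_comm _ (A h e), ← mul_add]
    refine mul_le_mul_right ?_ _
    cases e with
    | answer g => exact le_self_add
    | draw i =>
      obtain ⟨a, rfl⟩ : ∃ a', a = a' + 1 := ⟨a - 1, by omega⟩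
      obtain ⟨b, rfl⟩ : ∃ b', b = b' + 1 := ⟨b - 1, by omega⟩
      have key : ∀ (f : Fin n → ℝ≥0∞), (∀ x, ((c : ℝ≥0∞) + 1) * A.val D F T ((i, x) :: h) ≤
          ((c : ℝ≥0∞) + 1) * f x + A.drawCount D j T ((i, x) :: h)) →
          ((c : ℝ≥0∞) + 1) * ∑' x, D i x * A.val D F T ((i, x) :: h) ≤
          ((c : ℝ≥0∞) + 1) * (∑' x, D i x * f x) +
            ∑' x, D i x * A.drawCount D j T ((i, x) :: h) := by
        intro f hf
        rw [← ENNReal.tsum_mul_left, ← ENNReal.tsum_mul_left, ← ENNReal.tsum_add]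
        refine ENNReal.tsum_le_tsum fun x => ?_
        rw [mul_left_comm, mul_left_comm _ (D i x), ← mul_add]
        exact mul_le_mul_right (hf x) _
      cases hs : src i <;> simp only [hs, spend]
      · refine (key (fun x => A.quotaVal D src F T ((i, x) :: h) a (b + 1) c)
          fun x => ih _ _ _ _ (by omega) (by omega)).trans ?_
        gcongr; exact le_add_self
      · refine (key (fun x => A.quotaVal D src F T ((i, x) :: h) (a + 1) b c)
          fun x => ih _ _ _ _ (by omega) (by omega)).trans ?_
        gcongr; exact le_add_self
      · rw [if_pos ((hj i).1 hs)]
        cases c with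
        | zero =>
          simp only [Nat.cast_zero, zero_add, one_mul, mul_zero]
          refine le_trans ?_ le_self_add
          calc _ ≤ ∑' x, D i x * 1 :=
                ENNReal.tsum_le_tsum fun x => mul_le_mul_right (A.val_le_one D F hF _ _) _
            _ = 1 := by simp only [mul_one, PMF.tsum_coe]
        | succ c =>
          simp only
          -- The draw from `D j` lowers the quota from `c + 1` to `c`. The induction hypothesis
          -- therefore covers one copy of the value fewer, and this missing copy, at most 1, is paid
          -- for by the unit that the draw adds to the count.
          calc _ = ∑' x, D i x * ((((c + 1 : ℕ) : ℝ≥0∞) + 1) * A.val D F T ((i, x) :: h)) := by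
                rw [← ENNReal.tsum_mul_left]; simp only [mul_left_comm]
            _ ≤ ∑' x, (D i x * 1 + D i x * ((((c + 1 : ℕ) : ℝ≥0∞) + 1) *
                  A.quotaVal D src F T ((i, x) :: h) (a + 1) (b + 1) c +
                  A.drawCount D j T ((i, x) :: h))) := by
                refine ENNReal.tsum_le_tsum fun x => ?_
                rw [← mul_add]
                refine mul_le_mul_right ?_ _
                have h1 := ih ((i, x) :: h) (a + 1) (b + 1) c (by omega) (by omega)
                by_cases hq : A.val D F T ((i, x) :: h) ≤
                    A.quotaVal D src F T ((i, x) :: h) (a + 1) (b + 1) c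
                · calc _ ≤ (((c + 1 : ℕ) : ℝ≥0∞) + 1) *
                        A.quotaVal D src F T ((i, x) :: h) (a + 1) (b + 1) c := by gcongr
                    _ ≤ _ := by rw [← add_assoc]; exact le_add_self.trans le_self_add
                · push_cast
                  rw [add_mul _ 1, one_mul]
                  have h2 := A.val_le_one D F hF T ((i, x) :: h)
                  calc _ ≤ _ := add_le_add h1 h2
                    _ = 1 + (((c : ℝ≥0∞) + 1) *
                      A.quotaVal D src F T ((i, x) :: h) (a + 1) (b + 1) c +
                      A.drawCount D j T ((i, x) :: h)) := by ring
                    _ ≤ _ := by gcongr; exact le_self_add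
            _ = _ := by
                rw [ENNReal.tsum_add, ENNReal.tsum_mul_right, PMF.tsum_coe, one_mul]
                simp only [mul_add, ENNReal.tsum_add, ← ENNReal.tsum_mul_left]
                simp only [mul_left_comm, add_mul, mul_add, one_mul, ENNReal.tsum_add]
                ring

/-! ### Sums over words and the exponential formula. -/

theorem tsum_list {α : Type*} (g : List α → ℝ≥0∞) :
    ∑' l, g l = g [] + ∑' x, ∑' l, g (x :: l) := by
  classical
  rw [ENNReal.tsum_eq_add_tsum_ite [], ← ENNReal.tsum_prod (f := fun x l => g (x :: l))]
  congr 1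
  have hinj : Function.Injective fun p : α × List α => p.1 :: p.2 := by
    rintro ⟨x, l⟩ ⟨y, m⟩ h
    simpa using h
  rw [← hinj.tsum_eq]
  · simp
  · intro l hl
    cases l with
    | nil => simp at hl
    | cons x l => exact ⟨(x, l), rfl⟩

theorem iidSum_eq_tsum {α : Type*} (D : PMF α) (L : ℕ) (f : List α → ℝ≥0∞) :
    iidSum D L f = ∑' l, if l.length = L then (l.map D).prod * f l else 0 := by
  induction L generalizing f with
  | zero => rw [tsum_list]; simp [iidSum]
  | succ L ih =>
    rw [tsum_list]
    simp only [iidSum, ih, ← ENNReal.tsum_mul_left]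
    simp [mul_assoc]

theorem tsum_list_iidSum {α : Type*} (D : PMF α) (κ : ℕ → ℝ≥0∞) (f : List α → ℝ≥0∞) :
    ∑' l : List α, κ l.length * (l.map D).prod * f l = ∑' L, κ L * iidSum D L f := by
  simp only [iidSum_eq_tsum, ← ENNReal.tsum_mul_left]
  rw [ENNReal.tsum_comm]
  refine tsum_congr fun l => ?_
  rw [tsum_eq_single l.length]
  · simp [mul_assoc]
  · intro L hL
    simp [hL.symm]

/-- The multinomial coefficient, by recursion on the first letter: after multiplication by the
factorials, the words beginning with `x` contribute `(s - 1)! * a x`. -/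
theorem tsum_count_eq {α : Type*} [Fintype α] [DecidableEq α] (s : ℕ) (a : α → ℕ)
    (ha : ∑ x, a x = s) :
    (∑' l : List α, if (fun x => l.count x) = a then (1 : ℝ≥0∞) else 0) *
      ∏ x, ((a x).factorial : ℝ≥0∞) = (s.factorial : ℝ≥0∞) := by
  induction s generalizing a with
  | zero =>
    have h0 : a = 0 := by
      funext x
      exact (Finset.sum_eq_zero_iff.1 ha) x (Finset.mem_univ x)
    subst h0
    rw [tsum_eq_single []]
    · simp [funext_iff]
    · intro l hl
      rw [if_neg]
      intro h
      obtain ⟨x, m, rfl⟩ := List.exists_cons_of_ne_nil hl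
      have := congrFun h x
      simp at this
  | succ s ih =>
    rw [tsum_list, if_neg, zero_add, tsum_fintype, Finset.sum_mul]
    · have key : ∀ x, (∑' l : List α, if (fun y => (x :: l).count y) = a then (1 : ℝ≥0∞) else 0) *
          ∏ y, ((a y).factorial : ℝ≥0∞) = (s.factorial : ℝ≥0∞) * (a x : ℝ≥0∞) := by
        intro x
        by_cases hx : a x = 0
        · rw [hx]
          have : ∀ l : List α, ¬ ((fun y => (x :: l).count y) = a) := by
            intro l h
            have := congrFun h x
            simp [hx] at this
          simp [this]
        · set b := Function.update a x (a x - 1) with hb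
          have hbs : ∑ y, b y = s := by
            have h1 := Finset.add_sum_erase Finset.univ a (Finset.mem_univ x)
            have h2 := Finset.add_sum_erase Finset.univ b (Finset.mem_univ x)
            have h3 : ∑ y ∈ Finset.univ.erase x, b y = ∑ y ∈ Finset.univ.erase x, a y :=
              Finset.sum_congr rfl fun y hy => by simp [hb, Finset.ne_of_mem_erase hy]
            have h4 : b x = a x - 1 := by simp [hb]
            omega
          have hc : ∀ l : List α, ((fun y => (x :: l).count y) = a) ↔
              ((fun y => l.count y) = b) := by
            intro l
            simp only [funext_iff, List.count_cons, hb]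
            refine forall_congr' fun y => ?_
            by_cases hy : y = x
            · subst hy; simp; omega
            · simp [hy, Ne.symm hy]
          simp only [hc]
          rw [← ih b hbs, mul_assoc]
          congr 1
          rw [← Finset.mul_prod_erase _ _ (Finset.mem_univ x),
            ← Finset.mul_prod_erase _ (fun y => ((b y).factorial : ℝ≥0∞)) (Finset.mem_univ x)]
          have h3 : ∏ y ∈ Finset.univ.erase x, ((b y).factorial : ℝ≥0∞) =
              ∏ y ∈ Finset.univ.erase x, ((a y).factorial : ℝ≥0∞) :=
            Finset.prod_congr rfl fun y hy => by simp [hb, Finset.ne_of_mem_erase hy]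
          have h4 : b x = a x - 1 := by simp [hb]
          have h5 : ((a x).factorial : ℝ≥0∞) = (a x : ℝ≥0∞) * ((a x - 1).factorial : ℝ≥0∞) := by
            rw [← Nat.mul_factorial_pred hx]; push_cast; rfl
          rw [h3, h4, h5]; ring
      simp only [key]
      rw [← Finset.mul_sum, ← Nat.cast_sum, ha, Nat.factorial_succ]
      push_cast; ring
    · intro h
      have : ∑ x, a x = 0 := by rw [← h]; simp
      omega

theorem tsum_pi_prod (n : ℕ) (g : Fin n → ℕ → ℝ≥0∞) :
    ∑' a : Fin n → ℕ, ∏ x, g x (a x) = ∏ x, ∑' c, g x c := by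
  induction n with
  | zero => simp
  | succ n ih =>
    rw [← (Fin.consEquiv fun _ => ℕ).tsum_eq, ENNReal.tsum_prod', Fin.prod_univ_succ, ← ih,
      ← ENNReal.tsum_mul_right]
    refine tsum_congr fun c => ?_
    rw [← ENNReal.tsum_mul_left]
    refine tsum_congr fun a => ?_
    simp [Fin.prod_univ_succ, Fin.consEquiv]

/-- The exponential formula for sums over words. -/
theorem tsum_list_prod_count (n : ℕ) (f : Fin n → ℕ → ℝ≥0∞) :
    ∑' l : List (Fin n), (l.length.factorial : ℝ≥0∞)⁻¹ * ∏ x, f x (l.count x) =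
      ∏ x, ∑' c : ℕ, (c.factorial : ℝ≥0∞)⁻¹ * f x c := by
  rw [← tsum_pi_prod]
  -- Words are grouped by their vector of counts; the size of each group then cancels the factorial
  -- of the length.
  calc _ = ∑' (l : List (Fin n)) (a : Fin n → ℕ), (if (fun x => l.count x) = a then 1 else 0) *
        (((∑ x, a x).factorial : ℝ≥0∞)⁻¹ * ∏ x, f x (a x)) := by
        refine tsum_congr fun l => ?_
        rw [tsum_eq_single (fun x => l.count x)]
        · rw [if_pos rfl, one_mul]
          have hlen : ∑ x : Fin n, List.count x l = l.length := by
            rw [← Multiset.coe_card, ← Multiset.toFinset_sum_count_eq]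
            simp only [Multiset.coe_count]
            symm
            refine Finset.sum_subset (Finset.subset_univ _) ?_
            intro x _ hx
            exact List.count_eq_zero_of_not_mem (by simpa using hx)
          rw [hlen]
        · intro a ha
          rw [if_neg (Ne.symm ha), zero_mul]
    _ = _ := by
        rw [ENNReal.tsum_comm]
        refine tsum_congr fun a => ?_
        rw [ENNReal.tsum_mul_right, Finset.prod_mul_distrib, ← mul_assoc]
        congr 1
        have h := tsum_count_eq _ a rfl
        have h0 : ∀ m : ℕ, (m.factorial : ℝ≥0∞) ≠ 0 := fun m => by
          exact_mod_cast m.factorial_ne_zero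
        have ht : ∀ m : ℕ, (m.factorial : ℝ≥0∞) ≠ ∞ := fun m => ENNReal.natCast_ne_top _
        rw [← h, ← ENNReal.prod_inv_distrib]
        · set C := ∑' l : List (Fin n), if (fun x => l.count x) = a then (1 : ℝ≥0∞) else 0
          set B := ∏ x, ((a x).factorial : ℝ≥0∞)
          have hC0 : C ≠ 0 := by
            intro h'; rw [h', zero_mul] at h; exact h0 _ h.symm
          have hCt : C ≠ ∞ := by
            intro h'
            rw [h', ENNReal.top_mul] at h
            · exact ht _ h.symm
            · exact Finset.prod_ne_zero_iff.2 fun x _ => h0 _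
          rw [ENNReal.mul_inv (Or.inl hC0) (Or.inl hCt), ← mul_assoc,
            ENNReal.mul_inv_cancel hC0 hCt, one_mul]
        · intro x _ y _ _
          exact Or.inl (h0 _)

/-! ### Poissonization of the tapes. -/

/-- Poisson probabilities. -/
noncomputable def pois (Λ : ℝ) (L : ℕ) : ℝ := Real.exp (-Λ) * Λ ^ L / L.factorial

theorem pois_nonneg {Λ : ℝ} (h : 0 ≤ Λ) (L : ℕ) : 0 ≤ pois Λ L := by
  unfold pois; positivity

theorem hasSum_pow_div_factorial (x : ℝ) :
    HasSum (fun L : ℕ => x ^ L / L.factorial) (Real.exp x) := by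
  rw [Real.exp_eq_exp_ℝ]
  exact NormedSpace.expSeries_div_hasSum_exp x

theorem hasSum_pois (Λ : ℝ) : HasSum (pois Λ) 1 := by
  have h := (hasSum_pow_div_factorial Λ).mul_left (Real.exp (-Λ))
  rw [← Real.exp_add, neg_add_cancel, Real.exp_zero] at h
  exact (funext fun L => mul_div_assoc _ _ _ : pois Λ = _) ▸ h

theorem tsum_ofReal_pois {Λ : ℝ} (h : 0 ≤ Λ) : ∑' L, ENNReal.ofReal (pois Λ L) = 1 := by
  rw [← ENNReal.ofReal_tsum_of_nonneg (pois_nonneg h) (hasSum_pois Λ).summable,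
    (hasSum_pois Λ).tsum_eq, ENNReal.ofReal_one]

/-- A Chernoff bound with exponential weight 2: replacing `2 ^ L` by `2 ^ T` bounds the lower tail
by `2 ^ T * exp (-Λ / 2)`, which is at most `(2 * exp (-10)) ^ T`. -/
theorem sum_pois_lt_le {Λ : ℝ} {T : ℕ} (h : 20 * (T : ℝ) ≤ Λ) :
    ∑ L ∈ Finset.range T, pois Λ L ≤ 1 / 100 := by
  have hΛ : 0 ≤ Λ := le_trans (by positivity) h
  rcases Nat.eq_zero_or_pos T with rfl | hT
  · simp
  have hT1 : (1 : ℝ) ≤ T := by exact_mod_cast hT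
  calc ∑ L ∈ Finset.range T, pois Λ L
      ≤ ∑ L ∈ Finset.range T, Real.exp (-Λ) * 2 ^ T * ((Λ / 2) ^ L / L.factorial) := by
        refine Finset.sum_le_sum fun L hL => ?_
        have h2 : (2 : ℝ) ^ L ≤ 2 ^ T :=
          pow_le_pow_right₀ (by norm_num) (Finset.mem_range.1 hL).le
        calc pois Λ L = Real.exp (-Λ) * 2 ^ L * ((Λ / 2) ^ L / L.factorial) := by
              unfold pois; rw [div_pow]; field_simp
          _ ≤ _ := by gcongr
    _ ≤ Real.exp (-Λ) * 2 ^ T * Real.exp (Λ / 2) := by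
        rw [← Finset.mul_sum]
        gcongr
        exact sum_le_hasSum _ (fun _ _ => by positivity) (hasSum_pow_div_factorial _)
    _ = 2 ^ T * Real.exp (-(Λ / 2)) := by
        rw [mul_comm (Real.exp _), mul_assoc, ← Real.exp_add]; ring_nf
    _ ≤ 2 ^ T * Real.exp (-10) ^ T := by
        rw [← Real.exp_nat_mul]
        gcongr
        linarith
    _ = (2 * Real.exp (-10)) ^ T := by rw [mul_pow]
    _ ≤ 2 * Real.exp (-10) := by
        refine pow_le_of_le_one (by positivity) ?_ hT.ne'
        have := Real.add_one_le_exp 10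
        rw [Real.exp_neg]
        rw [← div_eq_mul_inv, div_le_one (Real.exp_pos _)]
        linarith
    _ ≤ 1 / 100 := by
        have h1 := Real.add_one_le_exp 5
        have h2 : Real.exp 10 = Real.exp 5 * Real.exp 5 := by rw [← Real.exp_add]; norm_num
        have h5 : (2.7 : ℝ) ≤ Real.exp 1 := by have := Real.exp_one_gt_d9; linarith
        have h3 : Real.exp 10 = Real.exp 1 ^ 10 := by rw [← Real.exp_nat_mul]; norm_num
        have h4 : (2.7 : ℝ) ^ 10 ≤ Real.exp 1 ^ 10 := by gcongr
        rw [Real.exp_neg, ← div_eq_mul_inv, div_le_div_iff₀ (Real.exp_pos _) (by norm_num)]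
        norm_num at h4
        linarith

theorem tsum_pois_lt_le {Λ : ℝ} {T : ℕ} (h : 20 * (T : ℝ) ≤ Λ) :
    ∑' L, ENNReal.ofReal (pois Λ L) * (if L < T then 1 else 0) ≤ ENNReal.ofReal (1 / 100) := by
  have hΛ : 0 ≤ Λ := le_trans (by positivity) h
  rw [tsum_eq_sum (s := Finset.range T)]
  · rw [Finset.sum_congr rfl (g := fun L => ENNReal.ofReal (pois Λ L)),
      ← ENNReal.ofReal_sum_of_nonneg fun L _ => pois_nonneg hΛ L]
    · exact ENNReal.ofReal_le_ofReal (sum_pois_lt_le h)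
    · intro L hL
      simp [Finset.mem_range.1 hL]
  · intro L hL
    simp [Finset.mem_range.not.1 hL]

/-- Weight of a list under the Poissonized sampling with intensity `t * w`. -/
noncomputable def listWeight {n : ℕ} (t : ℝ) (w : Fin n → ℝ) (l : List (Fin n)) : ℝ :=
  (l.length.factorial : ℝ)⁻¹ * ∏ x, (Real.exp (-(t * w x)) * (t * w x) ^ l.count x)

/-- A Poisson number of independent samples makes the bin counts independent Poisson variables. The
masses need not sum to 1: the total mass only changes the mean length, which is what allows
independent random masses later. -/
theorem ofReal_listWeight {n : ℕ} {t : ℝ} (ht : 0 ≤ t) {w : Fin n → ℝ} (hw : ∀ x, 0 ≤ w x)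
    (hW : 0 < ∑ x, w x) (D : PMF (Fin n))
    (hD : ∀ x, D x = ENNReal.ofReal (w x / ∑ y, w y)) (l : List (Fin n)) :
    ENNReal.ofReal (listWeight t w l) =
      ENNReal.ofReal (pois (t * ∑ x, w x) l.length) * (l.map D).prod := by
  have h1 : (l.map D).prod = ENNReal.ofReal ((l.map fun x => w x / ∑ y, w y).prod) := by
    induction l with
    | nil => simp
    | cons x l ih =>
      rw [List.map_cons, List.prod_cons, List.map_cons, List.prod_cons, ih, hD,
        ENNReal.ofReal_mul (by have := hw x; positivity)]
  rw [h1, ← ENNReal.ofReal_mul (pois_nonneg (by positivity) _)]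
  congr 1
  have h2 : (t * ∑ x, w x) ^ l.length * (l.map fun x => w x / ∑ y, w y).prod =
      ∏ x, (t * w x) ^ l.count x := by
    have h3 : ∏ x, (t * w x) ^ l.count x = (l.map fun x => t * w x).prod := by
      rw [Finset.prod_list_map_count]
      refine (Finset.prod_subset (Finset.subset_univ _) ?_).symm
      intro x _ hx
      rw [List.count_eq_zero_of_not_mem (by simpa using hx), pow_zero]
    rw [h3]
    clear h1 h3
    induction l with
    | nil => simp
    | cons x l ih =>
      simp only [List.map_cons, List.prod_cons, List.length_cons, pow_succ, ← ih]
      field_simp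
  unfold listWeight pois
  rw [Finset.prod_mul_distrib, ← h2, ← Real.exp_sum, Finset.sum_neg_distrib, ← Finset.mul_sum]
  field_simp

/-- Average of a function of three tapes under Poissonized sampling. -/
noncomputable def listSum (t s : ℝ) (u v w : Fin n → ℝ)
    (Φ : List (Fin n) → List (Fin n) → List (Fin n) → ℝ≥0∞) : ℝ≥0∞ :=
  ∑' l₁, ENNReal.ofReal (listWeight t u l₁) * ∑' l₂, ENNReal.ofReal (listWeight t v l₂) *
    ∑' l₃, ENNReal.ofReal (listWeight s w l₃) * Φ l₁ l₂ l₃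

/-- `D` is the probability distribution proportional to the masses `w`. -/
def IsNormalized (w : Fin n → ℝ) (D : PMF (Fin n)) : Prop :=
  (∀ x, 0 ≤ w x) ∧ 0 < ∑ x, w x ∧ ∀ x, D x = ENNReal.ofReal (w x / ∑ y, w y)

theorem tsum_listWeight {w : Fin n → ℝ} {D : PMF (Fin n)} (hD : IsNormalized w D) {t : ℝ}
    (ht : 0 ≤ t) (f : List (Fin n) → ℝ≥0∞) :
    ∑' l, ENNReal.ofReal (listWeight t w l) * f l =
      ∑' L, ENNReal.ofReal (pois (t * ∑ x, w x) L) * iidSum D L f := by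
  simp only [ofReal_listWeight ht hD.1 hD.2.1 D hD.2.2]
  exact tsum_list_iidSum D (fun L => ENNReal.ofReal (pois (t * ∑ x, w x) L)) f

theorem listSum_tapeVal (A : Algorithm n k) {u v w : Fin n → ℝ} {P Q S : PMF (Fin n)}
    (hP : IsNormalized u P) (hQ : IsNormalized v Q) (hS : IsNormalized w S)
    {t s : ℝ} (ht : 0 ≤ t) (hs : 0 ≤ s) (src : Fin k → Tape)
    (F : Option (Finset (Finset (Fin k))) → ℝ≥0∞) (T : ℕ) :
    listSum t s u v w (A.tapeVal src F T []) =
      ∑' a, ENNReal.ofReal (pois (t * ∑ x, u x) a) * ∑' b, ENNReal.ofReal (pois (t * ∑ x, v x) b) *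
        ∑' c, ENNReal.ofReal (pois (s * ∑ x, w x) c) *
          A.quotaVal (fun i => tapeLaw P Q S (src i)) src F T [] a b c := by
  unfold listSum
  simp only [tsum_listWeight hP ht, tsum_listWeight hQ ht, tsum_listWeight hS hs, iidSum_tsum,
    Algorithm.iidSum_tapeVal]

theorem listSum_tapeVal_le_val (A : Algorithm n k) {u v w : Fin n → ℝ} {P Q S : PMF (Fin n)}
    (hP : IsNormalized u P) (hQ : IsNormalized v Q) (hS : IsNormalized w S)
    {t s : ℝ} (ht : 0 ≤ t) (hs : 0 ≤ s) (src : Fin k → Tape)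
    (F : Option (Finset (Finset (Fin k))) → ℝ≥0∞) (T : ℕ) :
    listSum t s u v w (A.tapeVal src F T []) ≤
      A.val (fun i => tapeLaw P Q S (src i)) F T [] := by
  rw [listSum_tapeVal A hP hQ hS ht hs]
  have hu := hP.2.1.le
  have hv := hQ.2.1.le
  have hw := hS.2.1.le
  calc _ ≤ ∑' a, ENNReal.ofReal (pois (t * ∑ x, u x) a) *
        ∑' b, ENNReal.ofReal (pois (t * ∑ x, v x) b) *
        ∑' c, ENNReal.ofReal (pois (s * ∑ x, w x) c) *
          A.val (fun i => tapeLaw P Q S (src i)) F T [] := by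
        refine ENNReal.tsum_le_tsum fun a => mul_le_mul_right ?_ _
        refine ENNReal.tsum_le_tsum fun b => mul_le_mul_right ?_ _
        refine ENNReal.tsum_le_tsum fun c => mul_le_mul_right ?_ _
        exact A.quotaVal_le_val _ _ _ _ _ _ _ _
    _ = _ := by
        simp only [ENNReal.tsum_mul_right, tsum_ofReal_pois (mul_nonneg ht hu),
          tsum_ofReal_pois (mul_nonneg ht hv), tsum_ofReal_pois (mul_nonneg hs hw), one_mul]

/-- Replacing true runs by Poissonized tapes costs three Poisson lower tails of 1/100 each, and the
Markov term for drawing `D j` more than `N` times. -/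
theorem val_le_listSum_tapeVal (A : Algorithm n k) {u v w : Fin n → ℝ} {P Q S : PMF (Fin n)}
    (hP : IsNormalized u P) (hQ : IsNormalized v Q) (hS : IsNormalized w S)
    {t s : ℝ} (ht : 0 ≤ t) (hs : 0 ≤ s) (src : Fin k → Tape) (j : Fin k)
    (hj : ∀ i, src i = .own ↔ i = j)
    (F : Option (Finset (Finset (Fin k))) → ℝ≥0∞) (hF : ∀ o, F o ≤ 1) (T N : ℕ)
    (htu : 20 * (T : ℝ) ≤ t * ∑ x, u x) (htv : 20 * (T : ℝ) ≤ t * ∑ x, v x)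
    (hsw : 20 * (N : ℝ) ≤ s * ∑ x, w x) :
    A.val (fun i => tapeLaw P Q S (src i)) F T [] ≤
      listSum t s u v w (A.tapeVal src F T []) +
        A.drawCount (fun i => tapeLaw P Q S (src i)) j T [] / ((N : ℝ≥0∞) + 1) +
        ENNReal.ofReal (3 / 100) := by
  rw [listSum_tapeVal A hP hQ hS ht hs]
  set D := fun i => tapeLaw P Q S (src i)
  have hu := hP.2.1.le
  have hv := hQ.2.1.le
  have hw := hS.2.1.le
  set κ₁ := fun a => ENNReal.ofReal (pois (t * ∑ x, u x) a) with hκ₁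
  set κ₂ := fun a => ENNReal.ofReal (pois (t * ∑ x, v x) a) with hκ₂
  set κ₃ := fun a => ENNReal.ofReal (pois (s * ∑ x, w x) a) with hκ₃
  have s₁ : ∑' a, κ₁ a = 1 := tsum_ofReal_pois (mul_nonneg ht hu)
  have s₂ : ∑' a, κ₂ a = 1 := tsum_ofReal_pois (mul_nonneg ht hv)
  have s₃ : ∑' a, κ₃ a = 1 := tsum_ofReal_pois (mul_nonneg hs hw)
  have t₁ : ∑' a, κ₁ a * (if a < T then 1 else 0) ≤ ENNReal.ofReal (1 / 100) :=
    tsum_pois_lt_le htu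
  have t₂ : ∑' a, κ₂ a * (if a < T then 1 else 0) ≤ ENNReal.ofReal (1 / 100) :=
    tsum_pois_lt_le htv
  have t₃ : ∑' a, κ₃ a * (if a < N then 1 else 0) ≤ ENNReal.ofReal (1 / 100) :=
    tsum_pois_lt_le hsw
  set V := A.val D F T []
  set d := A.drawCount D j T [] / ((N : ℝ≥0∞) + 1) with hd
  -- A short tape is charged with the trivial bound 1 on the value; if all three tapes are long
  -- enough, `val_le_quotaVal_add` applies.
  have key : ∀ a b c, V ≤ A.quotaVal D src F T [] a b c + (d + ((if a < T then 1 else 0) +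
      ((if b < T then 1 else 0) + (if c < N then 1 else 0)))) := by
    intro a b c
    have hV1 : V ≤ 1 := A.val_le_one D F hF T []
    by_cases ha : a < T
    · rw [if_pos ha]
      exact hV1.trans (le_trans (le_trans le_self_add le_add_self) le_add_self)
    by_cases hb : b < T
    · rw [if_pos hb]
      exact hV1.trans (le_trans (le_trans (le_trans le_self_add le_add_self) le_add_self)
        le_add_self)
    by_cases hc : c < N
    · rw [if_pos hc]
      exact hV1.trans (le_trans (le_trans (le_trans le_add_self le_add_self) le_add_self)
        le_add_self)
    rw [if_neg ha, if_neg hb, if_neg hc, add_zero, add_zero, add_zero]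
    have h := A.val_le_quotaVal_add D src F hF j hj T [] a b c (not_lt.1 ha) (not_lt.1 hb)
    have hc0 : ((c : ℝ≥0∞) + 1) ≠ 0 := by simp
    have hct : ((c : ℝ≥0∞) + 1) ≠ ∞ := by simp
    have h2 : V ≤ A.quotaVal D src F T [] a b c + A.drawCount D j T [] / ((c : ℝ≥0∞) + 1) := by
      rw [← ENNReal.mul_le_mul_iff_right hc0 hct]
      refine h.trans (le_of_eq ?_)
      rw [mul_add, ENNReal.mul_div_cancel hc0 hct]
    have hNc : (N : ℝ≥0∞) ≤ c := by exact_mod_cast not_lt.1 hc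
    refine h2.trans ?_
    rw [hd]
    gcongr
  calc V = ∑' a, κ₁ a * ∑' b, κ₂ b * ∑' c, κ₃ c * V := by
        simp only [ENNReal.tsum_mul_right, s₁, s₂, s₃, one_mul]
    _ ≤ ∑' a, κ₁ a * ∑' b, κ₂ b * ∑' c, κ₃ c * (A.quotaVal D src F T [] a b c +
        (d + ((if a < T then 1 else 0) + ((if b < T then 1 else 0) +
          (if c < N then 1 else 0))))) := by
        refine ENNReal.tsum_le_tsum fun a => mul_le_mul_right ?_ _
        refine ENNReal.tsum_le_tsum fun b => mul_le_mul_right ?_ _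
        refine ENNReal.tsum_le_tsum fun c => mul_le_mul_right ?_ _
        exact key a b c
    _ = (∑' a, κ₁ a * ∑' b, κ₂ b * ∑' c, κ₃ c * A.quotaVal D src F T [] a b c) +
        (d + ((∑' a, κ₁ a * (if a < T then 1 else 0)) + ((∑' b, κ₂ b * (if b < T then 1 else 0)) +
          ∑' c, κ₃ c * (if c < N then 1 else 0)))) := by
        simp only [mul_add, ENNReal.tsum_add, ENNReal.tsum_mul_right, s₁, s₂, s₃, one_mul]
    _ ≤ (∑' a, κ₁ a * ∑' b, κ₂ b * ∑' c, κ₃ c * A.quotaVal D src F T [] a b c) +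
        (d + (ENNReal.ofReal (1 / 100) + (ENNReal.ofReal (1 / 100) + ENNReal.ofReal (1 / 100)))) := by
        gcongr
    _ = _ := by
        rw [← ENNReal.ofReal_add (by norm_num) (by norm_num),
          ← ENNReal.ofReal_add (by norm_num) (by norm_num), ← add_assoc]
        norm_num [κ₁, κ₂, κ₃]

/-! ### Mixtures over independent bin parameters and their affinities. -/

section Mixture

variable {Ω : Type*} [Fintype Ω]

/-- Joint law, for one bin, of the three Poisson counts. -/
noncomputable def binLaw (ρ : Ω → ℝ) (t s : ℝ) (u v w : Ω → ℝ) (a b c : ℕ) : ℝ :=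
  ∑ ω, ρ ω * (pois (t * u ω) a * pois (t * v ω) b * pois (s * w ω) c)

theorem sum_prod_prior {ρ : Ω → ℝ} (h1 : ∑ ω, ρ ω = 1) :
    ∑ θ : Fin n → Ω, ∏ x, ρ (θ x) = 1 := by
  classical
  rw [← Fintype.piFinset_univ, ← Finset.prod_univ_sum]
  simp [h1]

theorem listWeight_eq (t : ℝ) (w : Fin n → ℝ) (l : List (Fin n)) :
    listWeight t w l = (l.length.factorial : ℝ)⁻¹ *
      ∏ x, ((l.count x).factorial * pois (t * w x) (l.count x)) := by
  unfold listWeight pois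
  congr 1
  refine Finset.prod_congr rfl fun x _ => ?_
  field_simp

/-- Each weight depends on the tapes only through the bin counts, and the prior is a product; so the
average over all parameters is a product of one-bin averages. -/
theorem sum_prior_listWeight (ρ : Ω → ℝ) (t s : ℝ) (u v w : Fin n → Ω → ℝ)
    (l₁ l₂ l₃ : List (Fin n)) :
    ∑ θ : Fin n → Ω, (∏ x, ρ (θ x)) * (listWeight t (fun x => u x (θ x)) l₁ *
      (listWeight t (fun x => v x (θ x)) l₂ * listWeight s (fun x => w x (θ x)) l₃)) =
    ((l₁.length.factorial : ℝ)⁻¹ * ((l₂.length.factorial : ℝ)⁻¹ * (l₃.length.factorial : ℝ)⁻¹)) *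
      ∏ x, (((l₁.count x).factorial * ((l₂.count x).factorial * (l₃.count x).factorial)) *
        binLaw ρ t s (u x) (v x) (w x) (l₁.count x) (l₂.count x) (l₃.count x)) := by
  classical
  simp only [listWeight_eq, binLaw, Finset.mul_sum]
  rw [Finset.prod_univ_sum, Fintype.piFinset_univ, Finset.mul_sum]
  refine Finset.sum_congr rfl fun θ _ => ?_
  simp only [Finset.prod_mul_distrib]
  ring

theorem binLaw_nonneg {ρ : Ω → ℝ} (h0 : ∀ ω, 0 ≤ ρ ω) {t s : ℝ} (ht : 0 ≤ t) (hs : 0 ≤ s)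
    {u v w : Ω → ℝ} (hu : ∀ ω, 0 ≤ u ω) (hv : ∀ ω, 0 ≤ v ω) (hw : ∀ ω, 0 ≤ w ω) (a b c : ℕ) :
    0 ≤ binLaw ρ t s u v w a b c :=
  Finset.sum_nonneg fun ω _ => mul_nonneg (h0 ω) (mul_nonneg (mul_nonneg
    (pois_nonneg (mul_nonneg ht (hu ω)) _) (pois_nonneg (mul_nonneg ht (hv ω)) _))
    (pois_nonneg (mul_nonneg hs (hw ω)) _))

theorem tsum_lists_prod_count (f : Fin n → ℕ → ℕ → ℕ → ℝ≥0∞) :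
    ∑' (l₁ : List (Fin n)) (l₂ : List (Fin n)) (l₃ : List (Fin n)),
      ((l₁.length.factorial : ℝ≥0∞)⁻¹ * ((l₂.length.factorial : ℝ≥0∞)⁻¹ *
        (l₃.length.factorial : ℝ≥0∞)⁻¹)) * ∏ x, f x (l₁.count x) (l₂.count x) (l₃.count x) =
    ∏ x, ∑' (a : ℕ) (b : ℕ) (c : ℕ), ((a.factorial : ℝ≥0∞)⁻¹ * ((b.factorial : ℝ≥0∞)⁻¹ *
        (c.factorial : ℝ≥0∞)⁻¹)) * f x a b c := by
  simp only [mul_assoc, ENNReal.tsum_mul_left]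
  have h3 := fun (l₁ l₂ : List (Fin n)) =>
    tsum_list_prod_count n (fun x c => f x (l₁.count x) (l₂.count x) c)
  simp only [h3]
  have h2 := fun (l₁ : List (Fin n)) =>
    tsum_list_prod_count n (fun x b => ∑' c : ℕ, (c.factorial : ℝ≥0∞)⁻¹ * f x (l₁.count x) b c)
  simp only [h2]
  exact tsum_list_prod_count n (fun x a => ∑' b : ℕ, (b.factorial : ℝ≥0∞)⁻¹ *
    ∑' c : ℕ, (c.factorial : ℝ≥0∞)⁻¹ * f x a b c)

/-- Bhattacharyya coefficient of two laws of the three counts in a bin. -/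
noncomputable def affinity (p q : ℕ → ℕ → ℕ → ℝ) : ℝ≥0∞ :=
  ∑' (a : ℕ) (b : ℕ) (c : ℕ), ENNReal.ofReal (Real.sqrt (p a b c * q a b c))

theorem affinity_comm (p q : ℕ → ℕ → ℕ → ℝ) : affinity p q = affinity q p := by
  simp only [affinity, mul_comm]

/-- The mixture over the prior of the laws of the three tapes. -/
noncomputable def mixWeight (ρ : Ω → ℝ) (t s : ℝ) (u v w : Fin n → Ω → ℝ)
    (l₁ l₂ l₃ : List (Fin n)) : ℝ :=
  ∑ θ : Fin n → Ω, (∏ x, ρ (θ x)) * (listWeight t (fun x => u x (θ x)) l₁ *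
      (listWeight t (fun x => v x (θ x)) l₂ * listWeight s (fun x => w x (θ x)) l₃))

theorem listWeight_nonneg {t : ℝ} (ht : 0 ≤ t) {w : Fin n → ℝ} (hw : ∀ x, 0 ≤ w x)
    (l : List (Fin n)) : 0 ≤ listWeight t w l :=
  mul_nonneg (by positivity) (Finset.prod_nonneg fun x _ => by have := hw x; positivity)

/-- Affinity is multiplicative over independent coordinates. Here the law lives on words instead of
counts, but the square root retains the product form and the same factorials, so the exponential
formula turns the sum over words into a product over bins. -/
theorem tsum_sqrt_mixWeight {ρ : Ω → ℝ} (h0 : ∀ ω, 0 ≤ ρ ω) {t s : ℝ} (ht : 0 ≤ t) (hs : 0 ≤ s)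
    {u v w w' : Fin n → Ω → ℝ} (hu : ∀ x ω, 0 ≤ u x ω) (hv : ∀ x ω, 0 ≤ v x ω)
    (hw : ∀ x ω, 0 ≤ w x ω) (hw' : ∀ x ω, 0 ≤ w' x ω) :
    ∑' (l₁ : List (Fin n)) (l₂ : List (Fin n)) (l₃ : List (Fin n)),
      ENNReal.ofReal (Real.sqrt (mixWeight ρ t s u v w l₁ l₂ l₃ *
        mixWeight ρ t s u v w' l₁ l₂ l₃)) =
    ∏ x, affinity (binLaw ρ t s (u x) (v x) (w x)) (binLaw ρ t s (u x) (v x) (w' x)) := by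
  have hfac : ∀ m : ℕ, ENNReal.ofReal ((m.factorial : ℝ)⁻¹) = (m.factorial : ℝ≥0∞)⁻¹ := by
    intro m
    rw [ENNReal.ofReal_inv_of_pos (by positivity), ENNReal.ofReal_natCast]
  have hp := fun (w : Fin n → Ω → ℝ) (hw : ∀ x ω, 0 ≤ w x ω) (x : Fin n) (a b c : ℕ) =>
    binLaw_nonneg h0 ht hs (hu x) (hv x) (hw x) a b c
  set f : Fin n → ℕ → ℕ → ℕ → ℝ := fun x a b c =>
    (a.factorial * (b.factorial * c.factorial)) * Real.sqrt
      (binLaw ρ t s (u x) (v x) (w x) a b c * binLaw ρ t s (u x) (v x) (w' x) a b c) with hf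
  have hf0 : ∀ x a b c, 0 ≤ f x a b c := fun x a b c => by positivity
  have h1 : ∀ l₁ l₂ l₃ : List (Fin n), Real.sqrt (mixWeight ρ t s u v w l₁ l₂ l₃ *
      mixWeight ρ t s u v w' l₁ l₂ l₃) = ((l₁.length.factorial : ℝ)⁻¹ *
      ((l₂.length.factorial : ℝ)⁻¹ * (l₃.length.factorial : ℝ)⁻¹)) *
      ∏ x, f x (l₁.count x) (l₂.count x) (l₃.count x) := by
    intro l₁ l₂ l₃
    rw [Real.sqrt_eq_iff_mul_self_eq]
    · unfold mixWeight
      rw [sum_prior_listWeight, sum_prior_listWeight, mul_mul_mul_comm, ← Finset.prod_mul_distrib,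
        mul_mul_mul_comm _ (∏ x, _), ← Finset.prod_mul_distrib]
      congr 1
      refine Finset.prod_congr rfl fun x _ => ?_
      simp only [hf]
      rw [mul_mul_mul_comm, mul_mul_mul_comm _ (Real.sqrt _), Real.mul_self_sqrt (mul_nonneg (hp w hw _ _ _ _)
        (hp w' hw' _ _ _ _))]
    · unfold mixWeight
      rw [sum_prior_listWeight, sum_prior_listWeight]
      refine mul_nonneg (mul_nonneg (by positivity) (Finset.prod_nonneg fun x _ => ?_))
        (mul_nonneg (by positivity) (Finset.prod_nonneg fun x _ => ?_))
      · exact mul_nonneg (by positivity) (hp w hw _ _ _ _)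
      · exact mul_nonneg (by positivity) (hp w' hw' _ _ _ _)
    · exact mul_nonneg (by positivity) (Finset.prod_nonneg fun x _ => hf0 _ _ _ _)
  have h2 : ∀ l₁ l₂ l₃ : List (Fin n), ENNReal.ofReal (Real.sqrt (mixWeight ρ t s u v w l₁ l₂ l₃ *
      mixWeight ρ t s u v w' l₁ l₂ l₃)) = ((l₁.length.factorial : ℝ≥0∞)⁻¹ *
      ((l₂.length.factorial : ℝ≥0∞)⁻¹ * (l₃.length.factorial : ℝ≥0∞)⁻¹)) *
      ∏ x, ENNReal.ofReal (f x (l₁.count x) (l₂.count x) (l₃.count x)) := by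
    intro l₁ l₂ l₃
    rw [h1, ENNReal.ofReal_mul (by positivity), ENNReal.ofReal_mul (by positivity),
      ENNReal.ofReal_mul (by positivity), hfac, hfac, hfac,
      ENNReal.ofReal_prod_of_nonneg fun x _ => hf0 _ _ _ _]
  simp only [h2]
  rw [tsum_lists_prod_count (fun x a b c => ENNReal.ofReal (f x a b c))]
  refine Finset.prod_congr rfl fun x _ => ?_
  unfold affinity
  refine tsum_congr fun a => tsum_congr fun b => tsum_congr fun c => ?_
  rw [← hfac, ← hfac, ← hfac, ← ENNReal.ofReal_mul (by positivity),
    ← ENNReal.ofReal_mul (by positivity), ← ENNReal.ofReal_mul (by positivity), hf]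
  congr 1
  field_simp

end Mixture

section Mixture

variable {Ω : Type*} [Fintype Ω]

/-- Average over the prior `ρ` of independent bin parameters. -/
noncomputable def priorSum (ρ : Ω → ℝ) (f : (Fin n → Ω) → ℝ≥0∞) : ℝ≥0∞ :=
  ∑ θ : Fin n → Ω, ENNReal.ofReal (∏ x, ρ (θ x)) * f θ

theorem priorSum_mono {ρ : Ω → ℝ} {f g : (Fin n → Ω) → ℝ≥0∞} (h : ∀ θ, f θ ≤ g θ) :
    priorSum ρ f ≤ priorSum ρ g :=
  Finset.sum_le_sum fun θ _ => mul_le_mul_right (h θ) _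

theorem priorSum_add (ρ : Ω → ℝ) (f g : (Fin n → Ω) → ℝ≥0∞) :
    priorSum ρ (fun θ => f θ + g θ) = priorSum ρ f + priorSum ρ g := by
  simp only [priorSum, mul_add, Finset.sum_add_distrib]

theorem priorSum_mul_const (ρ : Ω → ℝ) (f : (Fin n → Ω) → ℝ≥0∞) (c : ℝ≥0∞) :
    priorSum ρ (fun θ => f θ * c) = priorSum ρ f * c := by
  simp only [priorSum, ← mul_assoc, Finset.sum_mul]

theorem priorSum_one {ρ : Ω → ℝ} (h0 : ∀ ω, 0 ≤ ρ ω) (h1 : ∑ ω, ρ ω = 1) :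
    priorSum (n := n) ρ (fun _ => 1) = 1 := by
  simp only [priorSum, mul_one]
  rw [← ENNReal.ofReal_sum_of_nonneg fun θ _ => Finset.prod_nonneg fun x _ => h0 _,
    sum_prod_prior h1, ENNReal.ofReal_one]

theorem priorSum_const {ρ : Ω → ℝ} (h0 : ∀ ω, 0 ≤ ρ ω) (h1 : ∑ ω, ρ ω = 1) (c : ℝ≥0∞) :
    priorSum (n := n) ρ (fun _ => c) = c := by
  have := priorSum_mul_const (n := n) ρ (fun _ => 1) c
  simpa only [one_mul, priorSum_one h0 h1] using this

theorem priorSum_listSum {ρ : Ω → ℝ} (h0 : ∀ ω, 0 ≤ ρ ω) {t s : ℝ} (ht : 0 ≤ t) (hs : 0 ≤ s)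
    {u v w : Fin n → Ω → ℝ} (hu : ∀ x ω, 0 ≤ u x ω) (hv : ∀ x ω, 0 ≤ v x ω)
    (hw : ∀ x ω, 0 ≤ w x ω) (Φ : List (Fin n) → List (Fin n) → List (Fin n) → ℝ≥0∞) :
    priorSum ρ (fun θ => listSum t s (fun x => u x (θ x)) (fun x => v x (θ x))
      (fun x => w x (θ x)) Φ) =
    ∑' (l₁ : List (Fin n)) (l₂ : List (Fin n)) (l₃ : List (Fin n)),
      ENNReal.ofReal (mixWeight ρ t s u v w l₁ l₂ l₃) * Φ l₁ l₂ l₃ := by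
  have hlw : ∀ (r : ℝ), 0 ≤ r → ∀ z : Fin n → Ω → ℝ, (∀ x ω, 0 ≤ z x ω) → ∀ (θ : Fin n → Ω) l,
      0 ≤ listWeight r (fun x => z x (θ x)) l := fun r hr z hz θ l =>
    listWeight_nonneg hr (fun x => hz x _) l
  have hρ : ∀ θ : Fin n → Ω, 0 ≤ ∏ x, ρ (θ x) := fun θ => Finset.prod_nonneg fun x _ => h0 _
  have h1 : ∀ l₁ l₂ l₃ : List (Fin n), ENNReal.ofReal (mixWeight ρ t s u v w l₁ l₂ l₃) =
      ∑ θ : Fin n → Ω, ENNReal.ofReal (∏ x, ρ (θ x)) *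
        (ENNReal.ofReal (listWeight t (fun x => u x (θ x)) l₁) *
        (ENNReal.ofReal (listWeight t (fun x => v x (θ x)) l₂) *
          ENNReal.ofReal (listWeight s (fun x => w x (θ x)) l₃))) := by
    intro l₁ l₂ l₃
    unfold mixWeight
    rw [ENNReal.ofReal_sum_of_nonneg]
    · refine Finset.sum_congr rfl fun θ _ => ?_
      rw [ENNReal.ofReal_mul (hρ θ), ENNReal.ofReal_mul (hlw t ht u hu θ _),
        ENNReal.ofReal_mul (hlw t ht v hv θ _)]
    · intro θ _
      exact mul_nonneg (hρ θ) (mul_nonneg (hlw t ht u hu θ _)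
        (mul_nonneg (hlw t ht v hv θ _) (hlw s hs w hw θ _)))
  simp only [h1, priorSum, listSum, ← ENNReal.tsum_mul_left, Finset.sum_mul]
  simp only [Summable.tsum_finsetSum (fun _ _ => ENNReal.summable), mul_assoc]

theorem listSum_one {u v w : Fin n → ℝ} {P Q S : PMF (Fin n)}
    (hP : IsNormalized u P) (hQ : IsNormalized v Q) (hS : IsNormalized w S)
    {t s : ℝ} (ht : 0 ≤ t) (hs : 0 ≤ s) :
    listSum t s u v w (fun _ _ _ => 1) = 1 := by
  unfold listSum
  simp only [tsum_listWeight hP ht, tsum_listWeight hQ ht, tsum_listWeight hS hs, iidSum_const]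
  simp only [mul_one, tsum_ofReal_pois (mul_nonneg hs hS.2.1.le),
    tsum_ofReal_pois (mul_nonneg ht hP.2.1.le), tsum_ofReal_pois (mul_nonneg ht hQ.2.1.le)]

/-- With `a = √p` and `b = √q` the claim is `φ a² ≤ 2 φ b² + 2 (a - b)²`, which follows from `(a -
2b)² ≥ 0` and `φ ≤ 1`. Allowing the factor 2 on the error under `q` makes the loss linear in 1 minus
the affinity. -/
theorem mul_add_sqrt_le {p q φ : ℝ} (hp : 0 ≤ p) (hq : 0 ≤ q) (h0 : 0 ≤ φ) (h1 : φ ≤ 1) :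
    p * φ + 4 * Real.sqrt (p * q) ≤ 2 * (q * φ) + 2 * (p + q) := by
  have ha := Real.sq_sqrt hp
  have hb := Real.sq_sqrt hq
  rw [Real.sqrt_mul hp]
  set a := Real.sqrt p
  set b := Real.sqrt q
  rw [← ha, ← hb]
  nlinarith [mul_nonneg h0 (sq_nonneg (a - 2 * b)), mul_nonneg (sub_nonneg.2 h1)
    (sq_nonneg (a - b)), sq_nonneg (a - b)]

theorem ofReal_mul_add_sqrt_le {p q : ℝ} {φ : ℝ≥0∞} (hp : 0 ≤ p) (hq : 0 ≤ q) (h1 : φ ≤ 1) :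
    ENNReal.ofReal p * φ + 4 * ENNReal.ofReal (Real.sqrt (p * q)) ≤
      2 * (ENNReal.ofReal q * φ) + 2 * (ENNReal.ofReal p + ENNReal.ofReal q) := by
  have hφ : φ = ENNReal.ofReal φ.toReal :=
    (ENNReal.ofReal_toReal (ne_top_of_le_ne_top ENNReal.one_ne_top h1)).symm
  have h0 : 0 ≤ φ.toReal := ENNReal.toReal_nonneg
  have h1' : φ.toReal ≤ 1 := by
    simpa using ENNReal.toReal_mono ENNReal.one_ne_top h1
  have h4 : (4 : ℝ≥0∞) = ENNReal.ofReal 4 := by simp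
  have h2 : (2 : ℝ≥0∞) = ENNReal.ofReal 2 := by simp
  rw [hφ, h4, h2, ← ENNReal.ofReal_mul hp, ← ENNReal.ofReal_mul hq,
    ← ENNReal.ofReal_mul (by norm_num), ← ENNReal.ofReal_mul (by norm_num),
    ← ENNReal.ofReal_add (by positivity) (by positivity), ← ENNReal.ofReal_add hp hq,
    ← ENNReal.ofReal_mul (by norm_num), ← ENNReal.ofReal_add (by positivity) (by positivity)]
  exact ENNReal.ofReal_le_ofReal (mul_add_sqrt_le hp hq h0 h1')

/-- Comparison of two mixtures through the affinities of their bins. -/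
theorem priorSum_listSum_le {ρ : Ω → ℝ} (h0 : ∀ ω, 0 ≤ ρ ω) (h1 : ∑ ω, ρ ω = 1)
    {t s : ℝ} (ht : 0 ≤ t) (hs : 0 ≤ s)
    {u v w w' : Fin n → Ω → ℝ} (hu : ∀ x ω, 0 ≤ u x ω) (hv : ∀ x ω, 0 ≤ v x ω)
    (hw : ∀ x ω, 0 ≤ w x ω) (hw' : ∀ x ω, 0 ≤ w' x ω)
    {P Q S S' : (Fin n → Ω) → PMF (Fin n)}
    (hP : ∀ θ, IsNormalized (fun x => u x (θ x)) (P θ))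
    (hQ : ∀ θ, IsNormalized (fun x => v x (θ x)) (Q θ))
    (hS : ∀ θ, IsNormalized (fun x => w x (θ x)) (S θ))
    (hS' : ∀ θ, IsNormalized (fun x => w' x (θ x)) (S' θ))
    {Φ : List (Fin n) → List (Fin n) → List (Fin n) → ℝ≥0∞} (hΦ : ∀ l₁ l₂ l₃, Φ l₁ l₂ l₃ ≤ 1) :
    priorSum ρ (fun θ => listSum t s (fun x => u x (θ x)) (fun x => v x (θ x))
        (fun x => w x (θ x)) Φ) +
      4 * ∏ x, affinity (binLaw ρ t s (u x) (v x) (w x)) (binLaw ρ t s (u x) (v x) (w' x)) ≤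
    2 * priorSum ρ (fun θ => listSum t s (fun x => u x (θ x)) (fun x => v x (θ x))
        (fun x => w' x (θ x)) Φ) + 4 := by
  have one : ∀ (z : Fin n → Ω → ℝ) (hz : ∀ x ω, 0 ≤ z x ω) (Z : (Fin n → Ω) → PMF (Fin n)),
      (∀ θ, IsNormalized (fun x => z x (θ x)) (Z θ)) →
      ∑' (l₁ : List (Fin n)) (l₂ : List (Fin n)) (l₃ : List (Fin n)),
        ENNReal.ofReal (mixWeight ρ t s u v z l₁ l₂ l₃) = 1 := by
    intro z hz Z hZ
    have := priorSum_listSum h0 ht hs hu hv hz (fun _ _ _ => 1)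
    simp only [listSum_one (hP _) (hQ _) (hZ _) ht hs, priorSum_one h0 h1, mul_one] at this
    exact this.symm
  have nonneg : ∀ (z : Fin n → Ω → ℝ), (∀ x ω, 0 ≤ z x ω) → ∀ l₁ l₂ l₃,
      0 ≤ mixWeight ρ t s u v z l₁ l₂ l₃ := by
    intro z hz l₁ l₂ l₃
    exact Finset.sum_nonneg fun θ _ => mul_nonneg (Finset.prod_nonneg fun x _ => h0 _)
      (mul_nonneg (listWeight_nonneg ht (fun x => hu x _) _)
        (mul_nonneg (listWeight_nonneg ht (fun x => hv x _) _)
          (listWeight_nonneg hs (fun x => hz x _) _)))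
  rw [priorSum_listSum h0 ht hs hu hv hw, priorSum_listSum h0 ht hs hu hv hw',
    ← tsum_sqrt_mixWeight h0 ht hs hu hv hw hw']
  calc _ = ∑' (l₁ : List (Fin n)) (l₂ : List (Fin n)) (l₃ : List (Fin n)),
        (ENNReal.ofReal (mixWeight ρ t s u v w l₁ l₂ l₃) * Φ l₁ l₂ l₃ +
          4 * ENNReal.ofReal (Real.sqrt (mixWeight ρ t s u v w l₁ l₂ l₃ *
            mixWeight ρ t s u v w' l₁ l₂ l₃))) := by
        simp only [ENNReal.tsum_add, ENNReal.tsum_mul_left]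
    _ ≤ ∑' (l₁ : List (Fin n)) (l₂ : List (Fin n)) (l₃ : List (Fin n)),
        (2 * (ENNReal.ofReal (mixWeight ρ t s u v w' l₁ l₂ l₃) * Φ l₁ l₂ l₃) +
          2 * (ENNReal.ofReal (mixWeight ρ t s u v w l₁ l₂ l₃) +
            ENNReal.ofReal (mixWeight ρ t s u v w' l₁ l₂ l₃))) := by
        refine ENNReal.tsum_le_tsum fun l₁ => ENNReal.tsum_le_tsum fun l₂ =>
          ENNReal.tsum_le_tsum fun l₃ => ?_
        exact ofReal_mul_add_sqrt_le (nonneg w hw _ _ _) (nonneg w' hw' _ _ _) (hΦ _ _ _)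
    _ = _ := by
        simp only [ENNReal.tsum_add, ENNReal.tsum_mul_left, one w hw S hS, one w' hw' S' hS']
        norm_num

end Mixture

theorem Algorithm.tapeVal_le_one (A : Algorithm n k) (src : Fin k → Tape)
    (F : Option (Finset (Finset (Fin k))) → ℝ≥0∞) (hF : ∀ o, F o ≤ 1) (T : ℕ)
    (h : List (Fin k × Fin n)) (l₁ l₂ l₃ : List (Fin n)) :
    A.tapeVal src F T h l₁ l₂ l₃ ≤ 1 := by
  have avg : ∀ (h : List (Fin k × Fin n)) (f : Action k → ℝ≥0∞), (∀ a, f a ≤ 1) →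
      ∑' a, A h a * f a ≤ 1 := by
    intro h f hf
    calc _ ≤ ∑' a, A h a * 1 := ENNReal.tsum_le_tsum fun a => mul_le_mul_right (hf a) _
      _ = 1 := by simp only [mul_one, PMF.tsum_coe]
  have popl : ∀ (l : List (Fin n)) (f : Fin n → List (Fin n) → ℝ≥0∞), (∀ x l, f x l ≤ 1) →
      pop l f ≤ 1 := by
    intro l f hf
    cases l
    · exact zero_le_one
    · exact hf _ _
  induction T generalizing h l₁ l₂ l₃ with
  | zero =>
    rw [Algorithm.tapeVal]
    refine avg _ _ fun a => ?_
    cases a <;> exact hF _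
  | succ T ih =>
    rw [Algorithm.tapeVal]
    refine avg _ _ fun a => ?_
    cases a with
    | answer g => exact hF _
    | draw i => cases hs : src i <;> simp only [hs] <;> exact popl _ _ fun _ _ => ih _ _ _ _

/-- The Weierstrass product inequality; it reduces closeness of the product laws to a sum of one-bin
losses. -/
theorem ofReal_one_sub_sum_le_prod {ι : Type*} (s : Finset ι) (f : ι → ℝ≥0∞) (β : ι → ℝ)
    (h0 : ∀ x ∈ s, 0 ≤ β x) (h1 : ∀ x ∈ s, β x ≤ 1) (h : ∀ x ∈ s, ENNReal.ofReal (1 - β x) ≤ f x) :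
    ENNReal.ofReal (1 - ∑ x ∈ s, β x) ≤ ∏ x ∈ s, f x := by
  calc ENNReal.ofReal (1 - ∑ x ∈ s, β x) ≤ ENNReal.ofReal (∏ x ∈ s, (1 - β x)) := by
        refine ENNReal.ofReal_le_ofReal ?_
        clear h
        classical
        induction s using Finset.induction_on with
        | empty => simp
        | insert a s ha ih =>
          rw [Finset.sum_insert ha, Finset.prod_insert ha]
          have ih' := ih (fun x hx => h0 x (Finset.mem_insert_of_mem hx))
            (fun x hx => h1 x (Finset.mem_insert_of_mem hx))
          have ha0 := h0 a (Finset.mem_insert_self _ _)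
          have ha1 := h1 a (Finset.mem_insert_self _ _)
          have hs0 : 0 ≤ ∑ x ∈ s, β x :=
            Finset.sum_nonneg fun x hx => h0 x (Finset.mem_insert_of_mem hx)
          nlinarith
    _ = ∏ x ∈ s, ENNReal.ofReal (1 - β x) :=
        ENNReal.ofReal_prod_of_nonneg fun x hx => sub_nonneg.2 (h1 x hx)
    _ ≤ _ := Finset.prod_le_prod' h

/-! ### The probability of missing a partition. -/

/-- Score `1` for every outcome other than the partition `{I, Iᶜ}`. -/
def missScore (I : Finset (Fin k)) (o : Option (Finset (Finset (Fin k)))) : ℝ≥0∞ :=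
  if o = some {I, Iᶜ} then 0 else 1

theorem missScore_le_one (I : Finset (Fin k)) (o : Option (Finset (Finset (Fin k)))) :
    missScore I o ≤ 1 := by
  unfold missScore; split_ifs <;> simp

theorem Algorithm.val_missScore_add (A : Algorithm n k) (D : Fin k → PMF (Fin n))
    (I : Finset (Fin k)) (T : ℕ) :
    A.val D (missScore I) T [] + A.run D T [] (some {I, Iᶜ}) = 1 := by
  have h : A.run D T [] (some {I, Iᶜ}) =
      ∑' o, A.run D T [] o * (if o = some {I, Iᶜ} then 1 else 0) := by
    rw [tsum_eq_single (some {I, Iᶜ})]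
    · simp
    · intro o ho
      simp [ho]
  rw [h, Algorithm.val, ← ENNReal.tsum_add]
  refine (tsum_congr fun o => ?_).trans (PMF.tsum_coe (A.run D T []))
  unfold missScore
  split_ifs <;> simp

/-- No outcome can equal two different partitions, so every outcome misses at least one of them. -/
theorem Algorithm.one_le_val_missScore_add (A : Algorithm n k) (D : Fin k → PMF (Fin n))
    {I I' : Finset (Fin k)} (h : ({I, Iᶜ} : Finset (Finset (Fin k))) ≠ {I', I'ᶜ}) (T : ℕ) :
    1 ≤ A.val D (missScore I) T [] + A.val D (missScore I') T [] := by
  rw [Algorithm.val, Algorithm.val, ← ENNReal.tsum_add, ← PMF.tsum_coe (A.run D T [])]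
  refine ENNReal.tsum_le_tsum fun o => ?_
  rw [← mul_add]
  refine le_mul_of_one_le_right (by simp) ?_
  unfold missScore
  by_cases h1 : o = some {I, Iᶜ}
  · have h2 : o ≠ some {I', I'ᶜ} := by
      rw [h1]; simpa using h
    simp [h2]
  · simp [h1]

/-- The two flipped sets differ at `i`, and they are not complementary because they agree at any
third index. -/
theorem partition_ne {J : Finset (Fin k)} {i j : Fin k} (hij : i ≠ j) (hk : 3 ≤ k) :
    ({symmDiff J {i}, (symmDiff J {i})ᶜ} : Finset (Finset (Fin k))) ≠
      {symmDiff J {j}, (symmDiff J {j})ᶜ} := by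
  intro h
  have hmem : symmDiff J {i} ∈ ({symmDiff J {j}, (symmDiff J {j})ᶜ} : Finset (Finset (Fin k))) := by
    rw [← h]; simp
  rw [Finset.mem_insert, Finset.mem_singleton] at hmem
  rcases hmem with h | h
  · have := Finset.ext_iff.1 h i
    simp [Finset.mem_symmDiff, hij] at this
  · obtain ⟨l, hl⟩ : ∃ l, l ∉ ({i, j} : Finset (Fin k)) := by
      by_contra hcon
      push Not at hcon
      have h2 : (Finset.univ : Finset (Fin k)) ⊆ {i, j} := fun l _ => hcon l
      have h3 := Finset.card_le_card h2
      have h4 := Finset.card_le_two (a := i) (b := j)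
      simp at h3
      omega
    simp only [Finset.mem_insert, Finset.mem_singleton, not_or] at hl
    have := Finset.ext_iff.1 h l
    simp [Finset.mem_symmDiff, hl] at this

/-! ### Hard families and the reduction to one-bin closeness. -/

section Mixture

variable {Ω : Type*} [Fintype Ω]

/-- A random pair of distributions whose atoms have independent masses, given by `u` and `v`. The
pair lies in `C` outside of an event of small probability. -/
structure HardFamily (n : ℕ) (Ω : Type*) [Fintype Ω] (C : Set (PMF (Fin n) × PMF (Fin n))) where
  /-- The law of the parameter of a bin. -/
  ρ : Ω → ℝ
  ρ_nonneg : ∀ ω, 0 ≤ ρ ω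
  ρ_sum : ∑ ω, ρ ω = 1
  /-- Masses of the first distribution. -/
  u : Fin n → Ω → ℝ
  /-- Masses of the second distribution. -/
  v : Fin n → Ω → ℝ
  u_nonneg : ∀ x ω, 0 ≤ u x ω
  v_nonneg : ∀ x ω, 0 ≤ v x ω
  /-- The first distribution. -/
  P : (Fin n → Ω) → PMF (Fin n)
  /-- The second distribution. -/
  Q : (Fin n → Ω) → PMF (Fin n)
  P_norm : ∀ θ, IsNormalized (fun x => u x (θ x)) (P θ)
  Q_norm : ∀ θ, IsNormalized (fun x => v x (θ x)) (Q θ)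
  /-- The parameters for which the pair lies in the class `C`. -/
  G : (Fin n → Ω) → Prop
  G_mem : ∀ θ, G θ → (P θ, Q θ) ∈ C
  G_u : ∀ θ, G θ → 1 / 2 ≤ ∑ x, u x (θ x)
  G_v : ∀ θ, G θ → 1 / 2 ≤ ∑ x, v x (θ x)
  G_prob : ∀ [DecidablePred G], priorSum ρ (fun θ => if G θ then 0 else 1) ≤ ENNReal.ofReal (1 / 20)

variable {C : Set (PMF (Fin n) × PMF (Fin n))}

/-- The bins of `H` carry little information on the source of the third tape. -/
def HardFamily.Close (H : HardFamily n Ω C) (t s : ℝ) : Prop :=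
  ∃ β : Fin n → ℝ, (∀ x, 0 ≤ β x) ∧ ∑ x, β x ≤ 1 / 200 ∧
    ∀ x, ENNReal.ofReal (1 - β x) ≤
      affinity (binLaw H.ρ t s (H.u x) (H.v x) (H.u x)) (binLaw H.ρ t s (H.u x) (H.v x) (H.v x))

theorem HardFamily.Close.prod_le {H : HardFamily n Ω C} {t s : ℝ} (h : H.Close t s) :
    ENNReal.ofReal (1 - 1 / 200) ≤ ∏ x, affinity (binLaw H.ρ t s (H.u x) (H.v x) (H.u x))
      (binLaw H.ρ t s (H.u x) (H.v x) (H.v x)) := by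
  obtain ⟨β, h0, hs, hβ⟩ := h
  have h1 : ∀ x, β x ≤ 1 := fun x => by
    have := Finset.single_le_sum (fun y _ => h0 y) (Finset.mem_univ x)
    linarith
  exact (ENNReal.ofReal_le_ofReal (by linarith)).trans
    (ofReal_one_sub_sum_le_prod Finset.univ _ β (fun x _ => h0 x) (fun x _ => h1 x)
      fun x _ => hβ x)

/-- Correctness on the legal input `J ∆ {j}` is transferred to `J`: the two inputs differ only in
the law of the third tape, and the mixtures over the family have affinity close to 1. -/
theorem HardFamily.priorSum_val_le (H : HardFamily n Ω C) {A : Algorithm n k} {T r N : ℕ}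
    (hA : A.Recovers T r C) (hclose : H.Close (40 * T) (40 * N)) {J : Finset (Fin k)} {j : Fin k}
    (hJ : (symmDiff J {j}).card = r) :
    priorSum H.ρ (fun θ => A.val (clustered J (H.P θ) (H.Q θ)) (missScore (symmDiff J {j})) T []) ≤
      priorSum H.ρ (fun θ => A.drawCount (clustered J (H.P θ) (H.Q θ)) j T []) /
        ((N : ℝ≥0∞) + 1) + ENNReal.ofReal (2 / 5) := by
  classical
  set I := symmDiff J {j} with hI
  set F := missScore I
  have hF := missScore_le_one I
  -- The same assignment of tapes serves `J` and `I`. Index `j` alone reads the third tape, so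
  -- passing from `J` to `I` changes nothing but the law of that tape.
  set src : Fin k → Tape := fun i => if i = j then .own else if i ∈ J then .fst else .snd with hsrc
  have hsrcj : ∀ i, src i = .own ↔ i = j := by
    intro i
    simp only [hsrc]
    split_ifs <;> simp_all
  have ht : (0 : ℝ) ≤ 40 * T := by positivity
  have hs : (0 : ℝ) ≤ 40 * N := by positivity
  -- The third tape has masses `w` under `J` and `w'` under `I`. Leaving them general treats `j ∈ J`
  -- and `j ∉ J` together; the two cases swap the roles of `P` and `Q`.
  have main : ∀ (w w' : Fin n → Ω → ℝ) (S S' : (Fin n → Ω) → PMF (Fin n)),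
      (∀ x ω, 0 ≤ w x ω) → (∀ x ω, 0 ≤ w' x ω) →
      (∀ θ, IsNormalized (fun x => w x (θ x)) (S θ)) →
      (∀ θ, IsNormalized (fun x => w' x (θ x)) (S' θ)) →
      (∀ θ, H.G θ → 1 / 2 ≤ ∑ x, w x (θ x)) →
      (∀ θ, clustered J (H.P θ) (H.Q θ) = fun i => tapeLaw (H.P θ) (H.Q θ) (S θ) (src i)) →
      (∀ θ, clustered I (H.P θ) (H.Q θ) = fun i => tapeLaw (H.P θ) (H.Q θ) (S' θ) (src i)) →
      ENNReal.ofReal (1 - 1 / 200) ≤ ∏ x, affinity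
        (binLaw H.ρ (40 * T) (40 * N) (H.u x) (H.v x) (w x))
        (binLaw H.ρ (40 * T) (40 * N) (H.u x) (H.v x) (w' x)) →
      priorSum H.ρ (fun θ => A.val (clustered J (H.P θ) (H.Q θ)) F T []) ≤
        priorSum H.ρ (fun θ => A.drawCount (clustered J (H.P θ) (H.Q θ)) j T []) /
          ((N : ℝ≥0∞) + 1) + ENNReal.ofReal (2 / 5) := by
    intro w w' S S' hw hw' hS hS' hGw hclus hclus' haff
    set V := priorSum H.ρ (fun θ => listSum (40 * T) (40 * N) (fun x => H.u x (θ x))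
      (fun x => H.v x (θ x)) (fun x => w x (θ x)) (A.tapeVal src F T [])) with hV
    set V' := priorSum H.ρ (fun θ => listSum (40 * T) (40 * N) (fun x => H.u x (θ x))
      (fun x => H.v x (θ x)) (fun x => w' x (θ x)) (A.tapeVal src F T [])) with hV'
    set bad := priorSum H.ρ (fun θ => if H.G θ then 0 else 1) with hbad
    have hbad1 : bad ≤ ENNReal.ofReal (1 / 20) := H.G_prob
    have hcmp : V + 4 * ENNReal.ofReal (1 - 1 / 200) ≤ 2 * V' + 4 := by
      refine le_trans ?_ (priorSum_listSum_le H.ρ_nonneg H.ρ_sum ht hs H.u_nonneg H.v_nonneg hw hw'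
        H.P_norm H.Q_norm hS hS' (fun l₁ l₂ l₃ => A.tapeVal_le_one src F hF T [] l₁ l₂ l₃))
      gcongr
    have hV1 : V' ≤ ENNReal.ofReal (1 / 10) + bad := by
      rw [← priorSum_const (n := n) H.ρ_nonneg H.ρ_sum (ENNReal.ofReal (1 / 10)), hbad,
        ← priorSum_add]
      refine priorSum_mono fun θ => ?_
      refine (listSum_tapeVal_le_val A (H.P_norm θ) (H.Q_norm θ) (hS' θ) ht hs src F T).trans ?_
      rw [← hclus' θ]
      by_cases hG : H.G θ
      · rw [if_pos hG, add_zero]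
        have h1 := hA _ _ (H.G_mem θ hG) I hJ
        have h2 := A.val_missScore_add (clustered I (H.P θ) (H.Q θ)) I T
        have h9 : (9 / 10 : ℝ≥0∞) = ENNReal.ofReal (9 / 10) := by
          rw [ENNReal.ofReal_div_of_pos (by norm_num)]; simp
        have h3 : A.val (clustered I (H.P θ) (H.Q θ)) F T [] + ENNReal.ofReal (9 / 10) ≤
            ENNReal.ofReal (1 / 10) + ENNReal.ofReal (9 / 10) := by
          rw [← ENNReal.ofReal_add (by norm_num) (by norm_num), ← h9]
          norm_num
          rw [← h2]
          gcongr
        exact (ENNReal.add_le_add_iff_right ENNReal.ofReal_ne_top).1 h3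
      · rw [if_neg hG]
        exact (A.val_le_one _ F hF _ _).trans le_add_self
    -- The error under `I` is at most 0.1 + 0.05 (failure plus bad event), and 2 · 0.15 + 4/200 =
    -- 0.32. The later losses 0.03 and 0.05 bring the total to 2/5.
    have hVV : V ≤ ENNReal.ofReal (32 / 100) := by
      have h4 : (4 : ℝ≥0∞) = ENNReal.ofReal 4 := by simp
      have h2 : (2 : ℝ≥0∞) = ENNReal.ofReal 2 := by simp
      have h5 : V' ≤ ENNReal.ofReal (15 / 100) := by
        refine hV1.trans ((add_le_add_right hbad1 _).trans ?_)
        rw [← ENNReal.ofReal_add (by norm_num) (by norm_num)]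
        norm_num
      have h6 : V + ENNReal.ofReal (398 / 100) ≤
          ENNReal.ofReal (32 / 100) + ENNReal.ofReal (398 / 100) := by
        calc V + ENNReal.ofReal (398 / 100) = V + 4 * ENNReal.ofReal (1 - 1 / 200) := by
              rw [h4, ← ENNReal.ofReal_mul (by norm_num)]; norm_num
          _ ≤ 2 * V' + 4 := hcmp
          _ ≤ 2 * ENNReal.ofReal (15 / 100) + 4 := by gcongr
          _ = _ := by
            rw [h4, h2, ← ENNReal.ofReal_mul (by norm_num),
              ← ENNReal.ofReal_add (by norm_num) (by norm_num),
              ← ENNReal.ofReal_add (by norm_num) (by norm_num)]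
            norm_num
      exact (ENNReal.add_le_add_iff_right ENNReal.ofReal_ne_top).1 h6
    set d := priorSum H.ρ (fun θ => A.drawCount (clustered J (H.P θ) (H.Q θ)) j T [])
    calc priorSum H.ρ (fun θ => A.val (clustered J (H.P θ) (H.Q θ)) F T [])
        ≤ V + d / ((N : ℝ≥0∞) + 1) + ENNReal.ofReal (3 / 100) + bad := by
          rw [hV, div_eq_mul_inv, ← priorSum_mul_const,
            ← priorSum_const (n := n) H.ρ_nonneg H.ρ_sum (ENNReal.ofReal (3 / 100)), hbad,
            ← priorSum_add, ← priorSum_add, ← priorSum_add]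
          refine priorSum_mono fun θ => ?_
          by_cases hG : H.G θ
          · rw [if_pos hG, add_zero, hclus θ]
            -- On the good event the total masses are at least 1/2, so intensities `40 * T` and `40
            -- * N` give the means `20 * T` and `20 * N` that the tail bound requires.
            refine val_le_listSum_tapeVal A (H.P_norm θ) (H.Q_norm θ) (hS θ) ht hs src j hsrcj F hF
              T N ?_ ?_ ?_
            · nlinarith [H.G_u θ hG, (Nat.cast_nonneg T : (0 : ℝ) ≤ T)]
            · nlinarith [H.G_v θ hG, (Nat.cast_nonneg T : (0 : ℝ) ≤ T)]
            · nlinarith [hGw θ hG, (Nat.cast_nonneg N : (0 : ℝ) ≤ N)]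
          · rw [if_neg hG]
            exact (A.val_le_one _ F hF _ _).trans le_add_self
      _ ≤ ENNReal.ofReal (32 / 100) + d / ((N : ℝ≥0∞) + 1) + ENNReal.ofReal (3 / 100) +
          ENNReal.ofReal (1 / 20) := by gcongr
      _ = d / ((N : ℝ≥0∞) + 1) + ENNReal.ofReal (2 / 5) := by
          rw [add_comm (ENNReal.ofReal _), add_assoc, add_assoc,
            ← ENNReal.ofReal_add (by norm_num) (by norm_num),
            ← ENNReal.ofReal_add (by norm_num) (by norm_num)]
          norm_num
  by_cases hj : j ∈ J
  · refine main H.u H.v H.P H.Q H.u_nonneg H.v_nonneg H.P_norm H.Q_norm H.G_u ?_ ?_ hclose.prod_le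
    · intro θ; funext i
      simp only [clustered, hsrc]
      by_cases h1 : i = j
      · subst h1; simp [hj, tapeLaw]
      · by_cases h2 : i ∈ J <;> simp [h1, h2, tapeLaw]
    · intro θ; funext i
      simp only [clustered, hsrc, hI, Finset.mem_symmDiff]
      by_cases h1 : i = j
      · subst h1; simp [hj, tapeLaw]
      · by_cases h2 : i ∈ J <;> simp [h1, h2, tapeLaw]
  · refine main H.v H.u H.Q H.P H.v_nonneg H.u_nonneg H.Q_norm H.P_norm H.G_v ?_ ?_ ?_
    · intro θ; funext i
      simp only [clustered, hsrc]
      by_cases h1 : i = j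
      · subst h1; simp [hj, tapeLaw]
      · by_cases h2 : i ∈ J <;> simp [h1, h2, tapeLaw]
    · intro θ; funext i
      simp only [clustered, hsrc, hI, Finset.mem_symmDiff]
      by_cases h1 : i = j
      · subst h1; simp [hj, tapeLaw]
      · by_cases h2 : i ∈ J <;> simp [h1, h2, tapeLaw]
    · simp only [affinity_comm (binLaw _ _ _ _ _ (H.v _))]
      exact hclose.prod_le

/-- An index is added if `r` is at most `k / 2` and removed otherwise, so that at least half of the
indices are available for the flip. -/
theorem exists_base_set {r : ℕ} (hr : 1 ≤ r) (hrk : r < k) :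
    ∃ J K : Finset (Fin k), k ≤ 2 * K.card ∧ ∀ j ∈ K, (symmDiff J {j}).card = r := by
  by_cases h : 2 * r ≤ k
  · obtain ⟨J, hJ⟩ := Finset.exists_subset_card_eq (s := (Finset.univ : Finset (Fin k)))
      (n := r - 1) (by simp; omega)
    refine ⟨J, Jᶜ, ?_, ?_⟩
    · rw [Finset.card_compl, hJ.2, Fintype.card_fin]; omega
    · intro j hj
      have hj' : j ∉ J := Finset.mem_compl.1 hj
      have : symmDiff J {j} = insert j J := by
        ext i
        simp only [Finset.mem_symmDiff, Finset.mem_singleton, Finset.mem_insert]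
        by_cases h1 : i = j
        · subst h1; simp [hj']
        · simp [h1]
      rw [this, Finset.card_insert_of_notMem hj', hJ.2]; omega
  · obtain ⟨J, hJ⟩ := Finset.exists_subset_card_eq (s := (Finset.univ : Finset (Fin k)))
      (n := r + 1) (by simp; omega)
    refine ⟨J, J, by omega, ?_⟩
    intro j hj
    have : symmDiff J {j} = J.erase j := by
      ext i
      simp only [Finset.mem_symmDiff, Finset.mem_singleton, Finset.mem_erase]
      by_cases h1 : i = j
      · subst h1; simp [hj]
      · simp [h1]
    rw [this, Finset.card_erase_of_mem hj, hJ.2]; omega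

/-- A correct algorithm needs enough samples to tell apart the two sources of the third tape. -/
theorem HardFamily.not_close (H : HardFamily n Ω C) {A : Algorithm n k} {T r N : ℕ}
    (hk : 100 ≤ k) (hr : 1 ≤ r) (hrk : r < k) (hA : A.Recovers T r C)
    (hN : 80 * T ≤ (N + 1) * k) : ¬ H.Close (40 * T) (40 * N) := by
  intro hclose
  obtain ⟨J, K, hK, hJ⟩ := exists_base_set hr hrk
  set d : Fin k → ℝ≥0∞ := fun j =>
    priorSum H.ρ (fun θ => A.drawCount (clustered J (H.P θ) (H.Q θ)) j T []) with hd
  have hsum : ∑ j, d j ≤ T := by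
    simp only [hd, priorSum]
    rw [Finset.sum_comm]
    calc _ ≤ ∑ θ : Fin n → Ω, ENNReal.ofReal (∏ x, H.ρ (θ x)) * (T : ℝ≥0∞) := by
          refine Finset.sum_le_sum fun θ _ => ?_
          rw [← Finset.mul_sum]
          exact mul_le_mul_right (A.sum_drawCount_le _ _ _) _
      _ = T := priorSum_const H.ρ_nonneg H.ρ_sum _
  set K' := K.filter fun j => d j / ((N : ℝ≥0∞) + 1) ≤ ENNReal.ofReal (1 / 20) with hK'
  -- Otherwise more than `k / 4` indices of `K` have expected count above `(N + 1) / 20`. Summing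
  -- their counts gives `80 * T > (N + 1) * k`, against `hN`; this is the origin of the 80.
  have hcard : 1 < K'.card := by
    by_contra hcon
    set B := K.filter fun j => ¬ d j / ((N : ℝ≥0∞) + 1) ≤ ENNReal.ofReal (1 / 20) with hB
    have h1 : K'.card + B.card = K.card := Finset.card_filter_add_card_filter_not _
    have h2 : k < 4 * B.card := by omega
    have h3 : (B.card : ℝ≥0∞) * (ENNReal.ofReal (1 / 20) * ((N : ℝ≥0∞) + 1)) ≤ T := by
      rw [← nsmul_eq_mul]
      refine (Finset.card_nsmul_le_sum B d _ fun j hj => ?_).trans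
        ((Finset.sum_le_sum_of_subset (Finset.subset_univ B)).trans hsum)
      have h4 := (Finset.mem_filter.1 hj).2
      rw [not_le] at h4
      have h5 := ENNReal.mul_le_of_le_div h4.le
      exact h5
    have h6 : ((B.card : ℝ) * (1 / 20 * ((N : ℝ) + 1))) ≤ T := by
      have h7 : (B.card : ℝ≥0∞) * (ENNReal.ofReal (1 / 20) * ((N : ℝ≥0∞) + 1)) =
          ENNReal.ofReal ((B.card : ℝ) * (1 / 20 * ((N : ℝ) + 1))) := by
        rw [ENNReal.ofReal_mul (by positivity), ENNReal.ofReal_mul (by positivity),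
          ENNReal.ofReal_natCast, ENNReal.ofReal_add (by positivity) (by positivity),
          ENNReal.ofReal_natCast, ENNReal.ofReal_one]
      rw [h7, ← ENNReal.ofReal_natCast T] at h3
      exact (ENNReal.ofReal_le_ofReal_iff (by positivity)).1 h3
    have h8 : B.card * (N + 1) ≤ 20 * T := by
      have : (B.card : ℝ) * ((N : ℝ) + 1) ≤ 20 * T := by linarith
      exact_mod_cast this
    nlinarith
  obtain ⟨i, hi, j, hj, hij⟩ := Finset.one_lt_card.1 hcard
  set e : Fin k → ℝ≥0∞ := fun j => priorSum H.ρ (fun θ =>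
    A.val (clustered J (H.P θ) (H.Q θ)) (missScore (symmDiff J {j})) T []) with he
  have hle : ∀ l ∈ K', e l ≤ ENNReal.ofReal (45 / 100) := by
    intro l hl
    rw [hK', Finset.mem_filter] at hl
    refine (H.priorSum_val_le hA hclose (hJ l hl.1)).trans ((add_le_add_left hl.2 _).trans ?_)
    rw [← ENNReal.ofReal_add (by norm_num) (by norm_num)]
    norm_num
  -- Each of the two miss probabilities is at most 0.45, yet together they cover everything.
  have hge : 1 ≤ e i + e j := by
    rw [← priorSum_one (n := n) H.ρ_nonneg H.ρ_sum]
    simp only [he]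
    rw [← priorSum_add]
    exact priorSum_mono fun θ => A.one_le_val_missScore_add _ (partition_ne hij (by omega)) T
  have h1 := hge.trans (add_le_add (hle i hi) (hle j hj))
  rw [← ENNReal.ofReal_add (by norm_num) (by norm_num), ← ENNReal.ofReal_one,
    ENNReal.ofReal_le_ofReal_iff (by norm_num)] at h1
  norm_num at h1

/-- The floor of `80 * T / k` is the least `N` admitted by `not_close`. Every lower bound below is
obtained by contradicting the failure of closeness at this `N`. -/
theorem HardFamily.exists_not_close (H : HardFamily n Ω C) {A : Algorithm n k} {T r : ℕ}
    (hk : 100 ≤ k) (hr : 1 ≤ r) (hrk : r < k) (hA : A.Recovers T r C) :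
    ∃ N : ℕ, (N : ℝ) * k ≤ 80 * T ∧ ¬ H.Close (40 * T) (40 * N) := by
  refine ⟨80 * T / k, by exact_mod_cast Nat.div_mul_le_self (80 * T) k,
    H.not_close hk hr hrk hA ?_⟩
  have := Nat.lt_div_mul_add (a := 80 * T) (b := k) (by omega)
  nlinarith

end Mixture

/-! ### Hellinger estimates for the laws of the counts. -/

theorem hasSum_mul_triple {f g h : ℕ → ℝ} {a b c : ℝ} (hf : HasSum f a) (hg : HasSum g b)
    (hh : HasSum h c) (f0 : ∀ x, 0 ≤ f x) (g0 : ∀ x, 0 ≤ g x) (h0 : ∀ x, 0 ≤ h x) :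
    HasSum (fun z : ℕ × ℕ × ℕ => f z.1 * g z.2.1 * h z.2.2) (a * b * c) := by
  have h1 : HasSum (fun z : ℕ × ℕ => g z.1 * h z.2) (b * c) :=
    hg.mul hh (hg.summable.mul_of_nonneg hh.summable g0 h0)
  have h2 : HasSum (fun z : ℕ × ℕ × ℕ => f z.1 * (g z.2.1 * h z.2.2)) (a * (b * c)) :=
    hf.mul h1 (hf.summable.mul_of_nonneg h1.summable f0 fun z => mul_nonneg (g0 _) (h0 _))
  simpa only [mul_assoc] using h2

theorem hasSum_binLaw {Ω : Type*} [Fintype Ω] {ρ : Ω → ℝ} (h1 : ∑ ω, ρ ω = 1)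
    {t s : ℝ} (ht : 0 ≤ t) (hs : 0 ≤ s)
    {u v w : Ω → ℝ} (hu : ∀ ω, 0 ≤ u ω) (hv : ∀ ω, 0 ≤ v ω) (hw : ∀ ω, 0 ≤ w ω) :
    HasSum (fun z : ℕ × ℕ × ℕ => binLaw ρ t s u v w z.1 z.2.1 z.2.2) 1 := by
  have h : ∀ ω ∈ (Finset.univ : Finset Ω), HasSum (fun z : ℕ × ℕ × ℕ =>
      ρ ω * (pois (t * u ω) z.1 * pois (t * v ω) z.2.1 * pois (s * w ω) z.2.2)) (ρ ω) := by
    intro ω _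
    have := (hasSum_mul_triple (hasSum_pois (t * u ω)) (hasSum_pois (t * v ω))
      (hasSum_pois (s * w ω)) (pois_nonneg (mul_nonneg ht (hu ω)))
      (pois_nonneg (mul_nonneg ht (hv ω))) (pois_nonneg (mul_nonneg hs (hw ω)))).mul_left (ρ ω)
    simpa only [mul_one] using this
  rw [← h1]
  exact hasSum_sum h

/-- A lower bound for the affinity from an upper bound for the Hellinger distance. -/
theorem ofReal_le_affinity {p q : ℕ → ℕ → ℕ → ℝ} {e : ℕ × ℕ × ℕ → ℝ} {E β : ℝ}
    (hp0 : ∀ a b c, 0 ≤ p a b c) (hq0 : ∀ a b c, 0 ≤ q a b c)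
    (hp : HasSum (fun z : ℕ × ℕ × ℕ => p z.1 z.2.1 z.2.2) 1)
    (hq : HasSum (fun z : ℕ × ℕ × ℕ => q z.1 z.2.1 z.2.2) 1)
    (he : HasSum e E)
    (hpq : ∀ a b c, (Real.sqrt (p a b c) - Real.sqrt (q a b c)) ^ 2 ≤ e (a, b, c))
    (hβ : E ≤ 2 * β) : ENNReal.ofReal (1 - β) ≤ affinity p q := by
  have he0 : ∀ z, 0 ≤ e z := fun z => (sq_nonneg _).trans (hpq z.1 z.2.1 z.2.2)
  have hE : 0 ≤ E := he.nonneg he0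
  have h1 : ∑' z : ℕ × ℕ × ℕ, ENNReal.ofReal ((p z.1 z.2.1 z.2.2 + q z.1 z.2.1 z.2.2) / 2) = 1 := by
    have hs := (hp.add hq).div_const 2
    rw [← ENNReal.ofReal_tsum_of_nonneg (fun z => by
      have := hp0 z.1 z.2.1 z.2.2; have := hq0 z.1 z.2.1 z.2.2; positivity) hs.summable, hs.tsum_eq]
    norm_num
  have h2 : ∑' z : ℕ × ℕ × ℕ, ENNReal.ofReal (e z / 2) = ENNReal.ofReal (E / 2) := by
    have hs := he.div_const 2
    rw [← ENNReal.ofReal_tsum_of_nonneg (fun z => by have := he0 z; positivity) hs.summable,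
      hs.tsum_eq]
  have h3 : affinity p q = ∑' z : ℕ × ℕ × ℕ,
      ENNReal.ofReal (Real.sqrt (p z.1 z.2.1 z.2.2 * q z.1 z.2.1 z.2.2)) := by
    rw [ENNReal.tsum_prod']
    simp only [ENNReal.tsum_prod' (f := fun z : ℕ × ℕ => _)]
    rfl
  have h4 : 1 ≤ affinity p q + ENNReal.ofReal (E / 2) := by
    rw [← h1, ← h2, h3, ← ENNReal.tsum_add]
    refine ENNReal.tsum_le_tsum fun z => ?_
    rw [← ENNReal.ofReal_add (Real.sqrt_nonneg _) (by have := he0 z; positivity)]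
    refine ENNReal.ofReal_le_ofReal ?_
    have ha := Real.sq_sqrt (hp0 z.1 z.2.1 z.2.2)
    have hb := Real.sq_sqrt (hq0 z.1 z.2.1 z.2.2)
    have hc := hpq z.1 z.2.1 z.2.2
    -- Pointwise, `√(p q) = (p + q) / 2 - (√p - √q)² / 2`.
    rw [Real.sqrt_mul (hp0 _ _ _)]
    nlinarith
  calc ENNReal.ofReal (1 - β) ≤ ENNReal.ofReal (1 - E / 2) :=
        ENNReal.ofReal_le_ofReal (by linarith)
    _ = 1 - ENNReal.ofReal (E / 2) := by
        rw [ENNReal.ofReal_sub _ (by positivity), ENNReal.ofReal_one]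
    _ ≤ affinity p q := tsub_le_iff_right.2 h4

/-- Since `(√p - √q)² (√p + √q)² = (p - q)²` and `(√p + √q)² ≥ p + q`, Hellinger terms are dominated
by chi-square terms. Any lower bound `d` of `p + q` may serve as denominator, so a convenient
component of a mixture can be selected. -/
theorem sq_sqrt_sub_sqrt_le {p q d e : ℝ} (hp : 0 ≤ p) (hq : 0 ≤ q) (he : 0 ≤ e)
    (hd : d ≤ p + q) (h : (p - q) ^ 2 ≤ e * d) : (Real.sqrt p - Real.sqrt q) ^ 2 ≤ e := by
  have ha := Real.sq_sqrt hp
  have hb := Real.sq_sqrt hq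
  have ha0 := Real.sqrt_nonneg p
  have hb0 := Real.sqrt_nonneg q
  set a := Real.sqrt p
  set b := Real.sqrt q
  rcases (add_nonneg hp hq).eq_or_lt' with h0 | h0
  · have h1 : p = 0 := by linarith
    have h2 : q = 0 := by linarith
    have h3 : a = 0 := by nlinarith
    have h4 : b = 0 := by nlinarith
    rw [h3, h4]; simpa using he
  · have h1 : (a - b) ^ 2 * (p + q) ≤ e * (p + q) := by
      calc (a - b) ^ 2 * (p + q) ≤ (a - b) ^ 2 * (a + b) ^ 2 := by
            gcongr
            nlinarith [mul_nonneg ha0 hb0]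
        _ = (p - q) ^ 2 := by rw [← ha, ← hb]; ring
        _ ≤ e * d := h
        _ ≤ _ := by gcongr
    exact le_of_mul_le_mul_right h1 h0

/-- The geometric mean of two Poisson laws is an unnormalized Poisson law with mean `√μ √ν`, whose
total mass is explicit. -/
theorem hasSum_sq_sqrt_pois_sub {μ ν : ℝ} (hμ : 0 ≤ μ) (hν : 0 ≤ ν) :
    HasSum (fun c => (Real.sqrt (pois μ c) - Real.sqrt (pois ν c)) ^ 2)
      (2 - 2 * Real.exp (-((Real.sqrt μ - Real.sqrt ν) ^ 2 / 2))) := by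
  have h1 : ∀ c, Real.sqrt (pois μ c) * Real.sqrt (pois ν c) =
      Real.exp (-((μ + ν) / 2)) * ((Real.sqrt μ * Real.sqrt ν) ^ c / c.factorial) := by
    intro c
    rw [← Real.sqrt_mul (pois_nonneg hμ c), Real.sqrt_eq_iff_mul_self_eq
      (mul_nonneg (pois_nonneg hμ c) (pois_nonneg hν c)) (by positivity)]
    have h2 : Real.exp (-((μ + ν) / 2)) * Real.exp (-((μ + ν) / 2)) =
        Real.exp (-μ) * Real.exp (-ν) := by
      rw [← Real.exp_add, ← Real.exp_add]; ring_nf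
    have h3 : (Real.sqrt μ * Real.sqrt ν) ^ c * (Real.sqrt μ * Real.sqrt ν) ^ c = μ ^ c * ν ^ c := by
      rw [← mul_pow, ← mul_pow, mul_mul_mul_comm, Real.mul_self_sqrt hμ, Real.mul_self_sqrt hν]
    calc _ = (Real.exp (-μ) * Real.exp (-ν)) * (μ ^ c * ν ^ c) / (c.factorial * c.factorial) := by
          unfold pois; ring
      _ = _ := by rw [← h2, ← h3]; ring
  have h4 : Real.exp (-((Real.sqrt μ - Real.sqrt ν) ^ 2 / 2)) =
      Real.exp (-((μ + ν) / 2)) * Real.exp (Real.sqrt μ * Real.sqrt ν) := by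
    rw [← Real.exp_add]
    congr 1
    nlinarith [Real.sq_sqrt hμ, Real.sq_sqrt hν]
  have h5 := ((hasSum_pois μ).add (hasSum_pois ν)).sub
    (((hasSum_pow_div_factorial (Real.sqrt μ * Real.sqrt ν)).mul_left
      (Real.exp (-((μ + ν) / 2)))).mul_left 2)
  rw [h4]
  rw [show (2 : ℝ) - 2 * (Real.exp (-((μ + ν) / 2)) * Real.exp (Real.sqrt μ * Real.sqrt ν)) =
    1 + 1 - 2 * (Real.exp (-((μ + ν) / 2)) * Real.exp (Real.sqrt μ * Real.sqrt ν)) by ring]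
  refine (funext fun c => ?_ : (fun c => (Real.sqrt (pois μ c) - Real.sqrt (pois ν c)) ^ 2) = _) ▸ h5
  rw [← h1]
  nlinarith [Real.sq_sqrt (pois_nonneg hμ c), Real.sq_sqrt (pois_nonneg hν c)]

theorem two_sub_two_mul_exp_le (x : ℝ) : 2 - 2 * Real.exp (-(x / 2)) ≤ x := by
  have := Real.add_one_le_exp (-(x / 2))
  linarith

/-! ### Fixed pairs: the term k/ε². -/

/-- Lower bound from a single pair of distributions. -/
theorem Algorithm.Recovers.le_of_pair {n k : ℕ} {A : Algorithm n k} {T r : ℕ}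
    {C : Set (PMF (Fin n) × PMF (Fin n))} (hk : 100 ≤ k) (hr : 1 ≤ r) (hrk : r < k)
    (hA : A.Recovers T r C) {P Q : PMF (Fin n)} (hPQ : (P, Q) ∈ C) {u v : Fin n → ℝ}
    (hu : ∀ x, 0 ≤ u x) (hv : ∀ x, 0 ≤ v x) (hu1 : ∑ x, u x = 1) (hv1 : ∑ x, v x = 1)
    (hP : ∀ x, P x = ENNReal.ofReal (u x)) (hQ : ∀ x, Q x = ENNReal.ofReal (v x)) :
    (k : ℝ) ≤ 320000 * (T * ∑ x, (Real.sqrt (u x) - Real.sqrt (v x)) ^ 2) := by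
  classical
  let H : HardFamily n Unit C :=
    { ρ := fun _ => 1
      ρ_nonneg := fun _ => zero_le_one
      ρ_sum := by simp
      u := fun x _ => u x
      v := fun x _ => v x
      u_nonneg := fun x _ => hu x
      v_nonneg := fun x _ => hv x
      P := fun _ => P
      Q := fun _ => Q
      P_norm := fun _ => ⟨hu, by rw [hu1]; exact one_pos, fun x => by rw [hu1, div_one, hP]⟩
      Q_norm := fun _ => ⟨hv, by rw [hv1]; exact one_pos, fun x => by rw [hv1, div_one, hQ]⟩
      G := fun _ => True
      G_mem := fun _ _ => hPQ
      G_u := fun _ _ => by rw [hu1]; norm_num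
      G_v := fun _ _ => by rw [hv1]; norm_num
      G_prob := by simp [priorSum] }
  obtain ⟨N, hN2, hnot⟩ := H.exists_not_close hk hr hrk hA
  have ht : (0 : ℝ) ≤ 40 * T := by positivity
  have hs : (0 : ℝ) ≤ 40 * N := by positivity
  set h2 := ∑ x, (Real.sqrt (u x) - Real.sqrt (v x)) ^ 2 with hh2
  have hh0 : 0 ≤ h2 := Finset.sum_nonneg fun x _ => sq_nonneg _
  -- With a deterministic pair the first two tapes carry no information about the source of the
  -- third, so the bin loss is half the squared Hellinger distance of two Poisson laws, at most `20
  -- * N * (√u - √v)²`. Combined with `N * k ≤ 80 * T` this yields 320000 = 200 · 20 · 80.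
  have hlt : 1 / 200 < 20 * N * h2 := by
    by_contra hcon
    rw [not_lt] at hcon
    refine hnot ⟨fun x => 20 * N * (Real.sqrt (u x) - Real.sqrt (v x)) ^ 2, fun x => by positivity,
      by rwa [← Finset.mul_sum], fun x => ?_⟩
    have hnn := fun (w : Unit → ℝ) (hw : ∀ ω, 0 ≤ w ω) => binLaw_nonneg (ρ := fun _ => 1)
      (fun _ => zero_le_one) ht hs (u := fun _ => u x) (v := fun _ => v x) (fun _ => hu x)
      (fun _ => hv x) hw
    have hsm := fun (w : Unit → ℝ) (hw : ∀ ω, 0 ≤ w ω) => hasSum_binLaw (ρ := fun _ => 1)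
      (by simp) ht hs (u := fun _ => u x) (v := fun _ => v x) (fun _ => hu x)
      (fun _ => hv x) hw
    have hpu := pois_nonneg (mul_nonneg ht (hu x))
    have hpv := pois_nonneg (mul_nonneg ht (hv x))
    refine ofReal_le_affinity (hnn _ fun _ => hu x) (hnn _ fun _ => hv x) (hsm _ fun _ => hu x)
      (hsm _ fun _ => hv x) (hasSum_mul_triple (hasSum_pois _) (hasSum_pois _)
        (hasSum_sq_sqrt_pois_sub (mul_nonneg hs (hu x)) (mul_nonneg hs (hv x))) hpu hpv
        fun _ => sq_nonneg _) ?_ ?_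
    · intro a b c
      refine le_of_eq ?_
      simp only [binLaw, Finset.univ_unique, Finset.sum_singleton]
      have h0 : 0 ≤ pois (40 * T * u x) a * pois (40 * T * v x) b := mul_nonneg (hpu a) (hpv b)
      rw [show (H.u x default) = u x from rfl, show (H.v x default) = v x from rfl,
        show H.ρ default = 1 from rfl, one_mul, one_mul,
        Real.sqrt_mul h0, Real.sqrt_mul h0, ← mul_sub, mul_pow, Real.sq_sqrt h0]
    · rw [one_mul, one_mul]
      refine (two_sub_two_mul_exp_le _).trans (le_of_eq ?_)
      rw [Real.sqrt_mul hs, Real.sqrt_mul hs, ← mul_sub, mul_pow, Real.sq_sqrt hs]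
      ring
  have h5 : (N : ℝ) * k * h2 ≤ 80 * T * h2 := by gcongr
  nlinarith

/-- The probability distribution proportional to given masses. -/
noncomputable def massPMF (w : Fin n → ℝ) (hw : ∀ x, 0 ≤ w x) (hW : 0 < ∑ x, w x) : PMF (Fin n) :=
  PMF.ofFintype (fun x => ENNReal.ofReal (w x / ∑ y, w y)) (by
    rw [← ENNReal.ofReal_sum_of_nonneg fun x _ => div_nonneg (hw x) hW.le, ← Finset.sum_div,
      div_self hW.ne', ENNReal.ofReal_one])

theorem isNormalized_massPMF (w : Fin n → ℝ) (hw : ∀ x, 0 ≤ w x) (hW : 0 < ∑ x, w x) :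
    IsNormalized w (massPMF w hw hW) :=
  ⟨hw, hW, fun _ => rfl⟩

theorem IsNormalized.tvDist_eq {u v : Fin n → ℝ} {P Q : PMF (Fin n)} (hP : IsNormalized u P)
    (hQ : IsNormalized v Q) :
    tvDist P Q = (1 / 2) * ∑ x, |u x / ∑ y, u y - v x / ∑ y, v y| := by
  unfold tvDist
  congr 1
  refine Finset.sum_congr rfl fun x _ => ?_
  rw [hP.2.2, hQ.2.2, ENNReal.toReal_ofReal (div_nonneg (hP.1 x) hP.2.1.le),
    ENNReal.toReal_ofReal (div_nonneg (hQ.1 x) hQ.2.1.le)]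

theorem IsNormalized.eq_ofReal {u : Fin n → ℝ} {P : PMF (Fin n)} (hP : IsNormalized u P)
    (h1 : ∑ x, u x = 1) (x : Fin n) : P x = ENNReal.ofReal (u x) := by
  rw [hP.2.2, h1, div_one]

theorem ofReal_one_div_natCast (hn : 0 < n) : ENNReal.ofReal (1 / n) = (n : ℝ≥0∞)⁻¹ := by
  rw [one_div, ENNReal.ofReal_inv_of_pos (by exact_mod_cast hn), ENNReal.ofReal_natCast]

/-- Two atoms suffice: masses (1 ± ε)/2 and (1 ∓ ε)/2 are at distance ε with squared Hellinger
distance at most 2ε². -/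
theorem Algorithm.Recovers.le_of_bothUnknown {A : Algorithm n k} {T r : ℕ} {ε : ℝ}
    (hn : 2 ≤ n) (hk : 100 ≤ k) (hr : 1 ≤ r) (hrk : r < k) (hε : 0 < ε) (hε1 : ε < 1)
    (hA : A.Recovers T r (bothUnknown n ε)) : (k : ℝ) ≤ 640000 * (T * ε ^ 2) := by
  let a : Fin n := ⟨0, by omega⟩
  let b : Fin n := ⟨1, by omega⟩
  have hab : a ≠ b := by simp [a, b]
  let f : ℝ → Fin n → ℝ := fun s x =>
    (if x = a then (1 + s) / 2 else 0) + (if x = b then (1 - s) / 2 else 0)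
  have hf0 : ∀ s, -1 ≤ s → s ≤ 1 → ∀ x, 0 ≤ f s x := by
    intro s h1 h2 x
    simp only [f]
    split_ifs <;> linarith
  have hf1 : ∀ s, ∑ x, f s x = 1 := by
    intro s
    simp only [f, Finset.sum_add_distrib, Finset.sum_ite_eq', Finset.mem_univ, if_true]
    ring
  have hP := isNormalized_massPMF (f ε) (hf0 _ (by linarith) hε1.le) (by rw [hf1]; norm_num)
  have hQ := isNormalized_massPMF (f (-ε)) (hf0 _ (by linarith) (by linarith))
    (by rw [hf1]; norm_num)
  have hsum : ∀ c : ℝ, ∑ x, ((if x = a then c else 0) + (if x = b then c else 0)) = 2 * c := by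
    intro c
    simp only [Finset.sum_add_distrib, Finset.sum_ite_eq', Finset.mem_univ, if_true]
    ring
  have hmem : (massPMF (f ε) (hf0 _ (by linarith) hε1.le) (by rw [hf1]; norm_num),
      massPMF (f (-ε)) (hf0 _ (by linarith) (by linarith)) (by rw [hf1]; norm_num)) ∈
      bothUnknown n ε := by
    change ε ≤ tvDist _ _
    rw [hP.tvDist_eq hQ, hf1, hf1]
    have : ∀ x, |f ε x / 1 - f (-ε) x / 1| =
        (if x = a then ε else 0) + (if x = b then ε else 0) := by
      intro x
      simp only [f]
      by_cases h1 : x = a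
      · subst h1
        rw [if_pos rfl, if_pos rfl, if_pos rfl, if_neg hab, if_neg hab, if_neg hab, abs_of_nonneg]
        · ring
        · linarith
      · by_cases h2 : x = b
        · subst h2
          rw [if_neg h1, if_neg h1, if_neg h1, if_pos rfl, if_pos rfl, if_pos rfl, abs_of_nonpos]
          · ring
          · linarith
        · simp [h1, h2]
    simp only [this, hsum]
    linarith
  have h := hA.le_of_pair hk hr hrk hmem (hf0 _ (by linarith) hε1.le)
    (hf0 _ (by linarith) (by linarith)) (hf1 _) (hf1 _) (hP.eq_ofReal (hf1 _))
    (hQ.eq_ofReal (hf1 _))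
  have hH : ∑ x, (Real.sqrt (f ε x) - Real.sqrt (f (-ε) x)) ^ 2 ≤ 2 * ε ^ 2 := by
    rw [← hsum]
    refine Finset.sum_le_sum fun x _ => ?_
    refine sq_sqrt_sub_sqrt_le (d := f ε x + f (-ε) x) (hf0 _ (by linarith) hε1.le x)
      (hf0 _ (by linarith) (by linarith) x) (by split_ifs <;> positivity) le_rfl ?_
    simp only [f]
    by_cases h1 : x = a
    · subst h1
      simp only [if_true, if_neg hab]
      nlinarith
    · by_cases h2 : x = b
      · subst h2
        simp only [if_true, if_neg h1]
        nlinarith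
      · simp [h1, h2]
  have hT : (T : ℝ) * ∑ x, (Real.sqrt (f ε x) - Real.sqrt (f (-ε) x)) ^ 2 ≤ T * (2 * ε ^ 2) := by
    gcongr
  linarith

/-- `P` mixes the uniform distribution, with weight `t`, with the uniform distribution on a set of
`m` atoms. The set must be small enough for the distance `t (1 - m / n)` to reach `ε`, but of
density at least `γ / 2` to keep the chi-square distance from uniform of order ε²/γ. -/
theorem Algorithm.Recovers.le_of_oneUniform {A : Algorithm n k} {T r : ℕ} {ε γ : ℝ}
    (hn : 2 ≤ n) (hk : 100 ≤ k) (hr : 1 ≤ r) (hrk : r < k) (hε : 0 < ε) (hγ : 0 < γ)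
    (hγ2 : γ ≤ 1 / 2) (hεγ : ε ≤ 1 - γ) (hεn : ε ≤ 1 - 1 / (n : ℝ))
    (hA : A.Recovers T r (oneUniform n ε)) : (k : ℝ) * γ ≤ 2560000 * (T * ε ^ 2) := by
  have hn0 : (0 : ℝ) < n := by exact_mod_cast (by omega : 0 < n)
  have hn2 : (2 : ℝ) ≤ n := by exact_mod_cast hn
  -- The floor of `γ n` works unless it vanishes; then a single atom is used, and this is where `ε ≤
  -- 1 - 1 / n` enters.
  obtain ⟨m, hm1, hmn, hmε, hmh, hmγ⟩ : ∃ m : ℕ, 1 ≤ m ∧ m ≤ n ∧ ε ≤ 1 - (m : ℝ) / n ∧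
      1 / 2 ≤ 1 - (m : ℝ) / n ∧ γ * n ≤ 2 * m := by
    by_cases h : γ * n < 1
    · refine ⟨1, le_rfl, by omega, by simpa using hεn, ?_, by push_cast; linarith⟩
      have : (1 : ℝ) / n ≤ 1 / 2 := one_div_le_one_div_of_le (by norm_num) hn2
      push_cast; linarith
    · rw [not_lt] at h
      have h1 : ((⌊γ * n⌋₊ : ℕ) : ℝ) ≤ γ * n := Nat.floor_le (by positivity)
      have h2 := Nat.lt_floor_add_one (γ * n)
      have h3 : 1 ≤ ⌊γ * n⌋₊ := Nat.le_floor (by simpa using h)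
      have h3' : (1 : ℝ) ≤ (⌊γ * n⌋₊ : ℕ) := by exact_mod_cast h3
      have h4 : ((⌊γ * n⌋₊ : ℕ) : ℝ) / n ≤ γ := by
        rw [div_le_iff₀ hn0]; exact h1
      refine ⟨⌊γ * n⌋₊, h3, ?_, by linarith, by linarith, by linarith⟩
      have : ((⌊γ * n⌋₊ : ℕ) : ℝ) ≤ n := by nlinarith
      exact_mod_cast this
  have hm0 : (0 : ℝ) < m := by exact_mod_cast hm1
  obtain ⟨S, -, hS⟩ := Finset.exists_subset_card_eq (s := (Finset.univ : Finset (Fin n)))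
    (n := m) (by simpa using hmn)
  set q := 1 - (m : ℝ) / n with hq
  set t := ε / q with ht
  have hq0 : 0 < q := by linarith
  have ht0 : 0 < t := by positivity
  have ht1 : t ≤ 1 := by rw [ht, div_le_one hq0]; exact hmε
  have htq : t * q = ε := by rw [ht]; field_simp
  let u : Fin n → ℝ := fun x => (1 - t) / n + (if x ∈ S then t / m else 0)
  let v : Fin n → ℝ := fun _ => 1 / n
  have hsum : ∀ c d : ℝ, ∑ x, (d + if x ∈ S then c else 0) = n * d + m * c := by
    intro c d
    rw [Finset.sum_add_distrib, Finset.sum_const, Finset.card_univ, Fintype.card_fin,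
      ← Finset.sum_filter, Finset.filter_mem_eq_inter, Finset.univ_inter, Finset.sum_const, hS]
    simp
  have hu0 : ∀ x, 0 ≤ u x := by
    intro x
    have : 0 ≤ (1 - t) / n := div_nonneg (by linarith) hn0.le
    simp only [u]
    split_ifs <;> positivity
  have hv0 : ∀ x, 0 ≤ v x := fun x => by simp only [v]; positivity
  have hu1 : ∑ x, u x = 1 := by
    simp only [u, hsum]
    field_simp
    ring
  have hv1 : ∑ x, v x = 1 := by
    simp only [v, Finset.sum_const, Finset.card_univ, Fintype.card_fin, nsmul_eq_mul]
    field_simp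
  have hP := isNormalized_massPMF u hu0 (by rw [hu1]; norm_num)
  have hQ := isNormalized_massPMF v hv0 (by rw [hv1]; norm_num)
  have hmn1 : (1 : ℝ) / n ≤ 1 / m :=
    one_div_le_one_div_of_le hm0 (by exact_mod_cast hmn)
  have hmem : (massPMF u hu0 (by rw [hu1]; norm_num), massPMF v hv0 (by rw [hv1]; norm_num)) ∈
      oneUniform n ε := by
    constructor
    · rw [hP.tvDist_eq hQ, hu1, hv1]
      have : ∀ x, |u x / 1 - v x / 1| = t / n + if x ∈ S then t * (1 / m - 2 / n) else 0 := by
        intro x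
        simp only [u, v]
        split_ifs
        · rw [abs_of_nonneg]
          · field_simp; ring
          · have : 0 ≤ t * (1 / m - 1 / n) := mul_nonneg ht0.le (by linarith)
            calc 0 ≤ t * (1 / m - 1 / n) := this
              _ = _ := by field_simp; ring
        · rw [abs_of_nonpos]
          · field_simp; ring
          · have : 0 ≤ t / n := by positivity
            calc _ = -(t / n) := by field_simp; ring
              _ ≤ 0 := by linarith
      simp only [this, hsum]
      rw [← htq, hq]
      refine le_of_eq ?_
      field_simp
      ring
    · intro x
      rw [← ofReal_one_div_natCast (by omega)]
      exact hQ.eq_ofReal hv1 x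
  have h := hA.le_of_pair hk hr hrk hmem hu0 hv0 hu1 hv1 (hP.eq_ofReal hu1) (hQ.eq_ofReal hv1)
  have hH : ∑ x, (Real.sqrt (u x) - Real.sqrt (v x)) ^ 2 ≤ t ^ 2 * (n / m) := by
    calc _ ≤ ∑ x, (t ^ 2 / n + if x ∈ S then t ^ 2 * (n / m ^ 2 - 2 / m) else 0) := by
          refine Finset.sum_le_sum fun x _ => ?_
          have he : t ^ 2 / n + (if x ∈ S then t ^ 2 * (n / m ^ 2 - 2 / m) else 0) =
              n * (u x - v x) ^ 2 := by
            simp only [u, v]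
            split_ifs
            · field_simp; ring
            · field_simp; ring
          rw [he]
          refine sq_sqrt_sub_sqrt_le (d := v x) (hu0 x) (hv0 x) (by positivity)
            (by have := hu0 x; linarith) (le_of_eq ?_)
          simp only [v]
          field_simp
      _ = t ^ 2 * (n / m - 1) := by
          rw [hsum]
          field_simp
          ring
      _ ≤ _ := by gcongr; linarith
  have ht2 : t ≤ 2 * ε := by
    rw [ht, div_le_iff₀ hq0]
    nlinarith
  have hnm : (n : ℝ) / m * γ ≤ 2 := by
    rw [div_mul_eq_mul_div, div_le_iff₀ hm0]; linarith
  have h2 : (∑ x, (Real.sqrt (u x) - Real.sqrt (v x)) ^ 2) * γ ≤ 8 * ε ^ 2 := by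
    calc _ ≤ t ^ 2 * (n / m) * γ := by gcongr
      _ = t ^ 2 * (n / m * γ) := by ring
      _ ≤ (2 * ε) ^ 2 * 2 := by gcongr
      _ = _ := by ring
  calc (k : ℝ) * γ ≤ 320000 * (T * ∑ x, (Real.sqrt (u x) - Real.sqrt (v x)) ^ 2) * γ := by gcongr
    _ = 320000 * (T * ((∑ x, (Real.sqrt (u x) - Real.sqrt (v x)) ^ 2) * γ)) := by ring
    _ ≤ 320000 * (T * (8 * ε ^ 2)) := by gcongr
    _ = _ := by ring

/-! ### Chebyshev's inequality under a product prior. -/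

section Chebyshev

variable {Ω : Type*} [Fintype Ω]

theorem sum_prior_mul_sum_sq {ρ g : Ω → ℝ} (h1 : ∑ ω, ρ ω = 1) (hg : ∑ ω, ρ ω * g ω = 0) :
    ∑ θ : Fin n → Ω, (∏ x, ρ (θ x)) * (∑ x, g (θ x)) ^ 2 = n * ∑ ω, ρ ω * g ω ^ 2 := by
  classical
  have key : ∀ x y : Fin n, ∑ θ : Fin n → Ω, (∏ z, ρ (θ z)) * (g (θ x) * g (θ y)) =
      if x = y then ∑ ω, ρ ω * g ω ^ 2 else 0 := by
    intro x y
    have h2 : ∀ θ : Fin n → Ω, (∏ z, ρ (θ z)) * (g (θ x) * g (θ y)) =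
        ∏ z, (ρ (θ z) * ((if z = x then g (θ z) else 1) * (if z = y then g (θ z) else 1))) := by
      intro θ
      rw [Finset.prod_mul_distrib, Finset.prod_mul_distrib, Finset.prod_ite_eq',
        Finset.prod_ite_eq']
      simp
    simp only [h2]
    rw [← Fintype.prod_sum (fun z ω => ρ ω * ((if z = x then g ω else 1) *
      (if z = y then g ω else 1)))]
    by_cases hxy : x = y
    · subst hxy
      rw [if_pos rfl, Finset.prod_eq_single x]
      · simp [sq]
      · intro z _ hz
        simp [hz, h1]
      · simp
    · rw [if_neg hxy]
      refine Finset.prod_eq_zero (Finset.mem_univ x) ?_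
      simpa [hxy] using hg
  calc _ = ∑ θ : Fin n → Ω, ∑ x, ∑ y, (∏ z, ρ (θ z)) * (g (θ x) * g (θ y)) := by
        refine Finset.sum_congr rfl fun θ _ => ?_
        rw [sq, Finset.sum_mul_sum, Finset.mul_sum]
        simp only [Finset.mul_sum]
    _ = ∑ x, ∑ y, ∑ θ : Fin n → Ω, (∏ z, ρ (θ z)) * (g (θ x) * g (θ y)) := by
        rw [Finset.sum_comm]
        refine Finset.sum_congr rfl fun x _ => Finset.sum_comm
    _ = _ := by simp [key]

/-- Chebyshev's inequality for sums over bins. -/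
theorem priorSum_chebyshev {ρ g : Ω → ℝ} (h0 : ∀ ω, 0 ≤ ρ ω) (h1 : ∑ ω, ρ ω = 1)
    (hg : ∑ ω, ρ ω * g ω = 0) {a : ℝ} (ha : 0 < a) :
    priorSum ρ (fun θ : Fin n → Ω => if |∑ x, g (θ x)| ≤ a then 0 else 1) ≤
      ENNReal.ofReal (n * (∑ ω, ρ ω * g ω ^ 2) / a ^ 2) := by
  have hρ : ∀ θ : Fin n → Ω, 0 ≤ ∏ x, ρ (θ x) := fun θ => Finset.prod_nonneg fun x _ => h0 _
  calc _ ≤ ∑ θ : Fin n → Ω, ENNReal.ofReal ((∏ x, ρ (θ x)) * (∑ x, g (θ x)) ^ 2 / a ^ 2) := by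
        refine Finset.sum_le_sum fun θ _ => ?_
        beta_reduce
        split_ifs with h
        · simp
        · rw [mul_one]
          refine ENNReal.ofReal_le_ofReal ?_
          rw [not_le] at h
          rw [mul_div_assoc]
          refine le_mul_of_one_le_right (hρ θ) ?_
          rw [one_le_div (by positivity), ← sq_abs (∑ x, g (θ x))]
          gcongr
    _ = _ := by
        rw [← ENNReal.ofReal_sum_of_nonneg fun θ _ => by have := hρ θ; positivity,
          ← Finset.sum_div, sum_prior_mul_sum_sq h1 hg]

theorem priorSum_chebyshev_le {ρ g : Ω → ℝ} (h0 : ∀ ω, 0 ≤ ρ ω) (h1 : ∑ ω, ρ ω = 1)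
    (hg : ∑ ω, ρ ω * g ω = 0) {a b : ℝ} (ha : 0 < a)
    (hb : n * (∑ ω, ρ ω * g ω ^ 2) ≤ b * a ^ 2) :
    priorSum ρ (fun θ : Fin n → Ω => if |∑ x, g (θ x)| ≤ a then 0 else 1) ≤ ENNReal.ofReal b := by
  refine (priorSum_chebyshev h0 h1 hg ha).trans (ENNReal.ofReal_le_ofReal ?_)
  rwa [div_le_iff₀ (by positivity)]

end Chebyshev

/-! ### Second moments of Poisson likelihood ratios. -/

/-- Ratio of the Poisson probabilities with means `ν * r` and `ν`. -/
noncomputable def poisRatio (ν r : ℝ) (c : ℕ) : ℝ := Real.exp (ν - ν * r) * r ^ c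

theorem pois_mul_poisRatio (ν r : ℝ) (c : ℕ) : pois (ν * r) c = pois ν c * poisRatio ν r c := by
  have h : Real.exp (-(ν * r)) = Real.exp (-ν) * Real.exp (ν - ν * r) := by
    rw [← Real.exp_add]; ring_nf
  unfold pois poisRatio
  rw [h, mul_pow]
  ring

theorem poisRatio_one (ν : ℝ) (c : ℕ) : poisRatio ν 1 c = 1 := by
  simp [poisRatio]

/-- The product of two ratios is again a constant times a power in `c`, so its mean is an
exponential series. All chi-square quantities below are quadratic forms in these values. -/
theorem hasSum_pois_mul_poisRatio (ν r r' : ℝ) :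
    HasSum (fun c => pois ν c * (poisRatio ν r c * poisRatio ν r' c))
      (Real.exp (ν * ((1 - r) * (1 - r')))) := by
  have h := (hasSum_pow_div_factorial (ν * r * r')).mul_left (Real.exp (ν - ν * r - ν * r'))
  rw [← Real.exp_add] at h
  have h2 : ν - ν * r - ν * r' + ν * r * r' = ν * ((1 - r) * (1 - r')) := by ring
  rw [h2] at h
  refine (funext fun c => ?_ :
    (fun c => pois ν c * (poisRatio ν r c * poisRatio ν r' c)) = _) ▸ h
  have h3 : Real.exp (ν - ν * r - ν * r') =
      Real.exp (-ν) * (Real.exp (ν - ν * r) * Real.exp (ν - ν * r')) := by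
    rw [← Real.exp_add, ← Real.exp_add]; ring_nf
  unfold pois poisRatio
  rw [h3, mul_pow, mul_pow]
  ring

theorem hasSum_pois_mul_sq {ι : Type*} [Fintype ι] (ν : ℝ) (α r : ι → ℝ) :
    HasSum (fun c => pois ν c * (∑ i, α i * poisRatio ν (r i) c) ^ 2)
      (∑ i, ∑ j, α i * α j * Real.exp (ν * ((1 - r i) * (1 - r j)))) := by
  have h : ∀ i ∈ (Finset.univ : Finset ι), HasSum (fun c => ∑ j, α i * α j *
      (pois ν c * (poisRatio ν (r i) c * poisRatio ν (r j) c)))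
      (∑ j, α i * α j * Real.exp (ν * ((1 - r i) * (1 - r j)))) := fun i _ =>
    hasSum_sum fun j _ => (hasSum_pois_mul_poisRatio ν (r i) (r j)).mul_left _
  refine (funext fun c => ?_ :
    (fun c => pois ν c * (∑ i, α i * poisRatio ν (r i) c) ^ 2) = _) ▸ hasSum_sum h
  rw [sq, Finset.sum_mul_sum, Finset.mul_sum]
  refine Finset.sum_congr rfl fun i _ => ?_
  rw [Finset.mul_sum]
  refine Finset.sum_congr rfl fun j _ => ?_
  ring

theorem hasSum_pois_mul_sq_sub (ν r r' : ℝ) :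
    HasSum (fun c => pois ν c * (poisRatio ν r c - poisRatio ν r' c) ^ 2)
      (Real.exp (ν * (1 - r) ^ 2) + Real.exp (ν * (1 - r') ^ 2) -
        2 * Real.exp (ν * ((1 - r) * (1 - r')))) := by
  have h := hasSum_pois_mul_sq ν ![1, -1] ![r, r']
  simp only [Fin.sum_univ_two, Matrix.cons_val_zero, Matrix.cons_val_one] at h
  have h2 : Real.exp (ν * (1 - r) ^ 2) + Real.exp (ν * (1 - r') ^ 2) -
        2 * Real.exp (ν * ((1 - r) * (1 - r'))) =
      1 * 1 * Real.exp (ν * ((1 - r) * (1 - r))) + 1 * -1 * Real.exp (ν * ((1 - r) * (1 - r'))) +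
      (-1 * 1 * Real.exp (ν * ((1 - r') * (1 - r))) +
        -1 * -1 * Real.exp (ν * ((1 - r') * (1 - r')))) := by
    rw [mul_comm (1 - r') (1 - r), sq, sq]; ring
  rw [h2]
  refine (funext fun c => ?_ :
    (fun c => pois ν c * (poisRatio ν r c - poisRatio ν r' c) ^ 2) = _) ▸ h
  ring

theorem exp_le_one_add_add_sq {x : ℝ} (h : |x| ≤ 1) : Real.exp x ≤ 1 + x + x ^ 2 := by
  have := Real.abs_exp_sub_one_sub_id_le h
  have := (abs_le.1 this).2
  linarith

/-! ### One uniform distribution: the term √(nk)/ε². -/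

section OneUniform

variable {p δ : ℝ}

/-- Centered indicator of a heavy bin. -/
def centered (p : ℝ) (ω : Bool) : ℝ := if ω then 1 - p else -p

/-- The prior of a Bernoulli variable. -/
def bernoulli (p : ℝ) (ω : Bool) : ℝ := if ω then p else 1 - p

/-- The difference of the two laws is split into `p (A - B) (ka - 1)`, the correlation between the
first and third tapes, and `B K`, the deviation of the averaged third tape from the uniform one. The
two parts are estimated separately because each is small for its own reason. -/
theorem perturbed_bin_bound {M π A B ka kb : ℝ} (hp : 0 < p) (hA : 0 ≤ A) (hB : 0 ≤ B) :
    (M * π * (p * (A * ka) + (1 - p) * (B * kb)) - M * π * (p * A + (1 - p) * B)) ^ 2 ≤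
      (4 * p * ((Real.sqrt A - Real.sqrt B) ^ 2 * M * (π * (ka - 1) ^ 2)) + 2 / p *
        (B * M * (π * (p * ka + (1 - p) * kb + -1 * 1) ^ 2))) * (M * π * (p * (A + B))) := by
  have hsq : (A - B) ^ 2 ≤ 2 * (Real.sqrt A - Real.sqrt B) ^ 2 * (A + B) := by
    have e1 := Real.sq_sqrt hA
    have e2 := Real.sq_sqrt hB
    set x := Real.sqrt A
    set y := Real.sqrt B
    rw [← e1, ← e2]
    nlinarith [mul_nonneg (sq_nonneg (x - y)) (sq_nonneg (x - y))]
  set D := (Real.sqrt A - Real.sqrt B) ^ 2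
  set K := p * ka + (1 - p) * kb + -1 * 1 with hK
  have hL : (M * π * (p * (A * ka) + (1 - p) * (B * kb)) - M * π * (p * A + (1 - p) * B)) ^ 2 =
      (M * π) ^ 2 * (p * (A - B) * (ka - 1) + B * K) ^ 2 := by
    rw [hK]; ring
  have hRHS : (4 * p * (D * M * (π * (ka - 1) ^ 2)) + 2 / p * (B * M * (π * K ^ 2))) *
      (M * π * (p * (A + B))) = (M * π) ^ 2 * (2 * (p ^ 2 * (ka - 1) ^ 2 * (2 * D * (A + B))) +
        2 * (K ^ 2 * (B * (A + B)))) := by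
    field_simp
    ring
  rw [hL, hRHS]
  refine mul_le_mul_of_nonneg_left ?_ (sq_nonneg _)
  calc (p * (A - B) * (ka - 1) + B * K) ^ 2
      ≤ 2 * (p * (A - B) * (ka - 1)) ^ 2 + 2 * (B * K) ^ 2 := by
        nlinarith [sq_nonneg (p * (A - B) * (ka - 1) - B * K)]
    _ = 2 * (p ^ 2 * (ka - 1) ^ 2 * (A - B) ^ 2) + 2 * (K ^ 2 * (B * B)) := by ring
    _ ≤ _ := by
        gcongr
        linarith

/-- The correlation part is a Hellinger distance on the first tape times a chi-square distance on
the third. The averaged part is only of second order in `X`. -/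
theorem perturbed_total {τ μ X a b : ℝ} (hτ0 : 0 ≤ τ) (hμ0 : 0 ≤ μ) (hp : 0 < p)
    (hp2 : p ≤ 1 / 2) (hδ : 0 ≤ δ) (hδ1 : δ ≤ 1) (ha : a = 1 + δ / p * (1 - p))
    (hb : b = 1 + δ / p * (-p)) (hX : X = μ * δ ^ 2 / p ^ 2) (hX1 : X ≤ 1) :
    4 * p * ((2 - 2 * Real.exp (-((Real.sqrt (τ * a) - Real.sqrt (τ * b)) ^ 2 / 2))) * 1 *
        (Real.exp (μ * (1 - a) ^ 2) + Real.exp (μ * (1 - 1) ^ 2) -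
          2 * Real.exp (μ * ((1 - a) * (1 - 1))))) +
      2 / p * (1 * 1 *
        (p * p * Real.exp (μ * ((1 - a) * (1 - a))) +
            p * (1 - p) * Real.exp (μ * ((1 - a) * (1 - b))) + p * -1 * 1 +
          ((1 - p) * p * Real.exp (μ * ((1 - b) * (1 - a))) +
            (1 - p) * (1 - p) * Real.exp (μ * ((1 - b) * (1 - b))) + (1 - p) * -1 * 1) +
          (-1 * p * 1 + -1 * (1 - p) * 1 + -1 * -1 * 1))) ≤
      2 * (4 * τ * δ ^ 2 * X / p + X ^ 2 / p) := by
  have hb' : b = 1 - δ := by rw [hb]; field_simp; ring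
  have hb0 : 0 ≤ b := by rw [hb']; linarith
  have hdp : 0 ≤ δ / p := by positivity
  have ha1 : 1 ≤ a := by rw [ha]; nlinarith
  have hXn : 0 ≤ X := by rw [hX]; positivity
  have hp1 : p ≤ 1 := by linarith
  have hμX : μ * δ ^ 2 = X * p ^ 2 := by rw [hX]; field_simp
  have hab : a - b = δ / p := by rw [ha, hb]; ring
  have hfirst : 2 - 2 * Real.exp (-((Real.sqrt (τ * a) - Real.sqrt (τ * b)) ^ 2 / 2)) ≤
      τ * (δ / p) ^ 2 := by
    refine (two_sub_two_mul_exp_le _).trans ?_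
    rw [Real.sqrt_mul hτ0, Real.sqrt_mul hτ0, ← mul_sub, mul_pow, Real.sq_sqrt hτ0]
    refine mul_le_mul_of_nonneg_left ?_ hτ0
    exact sq_sqrt_sub_sqrt_le (d := 1) (by linarith) hb0 (by positivity) (by linarith)
      (by rw [hab, mul_one])
  have e1 : μ * (1 - a) ^ 2 = X * (1 - p) ^ 2 := by
    rw [ha]
    calc _ = μ * δ ^ 2 * ((1 - p) ^ 2 / p ^ 2) := by field_simp; ring
      _ = _ := by rw [hμX]; field_simp
  have e2 : μ * ((1 - a) * (1 - a)) = X * (1 - p) ^ 2 := by rw [← e1]; ring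
  have e3 : μ * ((1 - a) * (1 - b)) = -(X * (p * (1 - p))) := by
    rw [ha, hb']
    calc _ = -(μ * δ ^ 2 * ((1 - p) / p)) := by field_simp; ring
      _ = _ := by rw [hμX]; field_simp
  have e4 : μ * ((1 - b) * (1 - a)) = -(X * (p * (1 - p))) := by rw [← e3]; ring
  have e5 : μ * ((1 - b) * (1 - b)) = X * p ^ 2 := by
    rw [hb', ← hμX]; ring
  have q1 : (1 - p) ^ 2 ≤ 1 := by nlinarith
  have q2 : p * (1 - p) ≤ 1 := by nlinarith
  have q3 : p ^ 2 ≤ 1 := by nlinarith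
  have b1 : X * (1 - p) ^ 2 ≤ X := mul_le_of_le_one_right hXn q1
  have b2 : X * (p * (1 - p)) ≤ X := mul_le_of_le_one_right hXn q2
  have b3 : X * p ^ 2 ≤ X := mul_le_of_le_one_right hXn q3
  have n1 : 0 ≤ X * (1 - p) ^ 2 := by positivity
  have n2 : 0 ≤ X * (p * (1 - p)) := mul_nonneg hXn (mul_nonneg hp.le (by linarith))
  have n3 : 0 ≤ X * p ^ 2 := by positivity
  have x1 := exp_le_one_add_add_sq (x := X * (1 - p) ^ 2) (by rw [abs_of_nonneg n1]; linarith)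
  have x2 := exp_le_one_add_add_sq (x := -(X * (p * (1 - p))))
    (by rw [abs_neg, abs_of_nonneg n2]; linarith)
  have x3 := exp_le_one_add_add_sq (x := X * p ^ 2) (by rw [abs_of_nonneg n3]; linarith)
  have s1 : (X * (1 - p) ^ 2) ^ 2 ≤ X ^ 2 := by gcongr
  have s2 : (-(X * (p * (1 - p)))) ^ 2 ≤ X ^ 2 := by rw [neg_sq]; gcongr
  have s3 : (X * p ^ 2) ^ 2 ≤ X ^ 2 := by gcongr
  have hsecond : Real.exp (μ * (1 - a) ^ 2) + Real.exp (μ * (1 - 1) ^ 2) -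
      2 * Real.exp (μ * ((1 - a) * (1 - 1))) ≤ 2 * X := by
    simp only [sub_self, ne_eq, OfNat.ofNat_ne_zero, not_false_eq_true, zero_pow, mul_zero,
      Real.exp_zero]
    rw [e1]
    have s0 : X ^ 2 ≤ X := by nlinarith
    linarith
  rw [e2, e3, e4, e5]
  set Ea := Real.exp (X * (1 - p) ^ 2)
  set Eb := Real.exp (-(X * (p * (1 - p))))
  set Ec := Real.exp (X * p ^ 2)
  -- The terms linear in `X` cancel because the relative masses `a` and `b` average to 1 under the
  -- prior.
  have hthird : p * p * Ea + p * (1 - p) * Eb + p * -1 * 1 +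
      ((1 - p) * p * Eb + (1 - p) * (1 - p) * Ec + (1 - p) * -1 * 1) +
      (-1 * p * 1 + -1 * (1 - p) * 1 + -1 * -1 * 1) ≤ X ^ 2 := by
    have m1 := mul_le_mul_of_nonneg_left (x1.trans (add_le_add_right s1 _)) (mul_self_nonneg p)
    have m2 := mul_le_mul_of_nonneg_left (x2.trans (add_le_add_right s2 _))
      (mul_nonneg hp.le (by linarith : 0 ≤ 1 - p))
    have m3 := mul_le_mul_of_nonneg_left (x3.trans (add_le_add_right s3 _))
      (mul_self_nonneg (1 - p))
    linarith
  have hI : 4 * p * ((2 - 2 * Real.exp (-((Real.sqrt (τ * a) - Real.sqrt (τ * b)) ^ 2 / 2))) * 1 *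
      (Real.exp (μ * (1 - a) ^ 2) + Real.exp (μ * (1 - 1) ^ 2) -
      2 * Real.exp (μ * ((1 - a) * (1 - 1))))) ≤ 4 * p * (τ * (δ / p) ^ 2 * 1 * (2 * X)) := by
    refine mul_le_mul_of_nonneg_left ?_ (by positivity)
    rw [mul_one, mul_one]
    refine mul_le_mul hfirst hsecond ?_ (by positivity)
    exact (hasSum_pois_mul_sq_sub μ a 1).nonneg fun c =>
      mul_nonneg (pois_nonneg hμ0 c) (sq_nonneg _)
  have hII := mul_le_mul_of_nonneg_left hthird (by positivity : 0 ≤ 2 / p)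
  have hIII : 4 * p * (τ * (δ / p) ^ 2 * 1 * (2 * X)) + 2 / p * X ^ 2 =
      2 * (4 * τ * δ ^ 2 * X / p + X ^ 2 / p) := by
    field_simp
  rw [← hIII]
  refine add_le_add hI ?_
  rw [mul_one, one_mul]
  exact hII

/-- Bins perturbed to `1 - δ`, up to a fraction `p` of bins which compensate. -/
theorem affinity_perturbed {t s : ℝ} (ht : 0 ≤ t) (hs : 0 ≤ s) {m : ℝ} (hm : 0 < m) (hp : 0 < p)
    (hp2 : p ≤ 1 / 2) (hδ : 0 ≤ δ) (hδ1 : δ ≤ 1) {X : ℝ} (hX : X = s / m * δ ^ 2 / p ^ 2)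
    (hX1 : X ≤ 1) :
    ENNReal.ofReal (1 - (4 * (t / m) * δ ^ 2 * X / p + X ^ 2 / p)) ≤
      affinity
        (binLaw (bernoulli p) t s (fun ω => (1 + δ / p * centered p ω) / m) (fun _ => 1 / m)
          (fun ω => (1 + δ / p * centered p ω) / m))
        (binLaw (bernoulli p) t s (fun ω => (1 + δ / p * centered p ω) / m) (fun _ => 1 / m)
          (fun _ => 1 / m)) := by
  set a := 1 + δ / p * (1 - p) with ha
  set b := 1 + δ / p * (-p) with hb
  have hb' : b = 1 - δ := by rw [hb]; field_simp; ring
  have hb0 : 0 ≤ b := by rw [hb']; linarith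
  have hdp : 0 ≤ δ / p := by positivity
  have ha1 : 1 ≤ a := by rw [ha]; nlinarith
  have hρ0 : ∀ ω, 0 ≤ bernoulli p ω := by
    intro ω; cases ω <;> simp [bernoulli] <;> linarith
  have hρ1 : ∑ ω, bernoulli p ω = 1 := by simp [bernoulli]
  have hw0 : ∀ ω, 0 ≤ (1 + δ / p * centered p ω) / m := by
    intro ω
    refine div_nonneg ?_ hm.le
    cases ω
    · simpa [centered, hb] using hb0
    · simp only [centered, if_true]; linarith
  have hv0 : ∀ ω : Bool, 0 ≤ 1 / m := fun _ => by positivity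
  set τ := t / m with hτ
  set μ := s / m with hμ
  have hτ0 : 0 ≤ τ := by positivity
  have hμ0 : 0 ≤ μ := by positivity
  set A := fun c => pois (τ * a) c
  set B := fun c => pois (τ * b) c
  have hA0 : ∀ c, 0 ≤ A c := fun c => pois_nonneg (by positivity) c
  have hB0 : ∀ c, 0 ≤ B c := fun c => pois_nonneg (by positivity) c
  have hπ0 : ∀ c, 0 ≤ pois μ c := pois_nonneg hμ0
  have hM0 : ∀ c, 0 ≤ pois τ c := pois_nonneg hτ0
  have hτm : ∀ r, t * (r / m) = τ * r := fun r => by rw [hτ]; ring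
  have hμm : ∀ r, s * (r / m) = μ * r := fun r => by rw [hμ]; ring
  have hF : ∀ i j c, binLaw (bernoulli p) t s (fun ω => (1 + δ / p * centered p ω) / m)
      (fun _ => 1 / m) (fun ω => (1 + δ / p * centered p ω) / m) i j c =
      pois τ j * pois μ c * (p * (A i * poisRatio μ a c) + (1 - p) * (B i * poisRatio μ b c)) := by
    intro i j c
    simp only [binLaw, Fintype.sum_bool, bernoulli, centered, if_true, Bool.false_eq_true, if_false]
    rw [← ha, ← hb, hτm, hτm, hτm, hμm, hμm, mul_one, pois_mul_poisRatio μ a,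
      pois_mul_poisRatio μ b]
    ring
  have hG : ∀ i j c, binLaw (bernoulli p) t s (fun ω => (1 + δ / p * centered p ω) / m)
      (fun _ => 1 / m) (fun _ => 1 / m) i j c =
      pois τ j * pois μ c * (p * A i + (1 - p) * B i) := by
    intro i j c
    simp only [binLaw, Fintype.sum_bool, bernoulli, centered, if_true, Bool.false_eq_true, if_false]
    rw [← ha, ← hb, hτm, hτm, hτm, hμm, mul_one, mul_one]
    ring
  have hS1 := hasSum_sq_sqrt_pois_sub (mul_nonneg hτ0 (by linarith : 0 ≤ a)) (mul_nonneg hτ0 hb0)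
  have hS2 := hasSum_pois_mul_sq_sub μ a 1
  simp only [poisRatio_one] at hS2
  have hS3 := hasSum_pois_mul_sq μ ![p, 1 - p, -1] ![a, b, 1]
  simp only [Fin.sum_univ_three, Matrix.cons_val_zero, Matrix.cons_val_one, Matrix.cons_val,
    poisRatio_one, sub_self, mul_zero, zero_mul, Real.exp_zero] at hS3
  have hsum := ((hasSum_mul_triple hS1 (hasSum_pois τ) hS2 (fun _ => sq_nonneg _) hM0
    (fun c => mul_nonneg (hπ0 c) (sq_nonneg _))).mul_left (4 * p)).add
    ((hasSum_mul_triple (hasSum_pois (τ * b)) (hasSum_pois τ) hS3 hB0 hM0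
    (fun c => mul_nonneg (hπ0 c) (sq_nonneg _))).mul_left (2 / p))
  refine ofReal_le_affinity (binLaw_nonneg hρ0 ht hs hw0 hv0 hw0)
    (binLaw_nonneg hρ0 ht hs hw0 hv0 hv0) (hasSum_binLaw hρ1 ht hs hw0 hv0 hw0)
    (hasSum_binLaw hρ1 ht hs hw0 hv0 hv0) hsum ?_ ?_
  · intro i j c
    have hπ := hπ0 c
    have hM := hM0 j
    have hAi := hA0 i
    have hBi := hB0 i
    refine sq_sqrt_sub_sqrt_le (d := pois τ j * pois μ c * (p * (A i + B i)))
      (binLaw_nonneg hρ0 ht hs hw0 hv0 hw0 i j c) (binLaw_nonneg hρ0 ht hs hw0 hv0 hv0 i j c)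
      ?_ ?_ ?_
    · positivity
    · have h1 := binLaw_nonneg hρ0 ht hs hw0 hv0 hw0 i j c
      rw [hG]
      -- `p ≤ 1 / 2` is used here, to compare with a denominator symmetric in `A` and `B`.
      have h2 : p * (A i + B i) ≤ p * A i + (1 - p) * B i := by nlinarith
      have h3 := mul_le_mul_of_nonneg_left h2 (mul_nonneg hM hπ)
      linarith
    · rw [hF, hG]
      exact perturbed_bin_bound hp hAi hBi
  · exact perturbed_total hτ0 hμ0 hp hp2 hδ hδ1 ha hb hX hX1

end OneUniform

theorem bernoulli_nonneg {p : ℝ} (hp : 0 ≤ p) (hp1 : p ≤ 1) (ω : Bool) : 0 ≤ bernoulli p ω := by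
  cases ω <;> simp [bernoulli] <;> linarith

theorem sum_bernoulli (p : ℝ) : ∑ ω, bernoulli p ω = 1 := by simp [bernoulli]

theorem sum_bernoulli_mul_centered (p : ℝ) : ∑ ω, bernoulli p ω * centered p ω = 0 := by
  simp [bernoulli, centered]; ring

theorem sum_bernoulli_mul_centered_sq (p : ℝ) :
    ∑ ω, bernoulli p ω * centered p ω ^ 2 = p * (1 - p) := by
  simp [bernoulli, centered]; ring

theorem perturbed_nonneg {p δ : ℝ} (hp : 0 < p) (hδ : 0 ≤ δ) (ω : Bool) :
    1 - δ ≤ 1 + δ / p * centered p ω := by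
  have hdp : 0 ≤ δ / p := by positivity
  have : δ / p * p = δ := by field_simp
  cases ω
  · simp only [centered, Bool.false_eq_true, if_false]; linarith
  · simp only [centered, if_true]; nlinarith

/-- The total variation distance from uniform when the fraction of heavy bins is typical. -/
theorem le_tvDist_perturbed (hn : 0 < n) {p δ ε : ℝ} (hp : 0 < p) (hp2 : p ≤ 1 / 8)
    (hδ : 0 < δ) (hδ1 : δ < 1) (hε : ε = δ * (1 - 4 * p)) {θ : Fin n → Bool}
    (hθ : |∑ x, centered p (θ x)| ≤ n * p ^ 2) {P Q : PMF (Fin n)}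
    (hP : IsNormalized (fun x => (1 + δ / p * centered p (θ x)) / n) P)
    (hQ : IsNormalized (fun _ => 1 / n) Q) :
    ε ≤ tvDist P Q ∧ 1 / 2 ≤ ∑ x, (1 + δ / p * centered p (θ x)) / (n : ℝ) := by
  have hn0 : (0 : ℝ) < n := by exact_mod_cast hn
  obtain ⟨Z, hZ⟩ : ∃ Z : ℝ, ∑ x, centered p (θ x) = n * Z :=
    ⟨(∑ x, centered p (θ x)) / n, by field_simp⟩
  rw [hZ, abs_mul, abs_of_pos hn0, mul_le_mul_iff_right₀ hn0, abs_le] at hθ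
  have hdp : 0 < δ / p := by positivity
  have hdpp : δ / p * p = δ := by field_simp
  have hW : ∑ x, (1 + δ / p * centered p (θ x)) / (n : ℝ) = 1 + δ / p * Z := by
    rw [← Finset.sum_div, Finset.sum_add_distrib, ← Finset.mul_sum, hZ]
    simp only [Finset.sum_const, Finset.card_univ, Fintype.card_fin, nsmul_eq_mul]
    field_simp
  have hV : ∑ _x : Fin n, 1 / (n : ℝ) = 1 := by
    simp only [Finset.sum_const, Finset.card_univ, Fintype.card_fin, nsmul_eq_mul]
    field_simp
  set W := 1 + δ / p * Z with hWdef
  have hW1 : 1 - δ * p ≤ W := by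
    rw [hWdef]
    nlinarith [mul_le_mul_of_nonneg_left hθ.1 hdp.le]
  have hW2 : W ≤ 1 + p := by
    rw [hWdef]
    nlinarith [mul_le_mul_of_nonneg_left hθ.2 hdp.le]
  have hWh : 1 / 2 ≤ W := by nlinarith
  refine ⟨?_, by rw [hW]; exact hWh⟩
  rw [hP.tvDist_eq hQ, hW, hV]
  have hW0 : 0 < W := by linarith
  -- `centered p + p` is the indicator of a heavy bin. The signed differences sum to 0, so the total
  -- variation distance is at least the excess of `P` on the heavy bins.
  have hpt : ∀ x, 2 * ((centered p (θ x) + p) * ((1 + δ / p * (1 - p)) / n / W - 1 / n)) -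
      ((1 + δ / p * centered p (θ x)) / n / W - 1 / n) ≤
      |(1 + δ / p * centered p (θ x)) / n / W - 1 / n / 1| := by
    intro x
    rw [div_one]
    cases θ x
    · simp only [centered, Bool.false_eq_true, if_false]
      rw [neg_add_cancel, zero_mul, mul_zero, zero_sub]
      exact neg_le_abs _
    · simp only [centered, if_true]
      rw [sub_add_cancel, one_mul]
      refine le_trans (le_of_eq ?_) (le_abs_self _)
      ring
  have hsum := Finset.sum_le_sum fun x (_ : x ∈ (Finset.univ : Finset (Fin n))) => hpt x
  rw [Finset.sum_sub_distrib, ← Finset.mul_sum, ← Finset.sum_mul, Finset.sum_add_distrib, hZ,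
    Finset.sum_sub_distrib, ← Finset.sum_div, hW, hV, div_self hW0.ne', sub_self, sub_zero] at hsum
  simp only [Finset.sum_const, Finset.card_univ, Fintype.card_fin, nsmul_eq_mul] at hsum
  have hmain : ε ≤ (n * Z + n * p) * ((1 + δ / p * (1 - p)) / n / W - 1 / n) := by
    have h1 : (n * Z + n * p) * ((1 + δ / p * (1 - p)) / n / W - 1 / n) =
        δ / p * ((p + Z) * (1 - p - Z)) / W := by
      have h2 : 1 + δ / p * (1 - p) = W + δ / p * (1 - p - Z) := by rw [hWdef]; ring
      rw [h2]
      clear_value W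
      field_simp
      ring
    rw [h1, le_div_iff₀ hW0, hε]
    have h2 : (p - p ^ 2) * (1 - 2 * p) ≤ (p + Z) * (1 - p - Z) := by
      refine mul_le_mul (by linarith) (by nlinarith) (by linarith) (by nlinarith)
    calc δ * (1 - 4 * p) * W ≤ δ * (1 - 4 * p) * (1 + p) :=
          mul_le_mul_of_nonneg_left hW2 (mul_nonneg hδ.le (by linarith))
      _ ≤ δ * ((1 - p) * (1 - 2 * p)) := by
          rw [mul_assoc]
          refine mul_le_mul_of_nonneg_left (by nlinarith) hδ.le
      _ = δ / p * ((p - p ^ 2) * (1 - 2 * p)) := by field_simp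
      _ ≤ _ := mul_le_mul_of_nonneg_left h2 hdp.le
  linarith

/-- Lower bound from testing uniformity against randomly perturbed distributions. -/
theorem Algorithm.Recovers.le_of_oneUniform_perturbed {A : Algorithm n k} {T r : ℕ} {ε p : ℝ}
    (hk : 100 ≤ k) (hr : 1 ≤ r) (hrk : r < k) (hε : 0 < ε) (hp : 0 < p)
    (hp2 : p ≤ 1 / 16) (hεp : ε < 1 - 4 * p) (hn : 20 ≤ n * p ^ 3)
    (hA : A.Recovers T r (oneUniform n ε)) :
    (n : ℝ) * k * p ^ 5 ≤ 10 ^ 9 * (T * ε ^ 2) ^ 2 := by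
  classical
  have hn0' : 0 < n := by
    rcases Nat.eq_zero_or_pos n with rfl | h
    · norm_num at hn
    · exact h
  have hn0 : (0 : ℝ) < n := by exact_mod_cast hn0'
  have hk0 : (0 : ℝ) < k := by exact_mod_cast (by omega : 0 < k)
  have hk100 : (100 : ℝ) ≤ k := by exact_mod_cast hk
  have h4p : 0 < 1 - 4 * p := by linarith
  set δ := ε / (1 - 4 * p) with hδdef
  have hδ : 0 < δ := by positivity
  have hδ1 : δ < 1 := by rw [hδdef, div_lt_one h4p]; exact hεp
  have hεδ : ε = δ * (1 - 4 * p) := by rw [hδdef]; field_simp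
  have hδ2 : δ ≤ 4 / 3 * ε := by rw [hδdef, div_le_iff₀ h4p]; nlinarith
  have hu0 : ∀ ω, 0 ≤ (1 + δ / p * centered p ω) / (n : ℝ) := fun ω =>
    div_nonneg (by have := perturbed_nonneg hp hδ.le ω; linarith) hn0.le
  have hupos : ∀ θ : Fin n → Bool, 0 < ∑ x, (1 + δ / p * centered p (θ x)) / (n : ℝ) := by
    intro θ
    have : Nonempty (Fin n) := ⟨⟨0, hn0'⟩⟩
    refine Finset.sum_pos (fun x _ => div_pos ?_ hn0) Finset.univ_nonempty
    have := perturbed_nonneg hp hδ.le (θ x)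
    linarith
  have hv1 : ∑ _x : Fin n, 1 / (n : ℝ) = 1 := by
    simp only [Finset.sum_const, Finset.card_univ, Fintype.card_fin, nsmul_eq_mul]
    field_simp
  have hP := fun θ : Fin n → Bool => isNormalized_massPMF
    (fun x => (1 + δ / p * centered p (θ x)) / (n : ℝ)) (fun x => hu0 (θ x)) (hupos θ)
  have hQ := isNormalized_massPMF (fun _ : Fin n => 1 / (n : ℝ)) (fun _ => by positivity)
    (by rw [hv1]; norm_num)
  let H : HardFamily n Bool (oneUniform n ε) :=
    { ρ := bernoulli p
      ρ_nonneg := bernoulli_nonneg hp.le (by linarith)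
      ρ_sum := sum_bernoulli p
      u := fun _ ω => (1 + δ / p * centered p ω) / n
      v := fun _ _ => 1 / n
      u_nonneg := fun _ => hu0
      v_nonneg := fun _ _ => by positivity
      P := _
      Q := fun _ => _
      P_norm := hP
      Q_norm := fun _ => hQ
      G := fun θ => |∑ x, centered p (θ x)| ≤ n * p ^ 2
      G_mem := fun θ hθ => ⟨(le_tvDist_perturbed hn0' hp (by linarith) hδ hδ1 hεδ hθ (hP θ) hQ).1,
        fun x => by rw [← ofReal_one_div_natCast hn0']; exact hQ.eq_ofReal hv1 x⟩
      G_u := fun θ hθ => (le_tvDist_perturbed hn0' hp (by linarith) hδ hδ1 hεδ hθ (hP θ) hQ).2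
      G_v := fun θ _ => by rw [hv1]; norm_num
      G_prob := by
        intro _
        -- The variance `n p (1 - p)` against the squared tolerance `n² p⁴ / 20`; this requires `n
        -- p³ ≥ 20`.
        have hvar : n * ∑ ω, bernoulli p ω * centered p ω ^ 2 ≤ 1 / 20 * (n * p ^ 2) ^ 2 := by
          rw [sum_bernoulli_mul_centered_sq]
          have h1 : (n : ℝ) * p * 20 ≤ n * p * (n * p ^ 3) :=
            mul_le_mul_of_nonneg_left hn (by positivity)
          have h2 : 0 ≤ (n : ℝ) * p ^ 2 := by positivity
          nlinarith
        convert priorSum_chebyshev_le (n := n) (bernoulli_nonneg hp.le (by linarith))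
          (sum_bernoulli p) (sum_bernoulli_mul_centered p) (by positivity) hvar }
  obtain ⟨N, hN, hnot⟩ := H.exists_not_close hk hr hrk hA
  have ht : (0 : ℝ) ≤ 40 * T := by positivity
  have hs : (0 : ℝ) ≤ 40 * N := by positivity
  by_contra hcon
  rw [not_le] at hcon
  set X := 40 * N / n * δ ^ 2 / p ^ 2 with hX
  -- Summed over the bins, both parts of the loss are multiples of `Y`: the correlation part since T
  -- · N is at most 80 T²/k, the averaged part since N² is even smaller.
  set Y := (T * δ ^ 2) ^ 2 / (n * k) with hY
  have hY0 : 0 ≤ Y := by positivity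
  have hYp : 2 * 10 ^ 8 * Y ≤ p ^ 5 := by
    rw [hY, mul_div_assoc', div_le_iff₀ (by positivity)]
    have h1 : (T * δ ^ 2) ^ 2 ≤ 4 * (T * ε ^ 2) ^ 2 := by
      have h2 : (T : ℝ) * δ ^ 2 ≤ 2 * (T * ε ^ 2) := by
        have : δ ^ 2 ≤ (4 / 3 * ε) ^ 2 := by gcongr
        calc (T : ℝ) * δ ^ 2 ≤ T * (2 * ε ^ 2) := by gcongr; nlinarith [sq_nonneg ε]
          _ = _ := by ring
      calc (T * δ ^ 2) ^ 2 ≤ (2 * (T * ε ^ 2)) ^ 2 := by gcongr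
        _ = _ := by ring
    have h3 := sq_nonneg (T * ε ^ 2)
    linarith
  have hNk : (N : ℝ) ≤ 80 * T / k := by rw [le_div_iff₀ hk0]; exact hN
  have hX0 : 0 ≤ X := by positivity
  have hXle : X ≤ 3200 * (T * δ ^ 2) / (n * k) / p ^ 2 := by
    calc X ≤ 40 * (80 * T / k) / n * δ ^ 2 / p ^ 2 := by rw [hX]; gcongr
      _ = _ := by field_simp; ring
  have hp1 : p ≤ 1 := by linarith
  have hX2 : n * X ^ 2 / p ≤ 102400 * Y / p ^ 5 := by
    calc n * X ^ 2 / p ≤ n * (3200 * (T * δ ^ 2) / (n * k) / p ^ 2) ^ 2 / p := by gcongr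
      _ = 10240000 / k * Y / p ^ 5 := by rw [hY]; field_simp; ring
      _ ≤ 10240000 / 100 * Y / p ^ 5 := by gcongr
      _ = _ := by norm_num
  have hX1 : n * (4 * (40 * T / n) * δ ^ 2 * X / p) ≤ 512000 * Y / p ^ 3 := by
    calc n * (4 * (40 * T / n) * δ ^ 2 * X / p) ≤ n * (4 * (40 * T / n) * δ ^ 2 *
          (3200 * (T * δ ^ 2) / (n * k) / p ^ 2) / p) := by gcongr
      _ = _ := by rw [hY]; field_simp; ring
  have hYp5 : Y / p ^ 5 ≤ 1 / (2 * 10 ^ 8) := by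
    rw [div_le_div_iff₀ (by positivity) (by norm_num)]; linarith
  have hYp3 : Y / p ^ 3 ≤ Y / p ^ 5 :=
    div_le_div_of_nonneg_left hY0 (by positivity) (pow_le_pow_of_le_one hp.le hp1 (by norm_num))
  have hXone : X ≤ 1 := by
    have h1 : X ^ 2 ≤ 1 := by
      have h2 : X ^ 2 ≤ n * X ^ 2 / p := by
        rw [le_div_iff₀ hp]
        have h3 : (1 : ℝ) ≤ n := by exact_mod_cast hn0'
        have : p ≤ n := by linarith
        nlinarith [sq_nonneg X]
      have h4 : 102400 * Y / p ^ 5 = 102400 * (Y / p ^ 5) := by ring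
      rw [h4] at hX2
      norm_num at hYp5
      linarith
    nlinarith
  refine hnot ⟨fun _ => 4 * (40 * T / n) * δ ^ 2 * X / p + X ^ 2 / p, fun _ => by positivity, ?_,
    fun x => affinity_perturbed ht hs hn0 hp (by linarith) hδ.le hδ1.le hX hXone⟩
  simp only [Finset.sum_const, Finset.card_univ, Fintype.card_fin, nsmul_eq_mul]
  rw [mul_add]
  have h5 : n * (X ^ 2 / p) = n * X ^ 2 / p := by ring
  have h6 : 102400 * Y / p ^ 5 = 102400 * (Y / p ^ 5) := by ring
  have h7 : 512000 * Y / p ^ 3 = 512000 * (Y / p ^ 3) := by ring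
  rw [h5]
  rw [h6] at hX2
  rw [h7] at hX1
  norm_num at hYp5
  linarith

/-! ### Both distributions unknown: the cube-root term. -/

/-- The sign of a light bin; `none` is a heavy bin. -/
def lightSign : Option Bool → ℝ
  | none => 0
  | some true => 1
  | some false => -1

/-- Centered indicator of a heavy bin. -/
def heavyCentered (p : ℝ) : Option Bool → ℝ
  | none => 1 - p
  | some _ => -p

/-- A bin is heavy with probability `p`, and light with a random sign otherwise. -/
noncomputable def heavyPrior (p : ℝ) : Option Bool → ℝ
  | none => p
  | some _ => (1 - p) / 2

/-- The mass of a bin: `h` if it is heavy and `l * (1 + δ * sign)` if it is light. -/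
def heavyMass (h l δ : ℝ) : Option Bool → ℝ
  | none => h
  | some z => l * (1 + δ * lightSign (some z))

theorem heavyMass_eq (p h l δ : ℝ) (ω : Option Bool) :
    heavyMass h l δ ω = h * p + l * (1 - p) + (h - l) * heavyCentered p ω +
      l * δ * lightSign ω := by
  cases ω <;> simp only [heavyMass, heavyCentered, lightSign] <;> ring

theorem heavyMass_nonneg {h l δ : ℝ} (hh : 0 ≤ h) (hl : 0 ≤ l) (hδ : |δ| ≤ 1) (ω : Option Bool) :
    0 ≤ heavyMass h l δ ω := by
  rw [abs_le] at hδ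
  rcases ω with _ | _ | _
  · exact hh
  · simp only [heavyMass, lightSign]
    exact mul_nonneg hl (by linarith)
  · simp only [heavyMass, lightSign]
    exact mul_nonneg hl (by linarith)

theorem heavyPrior_nonneg {p : ℝ} (hp : 0 ≤ p) (hp1 : p ≤ 1) (ω : Option Bool) :
    0 ≤ heavyPrior p ω := by
  cases ω <;> simp only [heavyPrior] <;> linarith

theorem sum_heavyPrior (p : ℝ) : ∑ ω, heavyPrior p ω = 1 := by
  simp only [Fintype.sum_option, Fintype.sum_bool, heavyPrior]; ring

theorem sum_heavyPrior_mul_heavyCentered (p : ℝ) :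
    ∑ ω, heavyPrior p ω * heavyCentered p ω = 0 := by
  simp only [Fintype.sum_option, Fintype.sum_bool, heavyPrior, heavyCentered]; ring

theorem sum_heavyPrior_mul_heavyCentered_sq (p : ℝ) :
    ∑ ω, heavyPrior p ω * heavyCentered p ω ^ 2 = p * (1 - p) := by
  simp only [Fintype.sum_option, Fintype.sum_bool, heavyPrior, heavyCentered]; ring

theorem sum_heavyPrior_mul_lightSign (p : ℝ) : ∑ ω, heavyPrior p ω * lightSign ω = 0 := by
  simp only [Fintype.sum_option, Fintype.sum_bool, heavyPrior, lightSign]; ring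

theorem sum_heavyPrior_mul_lightSign_sq (p : ℝ) :
    ∑ ω, heavyPrior p ω * lightSign ω ^ 2 = 1 - p := by
  simp only [Fintype.sum_option, Fintype.sum_bool, heavyPrior, lightSign]; ring

theorem poisRatio_nonneg {ν r : ℝ} (hr : 0 ≤ r) (c : ℕ) : 0 ≤ poisRatio ν r c :=
  mul_nonneg (Real.exp_pos _).le (pow_nonneg hr c)

theorem exp_sub_exp_le (x y : ℝ) : Real.exp x - Real.exp y ≤ (x - y) * Real.exp x := by
  have h := Real.add_one_le_exp (y - x)
  have h2 : Real.exp y = Real.exp x * Real.exp (y - x) := by rw [← Real.exp_add]; ring_nf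
  have h3 := mul_le_mul_of_nonneg_left h (Real.exp_pos x).le
  rw [h2]
  linarith

/-- Convexity of the exponential: the exponents differ by `H (x - y)²` and the larger is at most 4,
with e⁴ ≤ 81. This measures how well the first two tapes reveal the sign of a bin. -/
theorem sum_tests_first_le {H x y : ℝ} (hH : 0 ≤ H) (hH2 : H ≤ 2) (hx : 0 ≤ x) (hx1 : x ≤ 1)
    (hy : 0 ≤ y) (hy1 : y ≤ 1) :
    Real.exp (H * (x * x)) * Real.exp (H * (y * y)) + Real.exp (H * (y * y)) *
      Real.exp (H * (x * x)) - 2 * (Real.exp (H * (x * y)) * Real.exp (H * (x * y))) ≤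
      162 * (H * (x - y) ^ 2) := by
  rw [← Real.exp_add, ← Real.exp_add, ← Real.exp_add]
  have h1 := exp_sub_exp_le (H * (x * x) + H * (y * y)) (H * (x * y) + H * (x * y))
  have h2 : H * (x * x) + H * (y * y) ≤ 4 := by
    have : x * x ≤ 1 := by nlinarith
    have : y * y ≤ 1 := by nlinarith
    nlinarith
  have h3 : Real.exp (H * (x * x) + H * (y * y)) ≤ 81 := by
    calc _ ≤ Real.exp 4 := Real.exp_le_exp.2 h2
      _ = Real.exp 1 ^ 4 := by rw [← Real.exp_nat_mul]; norm_num
      _ ≤ 3 ^ 4 := by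
        gcongr
        have := Real.exp_one_lt_d9
        linarith
      _ = 81 := by norm_num
  have h4 : H * (x * x) + H * (y * y) - (H * (x * y) + H * (x * y)) = H * (x - y) ^ 2 := by ring
  rw [h4] at h1
  have h5 := mul_le_mul_of_nonneg_left h3 (by positivity : 0 ≤ H * (x - y) ^ 2)
  rw [add_comm (H * (y * y))]
  linarith

/-- Factoring out `exp (ν x y)` leaves the exponents `ν x (x - y)` and `-ν y (x - y)`, whose sum is
already quadratic in `x - y`. This is the information on the sign in the third tape. -/
theorem sum_tests_second_le {ν x y : ℝ} (hν : 0 ≤ ν) (hν1 : ν ≤ 1) (hx : 0 ≤ x) (hx1 : x ≤ 1)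
    (hy : 0 ≤ y) (hy1 : y ≤ 1) :
    Real.exp (ν * x ^ 2) + Real.exp (ν * y ^ 2) - 2 * Real.exp (ν * (x * y)) ≤
      9 * (ν * (x - y) ^ 2) := by
  have hd : |x - y| ≤ 1 := by rw [abs_le]; constructor <;> linarith
  have e1 : Real.exp (ν * x ^ 2) = Real.exp (ν * (x * y)) * Real.exp (ν * x * (x - y)) := by
    rw [← Real.exp_add]; ring_nf
  have e2 : Real.exp (ν * y ^ 2) = Real.exp (ν * (x * y)) * Real.exp (-(ν * y * (x - y))) := by
    rw [← Real.exp_add]; ring_nf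
  have b1 : |ν * x * (x - y)| ≤ 1 := by
    rw [abs_mul, abs_of_nonneg (mul_nonneg hν hx)]
    have : ν * x ≤ 1 := by nlinarith
    exact mul_le_one₀ this (abs_nonneg _) hd
  have b2 : |-(ν * y * (x - y))| ≤ 1 := by
    rw [abs_neg, abs_mul, abs_of_nonneg (mul_nonneg hν hy)]
    have : ν * y ≤ 1 := by nlinarith
    exact mul_le_one₀ this (abs_nonneg _) hd
  have c1 := exp_le_one_add_add_sq b1
  have c2 := exp_le_one_add_add_sq b2
  have h3 : Real.exp (ν * (x * y)) ≤ 3 := by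
    calc _ ≤ Real.exp 1 := Real.exp_le_exp.2 (by
          have : x * y ≤ 1 := mul_le_one₀ hx1 hy hy1
          have := mul_nonneg hx hy
          nlinarith)
      _ ≤ 3 := by have := Real.exp_one_lt_d9; linarith
  have h4 : Real.exp (ν * x * (x - y)) + Real.exp (-(ν * y * (x - y))) - 2 ≤
      3 * (ν * (x - y) ^ 2) := by
    have h5 : (ν * x * (x - y)) ^ 2 ≤ ν * (x - y) ^ 2 := by
      have : (ν * x) ^ 2 ≤ ν := by
        have : x ^ 2 ≤ 1 := by nlinarith
        have : ν ^ 2 ≤ ν := by nlinarith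
        rw [mul_pow]; nlinarith [sq_nonneg ν]
      rw [mul_pow]
      exact mul_le_mul_of_nonneg_right this (sq_nonneg _)
    have h6 : (-(ν * y * (x - y))) ^ 2 ≤ ν * (x - y) ^ 2 := by
      have : (ν * y) ^ 2 ≤ ν := by
        have : y ^ 2 ≤ 1 := by nlinarith
        have : ν ^ 2 ≤ ν := by nlinarith
        rw [mul_pow]; nlinarith [sq_nonneg ν]
      rw [neg_sq, mul_pow]
      exact mul_le_mul_of_nonneg_right this (sq_nonneg _)
    linarith
  calc _ = Real.exp (ν * (x * y)) *
        (Real.exp (ν * x * (x - y)) + Real.exp (-(ν * y * (x - y))) - 2) := by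
        rw [e1, e2]; ring
    _ ≤ Real.exp (ν * (x * y)) * (3 * (ν * (x - y) ^ 2)) :=
        mul_le_mul_of_nonneg_left h4 (Real.exp_pos _).le
    _ ≤ 3 * (3 * (ν * (x - y) ^ 2)) := mul_le_mul_of_nonneg_right h3 (by positivity)
    _ = _ := by ring

/-- Heavy bins hide the correlations of the signs of the light bins. -/
theorem affinity_heavy {t s p h l δ : ℝ} (ht : 0 ≤ t) (hs : 0 ≤ s) (hp : 0 < p) (hp1 : p ≤ 1)
    (hh : 0 < h) (hl : 0 ≤ l) (hδ : 0 ≤ δ) (hδ1 : δ ≤ 1) (hlh : 2 * l ≤ h)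
    (hH : t * h ≤ 2) (hν : s * h ≤ 1) :
    ENNReal.ofReal (1 - 2928 * (t * s * l ^ 4 * δ ^ 4 / (h ^ 2 * p))) ≤
      affinity
        (binLaw (heavyPrior p) t s (heavyMass h l δ) (heavyMass h l (-δ)) (heavyMass h l δ))
        (binLaw (heavyPrior p) t s (heavyMass h l δ) (heavyMass h l (-δ))
          (heavyMass h l (-δ))) := by
  have hδa : |δ| ≤ 1 := by rwa [abs_of_nonneg hδ]
  have hδb : |-δ| ≤ 1 := by rwa [abs_neg]
  have hu0 := heavyMass_nonneg hh.le hl hδa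
  have hv0 := heavyMass_nonneg hh.le hl hδb
  have hρ0 := heavyPrior_nonneg hp.le hp1
  have hρ1 := sum_heavyPrior p
  set r := l * (1 + δ) / h with hr
  set r' := l * (1 - δ) / h with hr'
  have hrh : l * (1 + δ) = h * r := by rw [hr]; field_simp
  have hrh' : l * (1 - δ) = h * r' := by rw [hr']; field_simp
  have hr0 : 0 ≤ r := div_nonneg (mul_nonneg hl (by linarith)) hh.le
  have hr0' : 0 ≤ r' := div_nonneg (mul_nonneg hl (by linarith)) hh.le
  have hr1 : r ≤ 1 := by rw [hr, div_le_one hh]; nlinarith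
  have hr1' : r' ≤ 1 := by rw [hr', div_le_one hh]; nlinarith
  set H := t * h with hHdef
  set ν := s * h with hνdef
  have hH0 : 0 ≤ H := mul_nonneg ht hh.le
  have hν0 : 0 ≤ ν := mul_nonneg hs hh.le
  have hF : ∀ i j c, binLaw (heavyPrior p) t s (heavyMass h l δ) (heavyMass h l (-δ))
      (heavyMass h l δ) i j c = pois H i * pois H j * pois ν c * (p + (1 - p) / 2 *
        (poisRatio H r i * poisRatio H r' j * poisRatio ν r c +
          poisRatio H r' i * poisRatio H r j * poisRatio ν r' c)) := by
    intro i j c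
    simp only [binLaw, Fintype.sum_option, Fintype.sum_bool, heavyPrior, heavyMass, lightSign,
      mul_one, mul_neg, neg_neg, ← sub_eq_add_neg]
    rw [hrh, hrh', ← mul_assoc t, ← mul_assoc t, ← mul_assoc s, ← mul_assoc s, ← hHdef, ← hνdef]
    simp only [pois_mul_poisRatio]
    ring
  have hG : ∀ i j c, binLaw (heavyPrior p) t s (heavyMass h l δ) (heavyMass h l (-δ))
      (heavyMass h l (-δ)) i j c = pois H i * pois H j * pois ν c * (p + (1 - p) / 2 *
        (poisRatio H r i * poisRatio H r' j * poisRatio ν r' c +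
          poisRatio H r' i * poisRatio H r j * poisRatio ν r c)) := by
    intro i j c
    simp only [binLaw, Fintype.sum_option, Fintype.sum_bool, heavyPrior, heavyMass, lightSign,
      mul_one, mul_neg, neg_neg, ← sub_eq_add_neg]
    rw [hrh, hrh', ← mul_assoc t, ← mul_assoc t, ← mul_assoc s, ← mul_assoc s, ← hHdef, ← hνdef]
    simp only [pois_mul_poisRatio]
    ring
  have nn : ∀ q q' : ℝ, 0 ≤ q → 0 ≤ q' → ∀ c, 0 ≤ pois H c * (poisRatio H q c * poisRatio H q' c) :=
    fun q q' hq hq' c => mul_nonneg (pois_nonneg hH0 c)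
      (mul_nonneg (poisRatio_nonneg hq c) (poisRatio_nonneg hq' c))
  have nν : ∀ c, 0 ≤ pois ν c * (poisRatio ν r c - poisRatio ν r' c) ^ 2 := fun c =>
    mul_nonneg (pois_nonneg hν0 c) (sq_nonneg _)
  have S1 := hasSum_mul_triple (hasSum_pois_mul_poisRatio H r r) (hasSum_pois_mul_poisRatio H r' r')
    (hasSum_pois_mul_sq_sub ν r r') (nn r r hr0 hr0) (nn r' r' hr0' hr0') nν
  have S2 := hasSum_mul_triple (hasSum_pois_mul_poisRatio H r' r') (hasSum_pois_mul_poisRatio H r r)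
    (hasSum_pois_mul_sq_sub ν r r') (nn r' r' hr0' hr0') (nn r r hr0 hr0) nν
  have S3 := hasSum_mul_triple (hasSum_pois_mul_poisRatio H r r') (hasSum_pois_mul_poisRatio H r r')
    (hasSum_pois_mul_sq_sub ν r r') (nn r r' hr0 hr0') (nn r r' hr0 hr0') nν
  have hsum := ((S1.add S2).sub (S3.mul_left 2)).mul_left (1 / (4 * p))
  refine ofReal_le_affinity (binLaw_nonneg hρ0 ht hs hu0 hv0 hu0)
    (binLaw_nonneg hρ0 ht hs hu0 hv0 hv0) (hasSum_binLaw hρ1 ht hs hu0 hv0 hu0)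
    (hasSum_binLaw hρ1 ht hs hu0 hv0 hv0) hsum ?_ ?_
  · intro i j c
    have hM : 0 ≤ pois H i * pois H j * pois ν c :=
      mul_nonneg (mul_nonneg (pois_nonneg hH0 i) (pois_nonneg hH0 j)) (pois_nonneg hν0 c)
    have e1 := poisRatio_nonneg (ν := H) hr0 i
    have e2 := poisRatio_nonneg (ν := H) hr0' i
    have e3 := poisRatio_nonneg (ν := H) hr0 j
    have e4 := poisRatio_nonneg (ν := H) hr0' j
    have e5 := poisRatio_nonneg (ν := ν) hr0 c
    have e6 := poisRatio_nonneg (ν := ν) hr0' c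
    have h1p : 0 ≤ (1 - p) / 2 := by linarith
    have he : 1 / (4 * p) * (pois H i * (poisRatio H r i * poisRatio H r i) *
          (pois H j * (poisRatio H r' j * poisRatio H r' j)) *
          (pois ν c * (poisRatio ν r c - poisRatio ν r' c) ^ 2) +
        pois H i * (poisRatio H r' i * poisRatio H r' i) *
          (pois H j * (poisRatio H r j * poisRatio H r j)) *
          (pois ν c * (poisRatio ν r c - poisRatio ν r' c) ^ 2) -
        2 * (pois H i * (poisRatio H r i * poisRatio H r' i) *
          (pois H j * (poisRatio H r j * poisRatio H r' j)) *
          (pois ν c * (poisRatio ν r c - poisRatio ν r' c) ^ 2))) =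
        1 / (4 * p) * ((pois H i * pois H j * pois ν c) *
        ((poisRatio H r i * poisRatio H r' j - poisRatio H r' i * poisRatio H r j) *
          (poisRatio ν r c - poisRatio ν r' c)) ^ 2) := by ring
    rw [he]
    -- The denominator keeps only the heavy component of the mixture. The numerator is the product
    -- of a sign test on the first two tapes and one on the third, so its sum factorizes.
    refine sq_sqrt_sub_sqrt_le (d := pois H i * pois H j * pois ν c * p)
      (binLaw_nonneg hρ0 ht hs hu0 hv0 hu0 i j c) (binLaw_nonneg hρ0 ht hs hu0 hv0 hv0 i j c)
      (by positivity) ?_ ?_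
    · have h1 := binLaw_nonneg hρ0 ht hs hu0 hv0 hv0 i j c
      rw [hF]
      have h2 : p ≤ p + (1 - p) / 2 *
        (poisRatio H r i * poisRatio H r' j * poisRatio ν r c +
          poisRatio H r' i * poisRatio H r j * poisRatio ν r' c) :=
        le_add_of_nonneg_right (by positivity)
      have h3 := mul_le_mul_of_nonneg_left h2 hM
      linarith
    · rw [hF, hG]
      set M := pois H i * pois H j * pois ν c
      set D := (poisRatio H r i * poisRatio H r' j - poisRatio H r' i * poisRatio H r j) *
          (poisRatio ν r c - poisRatio ν r' c) with hD
      have h2 : (1 - p) ^ 2 ≤ 1 := by nlinarith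
      calc _ = M ^ 2 * D ^ 2 / 4 * (1 - p) ^ 2 := by rw [hD]; ring
        _ ≤ M ^ 2 * D ^ 2 / 4 * 1 := mul_le_mul_of_nonneg_left h2 (by positivity)
        _ = _ := by field_simp
  · have f1 := sum_tests_first_le hH0 hH (sub_nonneg.2 hr1) (by linarith : 1 - r ≤ 1)
      (sub_nonneg.2 hr1') (by linarith : 1 - r' ≤ 1)
    have f2 := sum_tests_second_le hν0 hν (sub_nonneg.2 hr1) (by linarith : 1 - r ≤ 1)
      (sub_nonneg.2 hr1') (by linarith : 1 - r' ≤ 1)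
    have f3 := (hasSum_pois_mul_sq_sub ν r r').nonneg nν
    have hd : (1 - r - (1 - r')) ^ 2 = 4 * l ^ 2 * δ ^ 2 / h ^ 2 := by
      rw [hr, hr']; field_simp; ring
    rw [hd] at f1 f2
    set K := Real.exp (ν * (1 - r) ^ 2) + Real.exp (ν * (1 - r') ^ 2) -
      2 * Real.exp (ν * ((1 - r) * (1 - r')))
    set E₁ := Real.exp (H * ((1 - r) * (1 - r)))
    set E₂ := Real.exp (H * ((1 - r') * (1 - r')))
    set E₃ := Real.exp (H * ((1 - r) * (1 - r')))
    calc _ = 1 / (4 * p) * ((E₁ * E₂ + E₂ * E₁ - 2 * (E₃ * E₃)) * K) := by ring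
      _ ≤ 1 / (4 * p) * (162 * (H * (4 * l ^ 2 * δ ^ 2 / h ^ 2)) *
          (9 * (ν * (4 * l ^ 2 * δ ^ 2 / h ^ 2)))) := by
          refine mul_le_mul_of_nonneg_left ?_ (by positivity)
          exact mul_le_mul f1 f2 f3 (by positivity)
      _ = 5832 * (t * s * l ^ 4 * δ ^ 4 / (h ^ 2 * p)) := by
          rw [hHdef, hνdef]; field_simp; ring
      _ ≤ _ := by
          have : 0 ≤ t * s * l ^ 4 * δ ^ 4 / (h ^ 2 * p) := by positivity
          linarith

theorem heavyMass_pos {h l δ : ℝ} (hh : 0 < h) (hl : 0 < l) (hδ : |δ| < 1) (ω : Option Bool) :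
    0 < heavyMass h l δ ω := by
  rw [abs_lt] at hδ
  rcases ω with _ | _ | _
  · exact hh
  · simp only [heavyMass, lightSign]
    exact mul_pos hl (by linarith)
  · simp only [heavyMass, lightSign]
    exact mul_pos hl (by linarith)

/-- The last factor is the indicator of a light bin, written so that its sum over bins is governed
by the Chebyshev event. -/
theorem abs_heavyMass_sub (p : ℝ) {h l δ : ℝ} (hl : 0 ≤ l) (hδ : 0 ≤ δ) (ω : Option Bool) :
    |heavyMass h l δ ω - heavyMass h l (-δ) ω| = 2 * (l * δ) * (1 - p - heavyCentered p ω) := by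
  have h0 : 0 ≤ 2 * (l * δ) := by positivity
  rcases ω with _ | _ | _
  · simp [heavyMass, heavyCentered]
  · simp only [heavyMass, heavyCentered, lightSign]
    rw [abs_of_nonpos (by linarith)]; ring
  · simp only [heavyMass, heavyCentered, lightSign]
    rw [abs_of_nonneg (by linarith)]; ring

theorem sum_heavyMass (p h l δ : ℝ) (θ : Fin n → Option Bool) :
    ∑ x, heavyMass h l δ (θ x) = n * (h * p + l * (1 - p)) +
      (h - l) * ∑ x, heavyCentered p (θ x) + l * δ * ∑ x, lightSign (θ x) := by
  simp only [heavyMass_eq p h l δ, Finset.sum_add_distrib, ← Finset.mul_sum, Finset.sum_const,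
    Finset.card_univ, Fintype.card_fin, nsmul_eq_mul]
  ring

/-- Typical total mass of the heavy-light construction. -/
theorem sum_heavyMass_mem {p γ δ Y Z : ℝ} (hn : 0 < n) (hp : 0 < p) (hγ : 0 < γ) (hγ1 : γ ≤ 1 / 2)
    (hpγ : p ≤ γ / 32) (hδ : |δ| ≤ 1) (hY : |Y| ≤ p * (γ / 16)) (hZ : |Z| ≤ γ / 16)
    {θ : Fin n → Option Bool} (hYθ : ∑ x, heavyCentered p (θ x) = n * Y)
    (hZθ : ∑ x, lightSign (θ x) = n * Z) :
    ∑ x, heavyMass (γ / (2 * (n * p))) ((1 - γ / 2) / n) δ (θ x) ∈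
      Set.Icc (1 - γ / 8) (1 + γ / 16) := by
  have hn0 : (0 : ℝ) < n := by exact_mod_cast hn
  rw [sum_heavyMass p, hYθ, hZθ]
  have e : n * (γ / (2 * (n * p)) * p + (1 - γ / 2) / n * (1 - p)) +
      (γ / (2 * (n * p)) - (1 - γ / 2) / n) * (n * Y) + (1 - γ / 2) / n * δ * (n * Z) =
      1 - (1 - γ / 2) * p + γ / 2 * (Y / p) - (1 - γ / 2) * Y + (1 - γ / 2) * (δ * Z) := by
    field_simp; ring
  rw [e]
  have h1 : |Y / p| ≤ γ / 16 := by
    rw [abs_div, abs_of_pos hp, div_le_iff₀ hp]; linarith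
  have h2 : |δ * Z| ≤ γ / 16 := by
    rw [abs_mul]
    calc _ ≤ 1 * (γ / 16) := mul_le_mul hδ hZ (abs_nonneg _) (by norm_num)
      _ = _ := one_mul _
  have h3 : |Y| ≤ p := by nlinarith
  rw [abs_le] at h1 h2 h3 hY
  have hl : 0 ≤ 1 - γ / 2 := by linarith
  have a1 := mul_le_mul_of_nonneg_left h1.1 (by linarith : 0 ≤ γ / 2)
  have a2 := mul_le_mul_of_nonneg_left h1.2 (by linarith : 0 ≤ γ / 2)
  have b1 := mul_le_mul_of_nonneg_left h2.1 hl
  have b2 := mul_le_mul_of_nonneg_left h2.2 hl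
  have c1 := mul_le_mul_of_nonneg_left h3.1 hl
  have c2 := mul_le_mul_of_nonneg_left h3.2 hl
  have c3 := mul_le_mul_of_nonneg_left hY.2 hl
  have d : (1 - γ / 2) * (p * (γ / 16)) ≤ γ / 32 * (γ / 16) := by
    have : (1 - γ / 2) * (p * (γ / 16)) ≤ 1 * (p * (γ / 16)) :=
      mul_le_mul_of_nonneg_right (by linarith) (by positivity)
    nlinarith
  have f : (1 - γ / 2) * p ≤ (1 - γ / 2) * (γ / 32) := mul_le_mul_of_nonneg_left hpγ hl
  constructor <;> nlinarith

/-- Isolates the effect of unequal normalizations: the correction is proportional to the probability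
`v / W'`, hence sums to `|W - W'| / W`. -/
theorem sub_le_abs_div_sub_div {u v W W' : ℝ} (hW : 0 < W) (hW' : 0 < W') (hv : 0 ≤ v) :
    |u - v| / W - v / W' * (|W - W'| / W) ≤ |u / W - v / W'| := by
  have e : u / W - v / W' = (u - v) / W - v / W' * ((W - W') / W) := by
    field_simp; ring
  have h := abs_sub_abs_le_abs_sub ((u - v) / W) (v / W' * ((W - W') / W))
  rw [← e, abs_mul, abs_div, abs_div (W - W'), abs_of_pos hW, abs_of_nonneg (div_nonneg hv hW'.le)]
    at h
  exact h

/-- The light bins have total mass about `1 - γ / 2`, and on each the masses differ by the relative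
amount `2 δ`. The remaining room up to `1 - γ` absorbs the fluctuations of the heavy count, of the
signs and of the normalizations. -/
theorem le_tvDist_heavy {p γ δ Y Z : ℝ} (hn : 0 < n) (hp : 0 < p) (hγ : 0 < γ) (hγ1 : γ ≤ 1 / 2)
    (hpγ : p ≤ γ / 32) (hδ : 0 ≤ δ) (hδ1 : δ ≤ 1) (hY : |Y| ≤ p * (γ / 16)) (hZ : |Z| ≤ γ / 16)
    {θ : Fin n → Option Bool} (hYθ : ∑ x, heavyCentered p (θ x) = n * Y)
    (hZθ : ∑ x, lightSign (θ x) = n * Z) {P Q : PMF (Fin n)}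
    (hP : IsNormalized (fun x => heavyMass (γ / (2 * (n * p))) ((1 - γ / 2) / n) δ (θ x)) P)
    (hQ : IsNormalized (fun x => heavyMass (γ / (2 * (n * p))) ((1 - γ / 2) / n) (-δ) (θ x)) Q) :
    δ * (1 - γ) ≤ tvDist P Q := by
  have hn0 : (0 : ℝ) < n := by exact_mod_cast hn
  have hWm := sum_heavyMass_mem hn hp hγ hγ1 hpγ (by rwa [abs_of_nonneg hδ]) hY hZ hYθ hZθ
  have hVm := sum_heavyMass_mem (δ := -δ) hn hp hγ hγ1 hpγ (by rwa [abs_neg, abs_of_nonneg hδ])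
    hY hZ hYθ hZθ
  rw [hP.tvDist_eq hQ]
  set h := γ / (2 * (n * p))
  set l := (1 - γ / 2) / n with hl
  have hl0 : 0 ≤ l := div_nonneg (by linarith) hn0.le
  have hln : l * n = 1 - γ / 2 := by rw [hl]; field_simp
  have hdiff : ∑ x, heavyMass h l δ (θ x) - ∑ x, heavyMass h l (-δ) (θ x) =
      2 * ((1 - γ / 2) * δ * Z) := by
    rw [sum_heavyMass p, sum_heavyMass p, hZθ, ← hln]; ring
  set W := ∑ x, heavyMass h l δ (θ x)
  set V := ∑ x, heavyMass h l (-δ) (θ x) with hV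
  have hW0 : 0 < W := by linarith [hWm.1]
  have hV0 : 0 < V := by linarith [hVm.1]
  have hsum := Finset.sum_le_sum fun x (_ : x ∈ (Finset.univ : Finset (Fin n))) =>
    sub_le_abs_div_sub_div (u := heavyMass h l δ (θ x)) hW0 hV0 (hQ.1 x)
  simp only [abs_heavyMass_sub p hl0 hδ] at hsum
  rw [Finset.sum_sub_distrib, ← Finset.sum_div, ← Finset.mul_sum, ← Finset.sum_mul,
    ← Finset.sum_div, ← hV, div_self hV0.ne', one_mul, Finset.sum_sub_distrib, hYθ, hdiff] at hsum
  simp only [Finset.sum_const, Finset.card_univ, Fintype.card_fin, nsmul_eq_mul] at hsum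
  have h0 : 0 ≤ (1 - γ / 2) * δ := mul_nonneg (by linarith) hδ
  have e : 2 * (l * δ) * (n * (1 - p) - n * Y) / W - |2 * ((1 - γ / 2) * δ * Z)| / W =
      2 * ((1 - γ / 2) * δ * (1 - p - Y - |Z|) / W) := by
    rw [abs_mul, abs_mul, abs_of_nonneg h0, abs_of_pos (by norm_num : (0 : ℝ) < 2), ← hln]
    field_simp
  rw [e] at hsum
  refine le_trans ?_ (by linarith :
    (1 - γ / 2) * δ * (1 - p - Y - |Z|) / W ≤ _)
  rw [le_div_iff₀ hW0]
  have h3 : 1 - γ / 8 ≤ 1 - p - Y - |Z| := by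
    have := (abs_le.1 hY).2
    nlinarith
  calc δ * (1 - γ) * W ≤ δ * (1 - γ) * (1 + γ / 16) :=
        mul_le_mul_of_nonneg_left hWm.2 (mul_nonneg hδ (by linarith))
    _ ≤ (1 - γ / 2) * δ * (1 - γ / 8) := by
        rw [mul_comm (1 - γ / 2), mul_assoc, mul_assoc]
        exact mul_le_mul_of_nonneg_left (by nlinarith) hδ
    _ ≤ _ := mul_le_mul_of_nonneg_left h3 h0

/-- Chebyshev twice, with 1/40 for each event; 10240 = 40 · 16² is what the heavy count needs, and
the sign sum needs less. -/
theorem priorSum_heavy_le {p γ : ℝ} (hn : 0 < n) (hp : 0 < p) (hp1 : p ≤ 1) (hγ : 0 < γ)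
    (hnp : 10240 ≤ n * p * γ ^ 2) [DecidablePred fun θ : Fin n → Option Bool =>
      |∑ x, heavyCentered p (θ x)| ≤ n * (p * (γ / 16)) ∧ |∑ x, lightSign (θ x)| ≤ n * (γ / 16)] :
    priorSum (heavyPrior p) (fun θ : Fin n → Option Bool =>
      if |∑ x, heavyCentered p (θ x)| ≤ n * (p * (γ / 16)) ∧
        |∑ x, lightSign (θ x)| ≤ n * (γ / 16) then 0 else 1) ≤ ENNReal.ofReal (1 / 20) := by
  classical
  have hn0 : (0 : ℝ) < n := by exact_mod_cast hn
  have h1 := priorSum_chebyshev_le (n := n) (a := n * (p * (γ / 16))) (b := 1 / 40)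
    (heavyPrior_nonneg hp.le hp1)
    (sum_heavyPrior p) (sum_heavyPrior_mul_heavyCentered p) (by positivity) (by
      rw [sum_heavyPrior_mul_heavyCentered_sq]
      have := mul_le_mul_of_nonneg_left hnp (by positivity : 0 ≤ n * p)
      have h2 : 0 ≤ (n : ℝ) * p ^ 2 := by positivity
      nlinarith)
  have h2 := priorSum_chebyshev_le (n := n) (a := n * (γ / 16)) (b := 1 / 40)
    (heavyPrior_nonneg hp.le hp1)
    (sum_heavyPrior p) (sum_heavyPrior_mul_lightSign p) (by positivity) (by
      rw [sum_heavyPrior_mul_lightSign_sq]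
      have h3 : (n : ℝ) * p * γ ^ 2 ≤ n * γ ^ 2 := by
        have : 0 ≤ (n : ℝ) * γ ^ 2 := by positivity
        nlinarith
      have := mul_le_mul_of_nonneg_left (hnp.trans h3) hn0.le
      nlinarith)
  refine le_trans ?_ ((add_le_add h1 h2).trans ?_)
  · rw [← priorSum_add]
    refine priorSum_mono fun θ => ?_
    by_cases ha : |∑ x, heavyCentered p (θ x)| ≤ n * (p * (γ / 16)) <;>
      by_cases hb : |∑ x, lightSign (θ x)| ≤ n * (γ / 16) <;> simp [ha, hb]
  · rw [← ENNReal.ofReal_add (by norm_num) (by norm_num)]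
    norm_num

/-- Lower bound from pairs that differ on light bins, hidden among a fraction `p` of heavy bins. -/
theorem Algorithm.Recovers.le_of_bothUnknown_heavy {A : Algorithm n k} {T r : ℕ} {ε γ p : ℝ}
    (hk : 100 ≤ k) (hr : 1 ≤ r) (hrk : r < k) (hε : 0 < ε) (hγ : 0 < γ) (hγ1 : γ ≤ 1 / 2)
    (hεγ : ε < 1 - γ) (hp : 0 < p) (hpγ : p ≤ γ / 32) (hnp : 10240 ≤ n * p * γ ^ 2)
    (hT : 32 * T ≤ n * p) (hA : A.Recovers T r (bothUnknown n ε)) :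
    (k : ℝ) * n * γ ^ 2 ≤ 10 ^ 13 * (T ^ 2 * p * ε ^ 4) := by
  classical
  have hn0' : 0 < n := by
    rcases Nat.eq_zero_or_pos n with rfl | h
    · norm_num at hnp
    · exact h
  have hn0 : (0 : ℝ) < n := by exact_mod_cast hn0'
  have hk0 : (0 : ℝ) < k := by exact_mod_cast (by omega : 0 < k)
  have hk100 : (100 : ℝ) ≤ k := by exact_mod_cast hk
  have hγ' : 0 < 1 - γ := by linarith
  have hp1 : p ≤ 1 := by linarith
  set δ := ε / (1 - γ) with hδdef
  have hδ : 0 < δ := by positivity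
  have hδ1 : δ < 1 := by rw [hδdef, div_lt_one hγ']; exact hεγ
  have hεδ : ε = δ * (1 - γ) := by rw [hδdef]; field_simp
  have hδ2 : δ ≤ 2 * ε := by rw [hδdef, div_le_iff₀ hγ']; nlinarith
  have hδa : |δ| < 1 := by rwa [abs_of_pos hδ]
  have hδb : |-δ| < 1 := by rwa [abs_neg]
  set h := γ / (2 * (n * p)) with hh
  set l := (1 - γ / 2) / n with hl
  have hh0 : 0 < h := by positivity
  have hl0 : 0 < l := div_pos (by linarith) hn0
  have hpos : ∀ s : ℝ, |s| < 1 → ∀ θ : Fin n → Option Bool, 0 < ∑ x, heavyMass h l s (θ x) := by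
    intro s hs θ
    have : Nonempty (Fin n) := ⟨⟨0, hn0'⟩⟩
    exact Finset.sum_pos (fun x _ => heavyMass_pos hh0 hl0 hs _) Finset.univ_nonempty
  have hP := fun θ : Fin n → Option Bool => isNormalized_massPMF
    (fun x => heavyMass h l δ (θ x)) (fun x => (heavyMass_pos hh0 hl0 hδa _).le) (hpos δ hδa θ)
  have hQ := fun θ : Fin n → Option Bool => isNormalized_massPMF
    (fun x => heavyMass h l (-δ) (θ x)) (fun x => (heavyMass_pos hh0 hl0 hδb _).le)
    (hpos (-δ) hδb θ)
  have hmean : ∀ (f : Option Bool → ℝ) (a : ℝ) (θ : Fin n → Option Bool),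
      |∑ x, f (θ x)| ≤ n * a → ∃ Y : ℝ, |Y| ≤ a ∧ ∑ x, f (θ x) = n * Y := by
    intro f a θ hθ
    refine ⟨(∑ x, f (θ x)) / n, ?_, by field_simp⟩
    rw [abs_div, abs_of_pos hn0, div_le_iff₀ hn0]; linarith
  have hmass : ∀ (s : ℝ) (θ : Fin n → Option Bool), |s| < 1 →
      |∑ x, heavyCentered p (θ x)| ≤ n * (p * (γ / 16)) ∧
        |∑ x, lightSign (θ x)| ≤ n * (γ / 16) → 1 / 2 ≤ ∑ x, heavyMass h l s (θ x) := by
    intro s θ hs hθ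
    obtain ⟨Y, hY, hYθ⟩ := hmean _ _ θ hθ.1
    obtain ⟨Z, hZ, hZθ⟩ := hmean _ _ θ hθ.2
    have := (sum_heavyMass_mem hn0' hp hγ hγ1 hpγ hs.le hY hZ hYθ hZθ).1
    linarith
  let H : HardFamily n (Option Bool) (bothUnknown n ε) :=
    { ρ := heavyPrior p
      ρ_nonneg := heavyPrior_nonneg hp.le hp1
      ρ_sum := sum_heavyPrior p
      u := fun _ => heavyMass h l δ
      v := fun _ => heavyMass h l (-δ)
      u_nonneg := fun _ ω => (heavyMass_pos hh0 hl0 hδa ω).le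
      v_nonneg := fun _ ω => (heavyMass_pos hh0 hl0 hδb ω).le
      P := _
      Q := _
      P_norm := hP
      Q_norm := hQ
      G := fun θ => |∑ x, heavyCentered p (θ x)| ≤ n * (p * (γ / 16)) ∧
        |∑ x, lightSign (θ x)| ≤ n * (γ / 16)
      G_mem := by
        intro θ hθ
        obtain ⟨Y, hY, hYθ⟩ := hmean _ _ θ hθ.1
        obtain ⟨Z, hZ, hZθ⟩ := hmean _ _ θ hθ.2
        have := le_tvDist_heavy hn0' hp hγ hγ1 hpγ hδ.le hδ1.le hY hZ hYθ hZθ (hP θ) (hQ θ)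
        rwa [← hεδ] at this
      G_u := fun θ => hmass δ θ hδa
      G_v := fun θ => hmass (-δ) θ hδb
      G_prob := priorSum_heavy_le hn0' hp hp1 hγ hnp }
  obtain ⟨N, hN, hnot⟩ := H.exists_not_close hk hr hrk hA
  by_contra hcon
  rw [not_le] at hcon
  have hm : 0 < n * p := by positivity
  have hNk : (N : ℝ) ≤ 80 * T / k := by rw [le_div_iff₀ hk0]; exact hN
  -- `N ≤ 80 * T / k` and `k ≥ 100` give `40 * N ≤ 32 * T`, whence the factor 32 in `hT`. It keeps
  -- the expected counts of a heavy bin bounded, as `affinity_heavy` requires.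
  have hN32 : 40 * (N : ℝ) ≤ n * p := by nlinarith [(Nat.cast_nonneg N : (0 : ℝ) ≤ N)]
  refine hnot ⟨fun _ => 2928 * (40 * T * (40 * N) * l ^ 4 * δ ^ 4 / (h ^ 2 * p)),
    fun _ => by positivity, ?_, fun x => affinity_heavy (by positivity) (by positivity) hp hp1 hh0
      hl0.le hδ.le hδ1.le ?_ ?_ ?_⟩
  · simp only [Finset.sum_const, Finset.card_univ, Fintype.card_fin, nsmul_eq_mul]
    have hl1 : l ≤ 1 / n := by rw [hl]; gcongr; linarith
    calc n * (2928 * (40 * T * (40 * N) * l ^ 4 * δ ^ 4 / (h ^ 2 * p)))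
        ≤ n * (2928 * (40 * T * (40 * (80 * T / k)) * (1 / n) ^ 4 * (2 * ε) ^ 4 /
          (h ^ 2 * p))) := by gcongr
      _ = 2928 * 8192000 * (T ^ 2 * p * ε ^ 4) / (k * n * γ ^ 2) := by
          rw [hh]; field_simp; ring
      _ ≤ 1 / 200 := by
          rw [div_le_div_iff₀ (by positivity) (by norm_num)]
          have : 0 ≤ (T : ℝ) ^ 2 * p * ε ^ 4 := by positivity
          linarith
  · rw [hh, hl, mul_div_assoc', div_le_div_iff₀ hn0 (by positivity)]
    nlinarith
  · rw [hh, mul_div_assoc', div_le_iff₀ (by positivity)]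
    nlinarith [(Nat.cast_nonneg T : (0 : ℝ) ≤ T)]
  · rw [hh, mul_div_assoc', div_le_iff₀ (by positivity)]
    nlinarith [(Nat.cast_nonneg N : (0 : ℝ) ≤ N)]

/-! ### Combination of the regimes. -/

theorem Algorithm.Recovers.mono {A : Algorithm n k} {T r : ℕ}
    {C C' : Set (PMF (Fin n) × PMF (Fin n))} (h : C ⊆ C') (hA : A.Recovers T r C') :
    A.Recovers T r C :=
  fun P Q hPQ => hA P Q (h hPQ)

theorem oneUniform_subset_bothUnknown (n : ℕ) (ε : ℝ) : oneUniform n ε ⊆ bothUnknown n ε :=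
  fun _ h => h.1

/-- The number of bins up to which the dependence on `n` is absorbed in the constants is the square
of `binThreshold γ`. -/
noncomputable def binThreshold (γ : ℝ) : ℝ := 327680 / γ ^ 3

/-- Constant of the bound on `√(n * k)`. -/
noncomputable def sqrtConst (γ : ℝ) : ℝ :=
  binThreshold γ * (2560000 / γ) + 31623 / (γ / 8) ^ 3

/-- Constant of the bound on the cube root. -/
noncomputable def cbrtConst (γ : ℝ) : ℝ :=
  binThreshold γ ^ 2 * (2560000 / γ) + sqrtConst γ + 10 ^ 6 / γ

theorem binThreshold_pos {γ : ℝ} (hγ : 0 < γ) : 0 < binThreshold γ := by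
  unfold binThreshold; positivity

theorem sqrtConst_pos {γ : ℝ} (hγ : 0 < γ) : 0 < sqrtConst γ := by
  have := binThreshold_pos hγ
  unfold sqrtConst; positivity

theorem one_le_binThreshold {γ : ℝ} (hγ : 0 < γ) (hγ1 : γ ≤ 1 / 2) : 1 ≤ binThreshold γ := by
  rw [binThreshold, one_le_div (by positivity)]
  have : γ ^ 3 ≤ 1 := pow_le_one₀ hγ.le (by linarith)
  linarith

/-- For bounded `n` the bound on `k` already implies the claim; for large `n` the perturbed family
applies with `p = γ / 8`. The bound on `k` enters as a hypothesis because parts (a) and (b) obtain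
it from different pairs. The constant 31623 is √(10⁹) rounded up. -/
theorem Algorithm.Recovers.sqrt_le {A : Algorithm n k} {T r : ℕ} {ε γ : ℝ} (hk : 100 ≤ k)
    (hr : 1 ≤ r) (hrk : r < k) (hε : 0 < ε) (hγ : 0 < γ) (hγ1 : γ ≤ 1 / 2) (hεγ : ε < 1 - γ)
    (hkT : (k : ℝ) ≤ 2560000 / γ * (T * ε ^ 2)) (hA : A.Recovers T r (oneUniform n ε)) :
    √(n * k) ≤ sqrtConst γ * (T * ε ^ 2) := by
  have hq := binThreshold_pos hγ
  have hX : 0 ≤ (T : ℝ) * ε ^ 2 := by positivity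
  have hk0 : (1 : ℝ) ≤ k := by exact_mod_cast (by omega : 1 ≤ k)
  rw [sqrtConst, add_mul]
  by_cases hn : (n : ℝ) ≤ binThreshold γ ^ 2
  · have h1 : √(n * k) ≤ binThreshold γ * k := by
      refine Real.sqrt_le_iff.2 ⟨by positivity, ?_⟩
      calc (n : ℝ) * k ≤ binThreshold γ ^ 2 * (k * k) := by
            gcongr
            nlinarith
        _ = _ := by ring
    have h2 := mul_le_mul_of_nonneg_left hkT hq.le
    have h3 : 0 ≤ 31623 / (γ / 8) ^ 3 * (T * ε ^ 2) := by positivity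
    linarith
  · rw [not_le] at hn
    have hq1 := one_le_binThreshold hγ hγ1
    have hnq : binThreshold γ ≤ n := by nlinarith
    have h20 : 20 ≤ n * (γ / 8) ^ 3 := by
      rw [binThreshold, div_le_iff₀ (by positivity)] at hnq
      rw [div_pow, mul_div_assoc', le_div_iff₀ (by norm_num)]
      linarith
    have h1 := hA.le_of_oneUniform_perturbed hk hr hrk hε (by positivity : 0 < γ / 8) (by linarith)
      (by linarith) h20
    have h2 : √(n * k) ≤ 31623 / (γ / 8) ^ 3 * (T * ε ^ 2) := by
      refine Real.sqrt_le_iff.2 ⟨by positivity, ?_⟩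
      rw [mul_pow, div_pow, div_mul_eq_mul_div, le_div_iff₀ (by positivity)]
      calc (n : ℝ) * k * ((γ / 8) ^ 3) ^ 2 = n * k * (γ / 8) ^ 5 * (γ / 8) := by ring
        _ ≤ n * k * (γ / 8) ^ 5 * 1 := by gcongr; linarith
        _ ≤ 10 ^ 9 * (T * ε ^ 2) ^ 2 := by rw [mul_one]; exact h1
        _ ≤ _ := by gcongr; norm_num
    have h3 : 0 ≤ binThreshold γ * (2560000 / γ) * (T * ε ^ 2) := by positivity
    linarith

/-- The three summands of `cbrtConst` serve three regimes: bounded `n`, where k/ε² dominates; `n ε⁴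
≤ k`, where √(nk)/ε² dominates; and the rest, where the heavy-light family is needed. -/
theorem Algorithm.Recovers.cbrt_le {A : Algorithm n k} {T r : ℕ} {ε γ : ℝ} (hn : 2 ≤ n)
    (hk : 100 ≤ k)
    (hr : 1 ≤ r) (hrk : r < k) (hε : 0 < ε) (hγ : 0 < γ) (hγ1 : γ ≤ 1 / 2) (hεγ : ε < 1 - γ)
    (hkT : (k : ℝ) ≤ 2560000 / γ * (T * ε ^ 2)) (hA : A.Recovers T r (bothUnknown n ε)) :
    ((k : ℝ) * (n : ℝ) ^ 2 / ε ^ 4) ^ (1 / 3 : ℝ) ≤ cbrtConst γ * T := by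
  have hq := binThreshold_pos hγ
  have hs := sqrtConst_pos hγ
  have hn0 : (0 : ℝ) < n := by exact_mod_cast (by omega : 0 < n)
  have hk0 : (1 : ℝ) ≤ k := by exact_mod_cast (by omega : 1 ≤ k)
  have hε1 : ε ≤ 1 := by linarith
  have hT0 : (0 : ℝ) ≤ T := Nat.cast_nonneg T
  set B := ((k : ℝ) * (n : ℝ) ^ 2 / ε ^ 4) ^ (1 / 3 : ℝ) with hB
  have hB0 : 0 < B := by positivity
  have hB3 : B ^ 3 = k * n ^ 2 / ε ^ 4 := by
    rw [hB, ← Real.rpow_natCast, ← Real.rpow_mul (by positivity)]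
    norm_num
  have hc1 : 0 ≤ binThreshold γ ^ 2 * (2560000 / γ) * T := by positivity
  have hc2 : 0 ≤ sqrtConst γ * T := by positivity
  have hc3 : 0 ≤ 10 ^ 6 / γ * T := by positivity
  rw [cbrtConst, add_mul, add_mul]
  have hε6 : ε ^ 6 ≤ ε ^ 4 := pow_le_pow_of_le_one hε.le hε1 (by norm_num)
  have hk3 : (k : ℝ) ≤ k ^ 3 := le_self_pow₀ hk0 (by norm_num)
  by_cases hnq : (n : ℝ) ≤ binThreshold γ ^ 2
  · have hq1 := one_le_binThreshold hγ hγ1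
    have h1 : B ≤ binThreshold γ ^ 2 * (k / ε ^ 2) := by
      refine le_of_pow_le_pow_left₀ (n := 3) (by norm_num) (by positivity) ?_
      rw [hB3]
      calc (k : ℝ) * n ^ 2 / ε ^ 4 ≤ k ^ 3 * (binThreshold γ ^ 2) ^ 2 / ε ^ 6 := by gcongr
        _ ≤ k ^ 3 * (binThreshold γ ^ 2) ^ 3 / ε ^ 6 := by
          gcongr
          · exact one_le_pow₀ hq1
          · norm_num
        _ = _ := by field_simp
    have h2 : k / ε ^ 2 ≤ 2560000 / γ * T := by
      rw [div_le_iff₀ (by positivity)]; linarith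
    have h3 := mul_le_mul_of_nonneg_left h2 (by positivity : 0 ≤ binThreshold γ ^ 2)
    linarith
  · rw [not_le] at hnq
    by_cases hkn : n * ε ^ 4 ≤ k
    · have h1 : B ≤ √(n * k) / ε ^ 2 := by
        refine le_of_pow_le_pow_left₀ (n := 6) (by norm_num) (by positivity) ?_
        have e1 : B ^ 6 = (k * n ^ 2 / ε ^ 4) ^ 2 := by rw [← hB3]; ring
        have e2 : (√(n * k) / ε ^ 2) ^ 6 = (n * k / ε ^ 4) ^ 3 := by
          have h := Real.sq_sqrt (by positivity : (0 : ℝ) ≤ n * k)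
          generalize √(n * k) = z at h
          rw [← h]
          field_simp
        rw [e1, e2]
        have e3 : ((k : ℝ) * n ^ 2 / ε ^ 4) ^ 2 = (n ^ 3 * k ^ 2 / ε ^ 12) * (n * ε ^ 4) := by
          field_simp
        have e4 : ((n : ℝ) * k / ε ^ 4) ^ 3 = (n ^ 3 * k ^ 2 / ε ^ 12) * k := by
          field_simp
        rw [e3, e4]
        exact mul_le_mul_of_nonneg_left hkn (by positivity)
      have h2 := (hA.mono (oneUniform_subset_bothUnknown n ε)).sqrt_le hk hr hrk hε hγ hγ1 hεγ hkT
      have h3 : √(n * k) / ε ^ 2 ≤ sqrtConst γ * T := by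
        rw [div_le_iff₀ (by positivity)]; linarith
      linarith
    · rw [not_le] at hkn
      have hq1 := one_le_binThreshold hγ hγ1
      have hBn : B ≤ n := by
        refine le_of_pow_le_pow_left₀ (n := 3) (by norm_num) (by positivity) ?_
        rw [hB3, div_le_iff₀ (by positivity)]
        calc (k : ℝ) * n ^ 2 ≤ n * ε ^ 4 * n ^ 2 := by gcongr
          _ = _ := by ring
      -- This is why the cutoff on `n` is the square of `binThreshold γ`: `B³ ≥ n²` then exceeds its
      -- fourth power.
      have hqB : binThreshold γ ≤ B := by
        refine le_of_pow_le_pow_left₀ (n := 3) (by norm_num) hB0.le ?_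
        rw [hB3, le_div_iff₀ (by positivity)]
        calc binThreshold γ ^ 3 * ε ^ 4 ≤ binThreshold γ ^ 4 * 1 := by
              gcongr
              · norm_num
              · exact pow_le_one₀ hε.le hε1
          _ = 1 * (binThreshold γ ^ 2) ^ 2 := by ring
          _ ≤ _ := by gcongr
      -- Chosen so that `n p` is a multiple of the target `B`. `B ≤ n` makes `p` admissible, and `B
      -- ≥ binThreshold γ` is exactly `n p γ² ≥ 10240`.
      set p := γ / 32 * (B / n) with hp
      have hp0 : 0 < p := by positivity
      have hnp : n * p = γ / 32 * B := by rw [hp]; field_simp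
      have hB6 : B ≤ 10 ^ 6 / γ * T := by
        rw [div_mul_eq_mul_div, le_div_iff₀ hγ]
        -- If the inequality fails, `T` already exceeds a multiple of `B`. If it holds, the family's
        -- bound becomes `B² γ ≤ (10 ^ 13 / 32) T²` after cancelling `B γ ε⁴`.
        by_cases hT : 32 * T ≤ n * p
        · have h1 := hA.le_of_bothUnknown_heavy hk hr hrk hε hγ hγ1 hεγ hp0 (by
              rw [hp]
              exact mul_le_of_le_one_right (by positivity) ((div_le_one hn0).2 hBn)) (by
              rw [hnp]
              rw [binThreshold, div_le_iff₀ (by positivity)] at hqB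
              linarith) hT
          have hkB : (k : ℝ) * n ^ 2 = B ^ 3 * ε ^ 4 := by rw [hB3]; field_simp
          have h2 : B ^ 2 * γ * (B * γ * ε ^ 4) ≤
              10 ^ 13 / 32 * (T : ℝ) ^ 2 * (B * γ * ε ^ 4) := by
            calc B ^ 2 * γ * (B * γ * ε ^ 4) = n * (k * n * γ ^ 2) := by
                  linear_combination -γ ^ 2 * hkB
              _ ≤ n * (10 ^ 13 * (T ^ 2 * p * ε ^ 4)) := mul_le_mul_of_nonneg_left h1 hn0.le
              _ = 10 ^ 13 * T ^ 2 * ε ^ 4 * (n * p) := by ring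
              _ = _ := by rw [hnp]; ring
          have h3 := le_of_mul_le_mul_right h2 (by positivity)
          refine le_of_pow_le_pow_left₀ (n := 2) (by norm_num) (by positivity) ?_
          have h4 : (B * γ) ^ 2 ≤ B ^ 2 * γ := by
            have : γ ^ 2 ≤ γ := by nlinarith
            rw [mul_pow]; gcongr
          nlinarith [sq_nonneg (T : ℝ)]
        · rw [hnp] at hT
          linarith
      linarith

end DistClustering


/-! ### Choice of the constant and conclusion. -/

theorem theorem4p2 (ε₀ : ℝ) (hε₀ : ε₀ < 1) :
    ∃ c : ℝ, 0 < c ∧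
      ∀ (n k r T : ℕ) (ε : ℝ), 2 ≤ n → 100 ≤ k → 1 ≤ r → r < k → 0 < ε → ε ≤ ε₀ →
        ∀ A : DistClustering.Algorithm n k,
          (ε ≤ 1 - 1 / (n : ℝ) →
            A.Recovers T r (DistClustering.oneUniform n ε) →
              c * (((k : ℝ) + Real.sqrt ((n : ℝ) * (k : ℝ))) / ε ^ 2) ≤ (T : ℝ)) ∧
          (A.Recovers T r (DistClustering.bothUnknown n ε) →
              c * (((k : ℝ) * (n : ℝ) ^ 2 / ε ^ 4) ^ (1 / 3 : ℝ)
                + ((k : ℝ) + Real.sqrt ((n : ℝ) * (k : ℝ))) / ε ^ 2) ≤ (T : ℝ)) := by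
  obtain ⟨γ, hγ, hγ1, hγε⟩ : ∃ γ : ℝ, 0 < γ ∧ γ ≤ 1 / 2 ∧ ε₀ < 1 - γ :=
    ⟨min (1 / 2) ((1 - ε₀) / 2), lt_min (by norm_num) (by linarith), min_le_left _ _, by
      have := min_le_right (1 / 2) ((1 - ε₀) / 2)
      linarith⟩
  have hq := DistClustering.binThreshold_pos hγ
  have hs := DistClustering.sqrtConst_pos hγ
  have hb : 0 < DistClustering.cbrtConst γ := by
    unfold DistClustering.cbrtConst; positivity
  have hγk : 0 < 2560000 / γ := by positivity
  set C := DistClustering.cbrtConst γ + (2560000 / γ + DistClustering.sqrtConst γ) with hC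
  have hC0 : 0 < C := by positivity
  refine ⟨1 / C, by positivity, ?_⟩
  intro n k r T ε hn hk hr hrk hε hεε A
  have hεγ : ε < 1 - γ := by linarith
  have hX : 0 ≤ (T : ℝ) * ε ^ 2 := by positivity
  have hmain : (k : ℝ) ≤ 2560000 / γ * (T * ε ^ 2) →
      A.Recovers T r (DistClustering.oneUniform n ε) →
      ((k : ℝ) + √(n * k)) / ε ^ 2 ≤ (2560000 / γ + DistClustering.sqrtConst γ) * T := by
    intro hkT hA
    have h1 := hA.sqrt_le hk hr hrk hε hγ hγ1 hεγ hkT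
    rw [div_le_iff₀ (by positivity)]
    linarith
  refine ⟨fun hεn hA => ?_, fun hA => ?_⟩
  · have hkT : (k : ℝ) ≤ 2560000 / γ * (T * ε ^ 2) := by
      rw [div_mul_eq_mul_div, le_div_iff₀ hγ]
      exact hA.le_of_oneUniform hn hk hr hrk hε hγ hγ1 hεγ.le hεn
    have h1 := hmain hkT hA
    have h2 : 0 ≤ DistClustering.cbrtConst γ * T := by positivity
    rw [div_mul_eq_mul_div, one_mul, div_le_iff₀ hC0]
    linarith
  -- Here `ε` may exceed `1 - 1 / n`, and then no pair has a uniform member; the bound on `k`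
  -- therefore comes from the two-atom pair.
  · have hkT : (k : ℝ) ≤ 2560000 / γ * (T * ε ^ 2) := by
      refine (hA.le_of_bothUnknown hn hk hr hrk hε (by linarith)).trans ?_
      refine mul_le_mul_of_nonneg_right ?_ hX
      rw [le_div_iff₀ hγ]; linarith
    have h1 := hmain hkT (hA.mono (DistClustering.oneUniform_subset_bothUnknown n ε))
    have h2 := hA.cbrt_le hn hk hr hrk hε hγ hγ1 hεγ hkT
    rw [div_mul_eq_mul_div, one_mul, div_le_iff₀ hC0]
    linarith
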